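/- **Corollary 3.6 (Hölder estimate, parabolic).** Let $n\ge 2$, $\nu>0$, and for $R>0$ put $B_R=\{x\in\mathbb R^n:|x|<R\}$ and $Q_R=B_R\times\,]-R^2,0[$. Let $1\le q,\ell\le\infty$ satisfy $$\alpha=\frac nq+\frac 2\ell-1\in[0,1[ ,$$ where $\frac n\infty=\frac2\infty=0$, and let $K\ge 0$. Then there exist constants $N_5>0$ and $\gamma_1>0$, depending only on $n,\nu,q,\ell$ and $K$, with the following property. Let $R_0>0$, and consider in $Q_{R_0}$ the equation (summation over repeated indices) $$\mathcal M u\equiv \partial_t u-D_i\big(a_{ij}(x;t)D_ju\big)+b_i(x;t)D_iu=0 ,$$ where the $a_{ij}$ are measurable and, for a.e. $(x;t)\in Q_{R_0}$ and all $\xi,\eta\in\mathbb R^n$, $$\nu|\xi|^2\le a_{ij}(x;t)\xi_i\xi_j\le\nu^{-1}|\xi|^2,\qquad |a_{ij}(x;t)\eta_i\xi_j|\le\nu^{-1}|\eta||\xi|$$ (the last inequality follows from the preceding ones when the matrix $(a_{ij})$ is symmetric), and where $\mathbf b=(b_i)\in L_{q,\ell}(Q_{R_0})$, that is, $\mathbf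 b$ is measurable and $\|\mathbf b\|_{q,\ell,Q_{R_0}}<\infty$ with $$\|\mathbf b\|_{q,\ell,Q_R}=\Big\|\,\|\mathbf b(\cdot;t)\|_{L_q(B_R)}\Big\|_{L_\ell(]-R^2,0[)} .$$ Suppose that $\operatorname{div}\mathbf b\le0$ in $Q_{R_0}$ in the sense of distributions (divergence with respect to $x$), and that $$\sup_{0<R<R_0}\widehat{\mathcal N}(R,1,1)\le K,\qquad \widehat{\mathcal N}(R,1,1)=R^{-\alpha}\|\mathbf b\|_{q,\ell,Q_R} .$$ Let $u$ be a Lipschitz solution of $\mathcal Mu=0$ in $Q_{R_0}$, that is, $u$ is Lipschitz in $(x;t)$ on $Q_{R_0}$ and $$\int_{Q_{R_0}}\big(\partial_tu\,\eta+a_{ij}D_juD_i\eta+b_iD_iu\,\eta\big)\,dx\,dt=0$$ for every Lipschitz function $\eta$ with compact support in $Q_{R_0}$. Then $$\underset{Q_\rho}{\mathrm{osc}}\,u\le N_5\Big(\frac\rho r\Big)^{\gamma_1}\,\underset{Q_r}{\mathrm{osc}}\,u,\qquad 0<\rho<r\le R_0,$$ where $\mathrm{osc}_Q\,u=\sup_Qu-\inf_Qu$.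 -/

import Mathlib

open MeasureTheory Set
open scoped ENNReal NNReal

namespace ParabolicHolder

/-- Points `(x; t)` of `ℝⁿ × ℝ`, with `ℝⁿ` Euclidean. -/
abbrev SpaceTime (n : ℕ) : Type := EuclideanSpace ℝ (Fin n) × ℝ

/-- The parabolic cylinder `Q_R = B_R × ]-R², 0[`. -/
def cyl (n : ℕ) (R : ℝ) : Set (SpaceTime n) :=
  Metric.ball (0 : EuclideanSpace ℝ (Fin n)) R ×ˢ Ioo (-R ^ 2) 0

/-- The partial derivative `D_i f` in the space variable `x_i`. -/
noncomputable def spaceDeriv {n : ℕ} (i : Fin n) (f : SpaceTime n → ℝ) (z : SpaceTime n) : ℝ :=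
  lineDeriv ℝ f z (EuclideanSpace.single i 1, 0)

/-- The time derivative `∂_t f`. -/
noncomputable def timeDeriv {n : ℕ} (f : SpaceTime n → ℝ) (z : SpaceTime n) : ℝ :=
  lineDeriv ℝ f z (0, 1)

/-- The oscillation `sup_S f - inf_S f`
(used for nonempty `S` and `f` bounded on `S`). -/
noncomputable def osc {X : Type*} (f : X → ℝ) (S : Set X) : ℝ :=
  sSup (f '' S) - sInf (f '' S)

/-- The exponent `α(q, ℓ) = n/q + 2/ℓ - 1`, with `n/∞ = 2/∞ = 0`
(used for `q, ℓ ∈ [1, ∞]`). -/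
noncomputable def alpha (n : ℕ) (q l : ℝ≥0∞) : ℝ :=
  n * (q⁻¹).toReal + 2 * (l⁻¹).toReal - 1

/-- The anisotropic norm `‖b‖_{q,ℓ,Q_R}`: the `L_ℓ` norm over `t ∈ ]-R², 0[` of the
`L_q(B_R)` norm of `b(·; t)`. -/
noncomputable def mixedNorm {n : ℕ} (q l : ℝ≥0∞) (R : ℝ)
    (b : SpaceTime n → EuclideanSpace ℝ (Fin n)) : ℝ≥0∞ :=
  eLpNorm
    (fun t : ℝ => eLpNorm (fun x => b (x, t)) q
      (volume.restrict (Metric.ball (0 : EuclideanSpace ℝ (Fin n)) R)))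
    l (volume.restrict (Ioo (-R ^ 2) 0))

/-- `b ∈ L_{q,ℓ}(Q_R)`. -/
def MemMixed {n : ℕ} (q l : ℝ≥0∞) (R : ℝ)
    (b : SpaceTime n → EuclideanSpace ℝ (Fin n)) : Prop :=
  AEStronglyMeasurable b (volume.restrict (cyl n R)) ∧ mixedNorm q l R b < ⊤

/-- The scale-invariant quantity `R^{-α} ‖b‖_{q,ℓ,Q_R}`. -/
noncomputable def scaledNorm {n : ℕ} (q l : ℝ≥0∞) (R : ℝ)
    (b : SpaceTime n → EuclideanSpace ℝ (Fin n)) : ℝ≥0∞ :=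
  ENNReal.ofReal (R ^ (-alpha n q l)) * mixedNorm q l R b

/-- Measurable leading coefficients on `Q` with
`ν|ξ|² ≤ a_ij ξ_i ξ_j ≤ ν⁻¹|ξ|²`. The last condition, `|a_ij η_i ξ_j| ≤ ν⁻¹|ξ||η|`, follows from
the previous one when the matrix `(a_ij)` is symmetric; symmetry itself is not required. -/
structure UniformlyParabolic {n : ℕ} (ν : ℝ) (Q : Set (SpaceTime n))
    (a : SpaceTime n → Matrix (Fin n) (Fin n) ℝ) : Prop where
  aemeasurable : ∀ i j, AEMeasurable (fun z => a z i j) (volume.restrict Q)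
  lower : ∀ᵐ z ∂(volume.restrict Q), ∀ ξ : EuclideanSpace ℝ (Fin n),
    ν * ‖ξ‖ ^ 2 ≤ ∑ i, ∑ j, a z i j * ξ i * ξ j
  upper : ∀ᵐ z ∂(volume.restrict Q), ∀ ξ : EuclideanSpace ℝ (Fin n),
    ∑ i, ∑ j, a z i j * ξ i * ξ j ≤ ν⁻¹ * ‖ξ‖ ^ 2
  bound : ∀ᵐ z ∂(volume.restrict Q), ∀ η ξ : EuclideanSpace ℝ (Fin n),
    |∑ i, ∑ j, a z i j * η i * ξ j| ≤ ν⁻¹ * ‖η‖ * ‖ξ‖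

/-- `div b ≤ 0` in `Q` in the sense of distributions (divergence in the space variables):
`⟨div b, φ⟩ = -∫_Q b_i D_i φ ≤ 0` for all nonnegative `φ ∈ C_c^∞(Q)`. -/
def DivNonpos {n : ℕ} (Q : Set (SpaceTime n))
    (b : SpaceTime n → EuclideanSpace ℝ (Fin n)) : Prop :=
  ∀ φ : SpaceTime n → ℝ, ContDiff ℝ ((⊤ : ℕ∞) : WithTop ℕ∞) φ → HasCompactSupport φ → tsupport φ ⊆ Q →
    (∀ z, 0 ≤ φ z) → -(∫ z in Q, ∑ i, b z i * spaceDeriv i φ z) ≤ 0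

/-- `u` is a Lipschitz solution in `Q` of `∂_t u - D_i(a_ij D_j u) + b_i D_i u = 0`: it is
Lipschitz on `Q` in `(x; t)`, and the integral identity holds for every Lipschitz test function
compactly supported in `Q`. -/
structure IsLipschitzSolution {n : ℕ} (Q : Set (SpaceTime n))
    (a : SpaceTime n → Matrix (Fin n) (Fin n) ℝ)
    (b : SpaceTime n → EuclideanSpace ℝ (Fin n)) (u : SpaceTime n → ℝ) : Prop where
  lipschitz : ∃ C : ℝ≥0, LipschitzOnWith C u Q
  weak : ∀ η : SpaceTime n → ℝ, (∃ C : ℝ≥0, LipschitzWith C η) → HasCompactSupport η →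
    tsupport η ⊆ Q →
    ∫ z in Q, (timeDeriv u z * η z
      + ∑ i, ∑ j, a z i j * spaceDeriv j u z * spaceDeriv i η z
      + (∑ i, b z i * spaceDeriv i u z) * η z) = 0

end ParabolicHolder

/-! This is De Giorgi's method on the unit cylinder, made uniform over all scales by parabolic
dilation. The map `(x, t) ↦ (R x, R² t)` carries a solution on `Q_R` to one on `Q_1` with drift `R
b(R x, R² t)`, whose mixed norm is at most `R^{-α}‖b‖_{q,ℓ,Q_R} ≤ K`. Hence it is enough that the
oscillation drops by a fixed factor from `Q_1` to a smaller cylinder (`exists_oscillation_decay`,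
transported to every scale by `exists_osc_le`); iterating the drop over a geometric sequence of
radii gives a power of `ρ / r` (`exists_rpow_bound`).

The drift is under control for two reasons. Testing the equation with `w ζ²`, where `w = (k - u)₊`,
makes the drift term equal to `-½ b·D(w²) ζ²` up to sign conventions. Since `div b ≤ 0`, the
integral of `b·D(w² ζ²)` is nonnegative and sits on the favourable side, so the only remainder is
the integral of `w² ζ b·Dζ` (`UnitSolution.energy`). Moreover `α < 1` means `n/(2q) + 1/ℓ < 1`, so
`1 + |b|` is a subcritical weight: by Hölder and Sobolev its integral against `|W|^{2+2δ}` is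
bounded by the energy of `W` to the power `1 + δ`, with `δ > 0` (`exists_interpolation`).

Normalize to `0 ≤ u ≤ 1`. The equation has no zeroth-order term, so `1 - u` is a solution too, and
one of the two is below `1/2` on at most half of `B_{1/2}` at time `-θ`; call it `u`. The energy
inequality over the short span `θ` keeps `{u < 1/64}` below three quarters of the ball
(`exists_propagation`). On each time slice the isoperimetric inequality then charges gradient energy
for every halving of the level. This energy is controlled, so `{u < 2^{-J}/64}` has small measure
for large `J` (`exists_shrinking`). Smallness in measure becomes a pointwise lower bound through a
superlinear recursion of energies (`exists_deGiorgi`), and the three steps together give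
`exists_lower_bound`. -/

namespace ParabolicHolder

open Filter Topology

open scoped Convolution

/-! ### Mollification of Lipschitz functions. -/

section Mollify

variable {E : Type*} [NormedAddCommGroup E] [NormedSpace ℝ E] [FiniteDimensional ℝ E]
  [MeasurableSpace E] [BorelSpace E] (μ : Measure E) [μ.IsAddHaarMeasure]

/-- The convolution of a normed bump with a Lipschitz function has line derivative the
convolution with the line derivative. -/
theorem lineDeriv_convolution_bump (φ : ContDiffBump (0 : E)) {C : ℝ≥0} {f : E → ℝ}
    (hf : LipschitzWith C f) (x v : E) :
    lineDeriv ℝ (φ.normed μ ⋆[ContinuousLinearMap.lsmul ℝ ℝ, μ] f) x v =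
      (φ.normed μ ⋆[ContinuousLinearMap.lsmul ℝ ℝ, μ] fun y => lineDeriv ℝ f y v) x := by
  apply HasLineDerivAt.lineDeriv
  unfold HasLineDerivAt
  simp only [convolution_def, ContinuousLinearMap.lsmul_apply, smul_eq_mul]
  have hcont : Continuous (φ.normed μ) := φ.continuous_normed
  refine (hasDerivAt_integral_of_dominated_loc_of_lip (s := univ)
    (F := fun (s : ℝ) y => φ.normed μ y * f (x + s • v - y))
    (bound := fun y => φ.normed μ y * (C * ‖v‖)) univ_mem ?_ ?_ ?_ ?_ ?_ ?_).2
  · refine Eventually.of_forall fun s => ?_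
    exact (hcont.mul (hf.continuous.comp (by fun_prop))).aestronglyMeasurable
  · apply Continuous.integrable_of_hasCompactSupport
    · exact hcont.mul (hf.continuous.comp (by fun_prop))
    · exact φ.hasCompactSupport_normed.mul_right
  · refine hcont.aestronglyMeasurable.mul ?_
    have := (measurable_lineDeriv (𝕜 := ℝ) (v := v) hf.continuous).comp
      (measurable_const.sub measurable_id : Measurable fun y : E => x - y)
    exact this.aestronglyMeasurable
  · refine Eventually.of_forall fun y => ?_
    refine LipschitzOnWith.of_dist_le_mul fun s _ t _ => ?_
    have h1 := hf.dist_le_mul (x + s • v - y) (x + t • v - y)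
    have h2 : dist (x + s • v - y) (x + t • v - y) = dist s t * ‖v‖ := by
      rw [dist_eq_norm, dist_eq_norm, ← norm_smul]; congr 1; module
    rw [Real.dist_eq, ← mul_sub, abs_mul, abs_of_nonneg (φ.nonneg_normed y)]
    rw [Real.coe_nnabs, abs_of_nonneg (mul_nonneg (φ.nonneg_normed y) (by positivity))]
    rw [h2, Real.dist_eq] at h1
    calc _ ≤ φ.normed μ y * (C * (dist s t * ‖v‖)) :=
          mul_le_mul_of_nonneg_left h1 (φ.nonneg_normed y)
      _ = _ := by ring
  · exact φ.integrable_normed.mul_const _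
  · have h := hf.ae_lineDifferentiableAt (μ := μ) v
    have h' : ∀ᵐ y ∂μ, LineDifferentiableAt ℝ f (x - y) v :=
      (quasiMeasurePreserving_sub_left_of_right_invariant μ x).ae h
    filter_upwards [h'] with y hy
    have := (hy.hasLineDerivAt).const_mul (φ.normed μ y)
    have heq : (fun s : ℝ => φ.normed μ y * f (x + s • v - y)) =
        fun s : ℝ => φ.normed μ y * f (x - y + s • v) := by
      funext s; rw [add_sub_right_comm]
    rw [heq]; exact this

theorem lipschitzWith_convolution_bump (φ : ContDiffBump (0 : E)) {C : ℝ≥0} {f : E → ℝ}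
    (hf : LipschitzWith C f) :
    LipschitzWith C (φ.normed μ ⋆[ContinuousLinearMap.lsmul ℝ ℝ, μ] f) := by
  have hint : ∀ x, Integrable (fun y => φ.normed μ y * f (x - y)) μ := fun x => by
    apply Continuous.integrable_of_hasCompactSupport
    · exact φ.continuous_normed.mul (hf.continuous.comp (by fun_prop))
    · exact φ.hasCompactSupport_normed.mul_right
  refine LipschitzWith.of_dist_le_mul fun x x' => ?_
  simp only [convolution_def, ContinuousLinearMap.lsmul_apply, smul_eq_mul]
  rw [Real.dist_eq, ← integral_sub (hint x) (hint x')]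
  calc |∫ y, (φ.normed μ y * f (x - y) - φ.normed μ y * f (x' - y)) ∂μ|
      ≤ ∫ y, φ.normed μ y * (C * dist x x') ∂μ := by
        rw [← Real.norm_eq_abs]
        refine norm_integral_le_of_norm_le (φ.integrable_normed.mul_const _) ?_
        refine Eventually.of_forall fun y => ?_
        rw [← mul_sub, norm_mul, Real.norm_of_nonneg (φ.nonneg_normed y)]
        refine mul_le_mul_of_nonneg_left ?_ (φ.nonneg_normed y)
        have := hf.dist_le_mul (x - y) (x' - y)
        rwa [dist_sub_right, Real.dist_eq] at this
    _ = C * dist x x' := by rw [integral_mul_const, φ.integral_normed, one_mul]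

/-- The common passage from smooth to Lipschitz functions below. The constant `C` is kept along the
sequence, which supplies dominating functions; almost everywhere convergence of directional
derivatives is Lebesgue differentiation of the bounded function `lineDeriv ℝ f · v`. -/
theorem exists_smooth_approx {C : ℝ≥0} {f : E → ℝ} (hf : LipschitzWith C f) :
    ∃ g : ℕ → E → ℝ, (∀ k, ContDiff ℝ ((⊤ : ℕ∞) : WithTop ℕ∞) (g k)) ∧
      (∀ k, LipschitzWith C (g k)) ∧
      (∀ x, Tendsto (fun k => g k x) atTop (𝓝 (f x))) ∧
      (∀ v, ∀ᵐ x ∂μ, Tendsto (fun k => lineDeriv ℝ (g k) x v) atTop (𝓝 (lineDeriv ℝ f x v))) ∧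
      ((∀ x, 0 ≤ f x) → ∀ k x, 0 ≤ g k x) ∧
      ∀ k x, g k x ≠ 0 → ∃ y, f y ≠ 0 ∧ dist x y < 1 / ((k : ℝ) + 1) := by
  -- The outer radius is exactly twice the inner one. Convergence at Lebesgue points needs this
  -- ratio bounded, whence `K = 2` below.
  let φ : ℕ → ContDiffBump (0 : E) := fun k =>
    ⟨1 / (2 * ((k : ℝ) + 1)), 1 / ((k : ℝ) + 1), by positivity, by
      apply one_div_lt_one_div_of_lt (by positivity); linarith [(Nat.cast_nonneg k : (0:ℝ) ≤ k)]⟩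
  have hφ : Tendsto (fun k => (φ k).rOut) atTop (𝓝 0) := tendsto_one_div_add_atTop_nhds_zero_nat
  refine ⟨fun k => (φ k).normed μ ⋆[ContinuousLinearMap.lsmul ℝ ℝ, μ] f, fun k => ?_,
    fun k => lipschitzWith_convolution_bump μ _ hf, fun x => ?_, fun v => ?_, fun h0 k x => ?_,
    fun k x hx => ?_⟩
  · exact (φ k).hasCompactSupport_normed.contDiff_convolution_left _ (φ k).contDiff_normed
      hf.continuous.locallyIntegrable
  · exact ContDiffBump.convolution_tendsto_right_of_continuous hφ hf.continuous x
  · have := ContDiffBump.ae_convolution_tendsto_right_of_locallyIntegrable (μ := μ) (K := 2) hφ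
      (Eventually.of_forall fun k => le_of_eq (by simp only [φ]; field_simp))
      (hf.locallyIntegrable_lineDeriv (μ := μ) v)
    filter_upwards [this] with x hx
    exact hx.congr fun k => (lineDeriv_convolution_bump μ (φ k) hf x v).symm
  · exact integral_nonneg fun y => mul_nonneg ((φ k).nonneg_normed y) (h0 _)
  · by_contra! hcon
    apply hx
    simp only [convolution_def, ContinuousLinearMap.lsmul_apply, smul_eq_mul]
    apply integral_eq_zero_of_ae
    refine Eventually.of_forall fun y => ?_
    by_cases hy : f (x - y) = 0
    · simp [hy]
    · have h1 := hcon _ hy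
      have : y ∉ Function.support ((φ k).normed μ) := by
        rw [(φ k).support_normed_eq]
        simp only [Metric.mem_ball, dist_zero_right, not_lt]
        simpa [dist_eq_norm, φ] using h1
      simp [Function.notMem_support.1 this]

end Mollify

/-! ### Gradients and a subcritical Sobolev inequality. -/

/-- The squared length of the gradient, in terms of line derivatives. -/
noncomputable def gradSq {n : ℕ} (f : EuclideanSpace ℝ (Fin n) → ℝ)
    (x : EuclideanSpace ℝ (Fin n)) : ℝ :=
  ∑ i, (lineDeriv ℝ f x (EuclideanSpace.single i 1)) ^ 2

theorem norm_sq_eq_sum_apply_single {n : ℕ} (L : EuclideanSpace ℝ (Fin n) →L[ℝ] ℝ) :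
    ‖L‖ ^ 2 = ∑ i, (L (EuclideanSpace.single i 1)) ^ 2 := by
  obtain ⟨v, rfl⟩ := (InnerProductSpace.toDual ℝ (EuclideanSpace ℝ (Fin n))).surjective L
  rw [LinearIsometryEquiv.norm_map, EuclideanSpace.norm_sq_eq]
  refine Finset.sum_congr rfl fun i _ => ?_
  simp [InnerProductSpace.toDual_apply_apply, EuclideanSpace.inner_single_right]

theorem norm_fderiv_sq {n : ℕ} {f : EuclideanSpace ℝ (Fin n) → ℝ} {x : EuclideanSpace ℝ (Fin n)}
    (hf : DifferentiableAt ℝ f x) : ‖fderiv ℝ f x‖ ^ 2 = gradSq f x := by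
  rw [norm_sq_eq_sum_apply_single, gradSq]
  exact Finset.sum_congr rfl fun i _ => by rw [hf.lineDeriv_eq_fderiv]

theorem measurable_gradSq {n : ℕ} {f : EuclideanSpace ℝ (Fin n) → ℝ} (hf : Continuous f) :
    Measurable (gradSq f) :=
  Finset.measurable_sum _ fun _ _ => (measurable_lineDeriv hf).pow_const 2

theorem gradSq_le_of_lipschitz {n : ℕ} {C : ℝ≥0} {f : EuclideanSpace ℝ (Fin n) → ℝ}
    (hf : LipschitzWith C f) (x : EuclideanSpace ℝ (Fin n)) : gradSq f x ≤ n * C ^ 2 := by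
  calc gradSq f x ≤ ∑ _i : Fin n, (C : ℝ) ^ 2 := by
        refine Finset.sum_le_sum fun i _ => ?_
        have h := norm_lineDeriv_le_of_lipschitz ℝ hf (x₀ := x) (v := EuclideanSpace.single i 1)
        rw [PiLp.norm_single, norm_one, mul_one] at h
        rw [← sq_abs]; exact pow_le_pow_left₀ (abs_nonneg _) h 2
    _ = n * C ^ 2 := by simp

theorem gradSq_eq_zero_of_eventuallyEq {n : ℕ} {f : EuclideanSpace ℝ (Fin n) → ℝ}
    {x : EuclideanSpace ℝ (Fin n)} (h : f =ᶠ[𝓝 x] 0) : gradSq f x = 0 := by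
  refine Finset.sum_eq_zero fun i _ => ?_
  rw [h.lineDeriv_eq (𝕜 := ℝ)]
  simp [lineDeriv]

theorem gradSq_eq_zero_of_support {n : ℕ} {f : EuclideanSpace ℝ (Fin n) → ℝ} {r : ℝ}
    (h : ∀ y, r < ‖y‖ → f y = 0) {x : EuclideanSpace ℝ (Fin n)} (hx : r < ‖x‖) :
    gradSq f x = 0 := by
  apply gradSq_eq_zero_of_eventuallyEq
  filter_upwards [(isOpen_lt continuous_const continuous_norm).mem_nhds hx] with y hy
  exact h y hy

/-- Sobolev inequality with a subcritical exponent for smooth functions on a ball. -/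
theorem sobolev_smooth {n : ℕ} (hn : 2 ≤ n) {m : ℝ} (hm : 2 < m) (hm' : 1 / 2 - 1 / (n : ℝ) < 1 / m) :
    ∃ A : ℝ≥0, ∀ g : EuclideanSpace ℝ (Fin n) → ℝ, ContDiff ℝ 1 g →
      (∀ x, 2 < ‖x‖ → g x = 0) →
      ∫⁻ x, ‖g x‖ₑ ^ m ≤ A * (∫⁻ x, ENNReal.ofReal (gradSq g x)) ^ (m / 2) := by
  have hn0 : (0 : ℝ) < n := by positivity
  have hm0 : 0 < m := by linarith
  -- `s = 1/p` for the gradient exponent `p` of the Sobolev inequality. Subcriticality of `m` gives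
  -- `s > 1/2`, so `p < 2 ≤ n`; this covers `n = 2`, where `p = 2` would be the limiting case.
  -- Hölder on the bounded support then raises `p` to `2`.
  set s : ℝ := min 1 (1 / m + 1 / n) with hs
  have hs1 : s ≤ 1 := min_le_left _ _
  have hs2 : 1 / 2 < s := lt_min (by norm_num) (by linarith)
  have hs3 : s ≤ 1 / m + 1 / n := min_le_right _ _
  have hs0 : 0 < s := by linarith
  let p : ℝ≥0 := ⟨1 / s, by positivity⟩
  have hp : (p : ℝ) = 1 / s := rfl
  have hp1 : 1 ≤ p := by
    rw [← NNReal.coe_le_coe, hp, NNReal.coe_one, le_div_iff₀ hs0]; linarith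
  have hp2 : (p : ℝ) < 2 := by rw [hp, div_lt_iff₀ hs0]; linarith
  let q : ℝ≥0 := ⟨m, hm0.le⟩
  have hq : (q : ℝ) = m := rfl
  let B : Set (EuclideanSpace ℝ (Fin n)) := Metric.closedBall 0 2
  have hB : Bornology.IsBounded B := Metric.isBounded_closedBall
  set A₁ : ℝ≥0 := eLpNormLESNormFDerivOfLeConst ℝ (volume : Measure (EuclideanSpace ℝ (Fin n))) B p q
  set V : ℝ≥0∞ := volume B ^ (1 / (p : ℝ) - 1 / 2) with hV
  have hVtop : V ≠ ⊤ := by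
    rw [hV]; exact ENNReal.rpow_ne_top_of_nonneg (by rw [hp, one_div_one_div]; linarith) hB.measure_lt_top.ne
  refine ⟨((A₁ : ℝ≥0∞) * V).toNNReal ^ m, fun g hg hsupp => ?_⟩
  have hg0 : ∀ x, 2 < ‖x‖ → fderiv ℝ g x = 0 := fun x hx => by
    have : g =ᶠ[𝓝 x] fun _ => 0 := by
      filter_upwards [(isOpen_lt continuous_const continuous_norm).mem_nhds hx] with y hy
      exact hsupp y hy
    rw [this.fderiv_eq]; simp
  have h1 : eLpNorm g q volume ≤ A₁ * eLpNorm (fderiv ℝ g) p volume := by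
    refine eLpNorm_le_eLpNorm_fderiv_of_le (μ := volume) hg ?_ hp1 ?_ ?_ hB
    · intro x hx
      by_contra hxB
      exact hx (hsupp x (by simpa [B] using hxB))
    · rw [finrank_euclideanSpace_fin, ← NNReal.coe_lt_coe]
      have : (2 : ℝ) ≤ n := by exact_mod_cast hn
      push_cast; linarith
    · rw [finrank_euclideanSpace_fin, hq]
      have : ((p⁻¹ : ℝ≥0) : ℝ) = s := by rw [NNReal.coe_inv, hp, one_div, inv_inv]
      have h3 := hs3
      simp only [one_div] at h3
      rw [this]; linarith
  have hcont : Continuous (fderiv ℝ g) := hg.continuous_fderiv (by norm_num)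
  have hres : ∀ r : ℝ≥0∞, eLpNorm (fderiv ℝ g) r (volume.restrict B) = eLpNorm (fderiv ℝ g) r volume := by
    intro r
    refine (eLpNorm_indicator_eq_eLpNorm_restrict (f := fderiv ℝ g) (s := B) (μ := volume) (p := r)
      Metric.isClosed_closedBall.measurableSet).symm.trans ?_
    congr 1
    ext1 x
    by_cases hx : x ∈ B
    · rw [indicator_of_mem hx]
    · rw [indicator_of_notMem hx, hg0 x (by simpa [B] using hx)]
  have h2 : eLpNorm (fderiv ℝ g) p volume ≤ eLpNorm (fderiv ℝ g) 2 volume * V := by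
    have := eLpNorm_le_eLpNorm_mul_rpow_measure_univ (μ := volume.restrict B) (p := (p : ℝ≥0∞)) (q := 2)
      (f := fderiv ℝ g) (by
        have : (p : ℝ≥0∞) ≤ ((2 : ℝ≥0) : ℝ≥0∞) := by
          rw [ENNReal.coe_le_coe, ← NNReal.coe_le_coe]; exact hp2.le
        exact_mod_cast this) hcont.aestronglyMeasurable
    rw [hres, hres] at this
    simpa [hV] using this
  have h3 : eLpNorm g q volume ≤ A₁ * V * eLpNorm (fderiv ℝ g) 2 volume := by
    refine h1.trans ?_
    rw [mul_assoc, mul_comm V]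
    gcongr
  have hq0 : (q : ℝ≥0∞) ≠ 0 := by
    rw [ENNReal.coe_ne_zero, ← NNReal.coe_ne_zero, hq]; exact hm0.ne'
  have e1 : eLpNorm g q volume ^ m = ∫⁻ x, ‖g x‖ₑ ^ m := by
    rw [eLpNorm_eq_lintegral_rpow_enorm_toReal hq0 ENNReal.coe_ne_top, ENNReal.coe_toReal, hq,
      ← ENNReal.rpow_mul, one_div, inv_mul_cancel₀ hm0.ne', ENNReal.rpow_one]
  have e2 : eLpNorm (fderiv ℝ g) 2 volume ^ m =
      (∫⁻ x, ENNReal.ofReal (gradSq g x)) ^ (m / 2) := by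
    rw [eLpNorm_eq_lintegral_rpow_enorm_toReal (by norm_num) (by norm_num), ← ENNReal.rpow_mul]
    congr 1
    · refine lintegral_congr fun x => ?_
      rw [← norm_fderiv_sq ((hg.differentiable (by norm_num)) x), ENNReal.toReal_ofNat,
        ENNReal.ofReal_pow (norm_nonneg _), ofReal_norm]
      norm_cast
    · rw [ENNReal.toReal_ofNat]; ring
  rw [← e1, ← e2]
  calc eLpNorm g q volume ^ m ≤ (A₁ * V * eLpNorm (fderiv ℝ g) 2 volume) ^ m :=
        ENNReal.rpow_le_rpow h3 hm0.le
    _ = _ := by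
        rw [ENNReal.mul_rpow_of_nonneg _ _ hm0.le, ENNReal.coe_rpow_of_nonneg _ hm0.le,
          ENNReal.coe_toNNReal (ENNReal.mul_ne_top ENNReal.coe_ne_top hVtop)]

/-- Convergence of Dirichlet integrals along the smooth approximations of a Lipschitz function. -/
theorem tendsto_lintegral_gradSq {n : ℕ} {C : ℝ≥0} {f : EuclideanSpace ℝ (Fin n) → ℝ} {r : ℝ}
    {g : ℕ → EuclideanSpace ℝ (Fin n) → ℝ} (hgL : ∀ k, LipschitzWith C (g k))
    (hlim : ∀ v, ∀ᵐ x, Tendsto (fun k => lineDeriv ℝ (g k) x v) atTop (𝓝 (lineDeriv ℝ f x v)))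
    (hsupp : ∀ k x, r < ‖x‖ → g k x = 0) :
    Tendsto (fun k => ∫⁻ x, ENNReal.ofReal (gradSq (g k) x)) atTop
      (𝓝 (∫⁻ x, ENNReal.ofReal (gradSq f x))) := by
  refine tendsto_lintegral_of_dominated_convergence
    ((Metric.closedBall (0 : EuclideanSpace ℝ (Fin n)) r).indicator
      fun _ => ENNReal.ofReal (n * C ^ 2)) ?_ ?_ ?_ ?_
  · exact fun k => (measurable_gradSq (hgL k).continuous).ennreal_ofReal
  · refine fun k => Eventually.of_forall fun x => ?_
    by_cases hx : ‖x‖ ≤ r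
    · rw [indicator_of_mem (by simpa using hx)]
      exact ENNReal.ofReal_le_ofReal (gradSq_le_of_lipschitz (hgL k) x)
    · simp [gradSq_eq_zero_of_support (hsupp k) (not_le.1 hx)]
  · rw [lintegral_indicator Metric.isClosed_closedBall.measurableSet, lintegral_const]
    simp only [Measure.restrict_apply, MeasurableSet.univ, univ_inter]
    exact ENNReal.mul_ne_top ENNReal.ofReal_ne_top Metric.isBounded_closedBall.measure_lt_top.ne
  · have : ∀ᵐ x, ∀ i : Fin n, Tendsto (fun k => lineDeriv ℝ (g k) x (EuclideanSpace.single i 1))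
        atTop (𝓝 (lineDeriv ℝ f x (EuclideanSpace.single i 1))) :=
      ae_all_iff.2 fun i => hlim _
    filter_upwards [this] with x hx
    refine ENNReal.tendsto_ofReal ?_
    exact tendsto_finsetSum _ fun i _ => (hx i).pow 2

/-- Sobolev inequality with a subcritical exponent for Lipschitz functions on the unit ball. -/
theorem sobolev_lipschitz {n : ℕ} (hn : 2 ≤ n) {m : ℝ} (hm : 2 < m)
    (hm' : 1 / 2 - 1 / (n : ℝ) < 1 / m) :
    ∃ A : ℝ≥0, ∀ (f : EuclideanSpace ℝ (Fin n) → ℝ) (C : ℝ≥0), LipschitzWith C f →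
      (∀ x, 1 < ‖x‖ → f x = 0) →
      ∫⁻ x, ‖f x‖ₑ ^ m ≤ A * (∫⁻ x, ENNReal.ofReal (gradSq f x)) ^ (m / 2) := by
  obtain ⟨A, hA⟩ := sobolev_smooth hn hm hm'
  refine ⟨A, fun f C hf hsupp => ?_⟩
  obtain ⟨g, hg, hgL, hlim, hlim', -, hsup⟩ := exists_smooth_approx volume hf
  -- The mollifiers have radius at most one, so a support in the unit ball spreads at most to radius
  -- two, the radius for which the smooth case was stated.
  have hgs : ∀ k x, 2 < ‖x‖ → g k x = 0 := by
    intro k x hx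
    by_contra h0
    obtain ⟨y, hy, hxy⟩ := hsup k x h0
    have h1 : 1 / ((k : ℝ) + 1) ≤ 1 := by
      rw [div_le_one (by positivity)]; linarith [(Nat.cast_nonneg k : (0 : ℝ) ≤ k)]
    have h2 : ‖y‖ ≤ 1 := by
      by_contra hy'; exact hy (hsupp y (not_le.1 hy'))
    have h3 : ‖x‖ ≤ ‖y‖ + dist x y := by
      rw [dist_eq_norm]; simpa using norm_add_le y (x - y)
    linarith
  have hG := tendsto_lintegral_gradSq (r := 2) hgL hlim' hgs
  have hm0 : 0 < m := by linarith
  have hR : Tendsto (fun k => (A : ℝ≥0∞) * (∫⁻ x, ENNReal.ofReal (gradSq (g k) x)) ^ (m / 2)) atTop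
      (𝓝 (A * (∫⁻ x, ENNReal.ofReal (gradSq f x)) ^ (m / 2))) :=
    ENNReal.Tendsto.const_mul ((ENNReal.continuous_rpow_const.tendsto _).comp hG)
      (Or.inr ENNReal.coe_ne_top)
  -- Fatou is enough on the left; genuine convergence is needed only for the Dirichlet integrals on
  -- the right.
  have hF : ∫⁻ x, ‖f x‖ₑ ^ m ≤ liminf (fun k => ∫⁻ x, ‖g k x‖ₑ ^ m) atTop := by
    have : ∀ x, ‖f x‖ₑ ^ m = liminf (fun k => ‖g k x‖ₑ ^ m) atTop := fun x =>
      (((ENNReal.continuous_rpow_const.tendsto _).comp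
        ((continuous_enorm.tendsto _).comp (hlim x)))).liminf_eq.symm
    simp_rw [this]
    exact lintegral_liminf_le fun k =>
      ((hg k).continuous.measurable.enorm.pow_const m)
  refine hF.trans ?_
  rw [← hR.liminf_eq]
  exact liminf_le_liminf (Eventually.of_forall fun k => hA (g k) ((hg k).of_le (by norm_cast)) (hgs k))

/-! ### Poincaré and isoperimetric inequalities on balls. -/

/-- The contraction towards `y` maps the ball into itself by convexity, and its inverse Jacobian
`c⁻ⁿ` is at most `2ⁿ` because `c ≥ 1/2`. -/
theorem lintegral_ball_comp_convex_le {n : ℕ} {r c : ℝ} (hc : 1 / 2 ≤ c) (hc1 : c ≤ 1)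
    {h : EuclideanSpace ℝ (Fin n) → ℝ≥0∞} (hh : Measurable h) {y : EuclideanSpace ℝ (Fin n)}
    (hy : y ∈ Metric.ball (0 : EuclideanSpace ℝ (Fin n)) r) :
    ∫⁻ x in Metric.ball 0 r, h (c • x + (1 - c) • y) ≤ 2 ^ n * ∫⁻ x in Metric.ball 0 r, h x := by
  have hc0 : 0 < c := by linarith
  set B := Metric.ball (0 : EuclideanSpace ℝ (Fin n)) r
  have hB : MeasurableSet B := Metric.isOpen_ball.measurableSet
  have hBc : Convex ℝ B := convex_ball 0 r
  rw [← lintegral_indicator hB, ← lintegral_indicator hB]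
  have hmeas : Measurable (B.indicator h) := hh.indicator hB
  calc ∫⁻ x, B.indicator (fun x => h (c • x + (1 - c) • y)) x
      ≤ ∫⁻ x, B.indicator h (c • x + (1 - c) • y) := by
        refine lintegral_mono fun x => ?_
        by_cases hx : x ∈ B
        · have : c • x + (1 - c) • y ∈ B := hBc hx hy hc0.le (by linarith) (by ring)
          rw [indicator_of_mem hx, indicator_of_mem this]
        · rw [indicator_of_notMem hx]; exact zero_le
    _ = ∫⁻ z, B.indicator h (z + (1 - c) • y) ∂(Measure.map (c • ·) volume) := by
        have hm2 : Measurable fun z : EuclideanSpace ℝ (Fin n) =>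
            B.indicator h (z + (1 - c) • y) := hmeas.comp (measurable_id.add_const _)
        rw [lintegral_map hm2 (measurable_const_smul c)]
    _ = ENNReal.ofReal |(c ^ n)⁻¹| * ∫⁻ z, B.indicator h (z + (1 - c) • y) := by
        rw [Measure.map_addHaar_smul volume hc0.ne', finrank_euclideanSpace_fin,
          lintegral_smul_measure, smul_eq_mul]
    _ = ENNReal.ofReal |(c ^ n)⁻¹| * ∫⁻ z, B.indicator h z := by
        rw [lintegral_add_right_eq_self (μ := volume) (fun z => B.indicator h z)]
    _ ≤ 2 ^ n * ∫⁻ z, B.indicator h z := by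
        gcongr
        have h2 : (c ^ n)⁻¹ ≤ 2 ^ n := by
          rw [← inv_pow]
          refine pow_le_pow_left₀ (by positivity) ?_ n
          rw [inv_le_comm₀ hc0 (by norm_num)]; linarith
        rw [abs_of_nonneg (by positivity)]
        calc ENNReal.ofReal (c ^ n)⁻¹ ≤ ENNReal.ofReal (2 ^ n) := ENNReal.ofReal_le_ofReal h2
          _ = 2 ^ n := by rw [ENNReal.ofReal_pow (by norm_num)]; norm_num

/-- One of `s`, `1 - s` is at least `1/2`. The change of variables is made in the variable carrying
that coefficient, so the constant does not degenerate at either end of the segment. -/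
theorem lintegral_ball_ball_comp_convex_le {n : ℕ} {r s : ℝ} (hs0 : 0 ≤ s) (hs1 : s ≤ 1)
    {h : EuclideanSpace ℝ (Fin n) → ℝ≥0∞} (hh : Measurable h) :
    ∫⁻ x in Metric.ball 0 r, ∫⁻ y in Metric.ball 0 r, h (s • x + (1 - s) • y) ≤
      volume (Metric.ball (0 : EuclideanSpace ℝ (Fin n)) r) *
        (2 ^ n * ∫⁻ x in Metric.ball 0 r, h x) := by
  set B := Metric.ball (0 : EuclideanSpace ℝ (Fin n)) r
  have hB : MeasurableSet B := Metric.isOpen_ball.measurableSet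
  rcases le_total (1 / 2) s with hs | hs
  · rw [lintegral_lintegral_swap]
    · calc ∫⁻ y in B, ∫⁻ x in B, h (s • x + (1 - s) • y)
          ≤ ∫⁻ y in B, (2 ^ n * ∫⁻ x in B, h x) :=
            setLIntegral_mono' hB fun y hy => lintegral_ball_comp_convex_le hs hs1 hh hy
        _ = _ := by rw [lintegral_const, Measure.restrict_apply_univ, mul_comm]
    · exact (hh.comp (by fun_prop)).aemeasurable
  · calc ∫⁻ x in B, ∫⁻ y in B, h (s • x + (1 - s) • y)
        ≤ ∫⁻ x in B, (2 ^ n * ∫⁻ y in B, h y) := by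
          refine setLIntegral_mono' hB fun x hx => ?_
          have := lintegral_ball_comp_convex_le (c := 1 - s) (by linarith) (by linarith) hh hx
          refine le_trans (le_of_eq ?_) this
          refine lintegral_congr fun y => ?_
          rw [sub_sub_cancel, add_comm]
      _ = _ := by rw [lintegral_const, Measure.restrict_apply_univ, mul_comm]

theorem enorm_sub_le_lintegral_fderiv {n : ℕ} {r : ℝ} {g : EuclideanSpace ℝ (Fin n) → ℝ}
    (hg : ContDiff ℝ 1 g) {x y : EuclideanSpace ℝ (Fin n)} (hx : x ∈ Metric.ball 0 r)
    (hy : y ∈ Metric.ball 0 r) :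
    ‖g x - g y‖ₑ ≤ ENNReal.ofReal (2 * r) *
      ∫⁻ s in Ioc (0 : ℝ) 1, ‖fderiv ℝ g (s • x + (1 - s) • y)‖ₑ := by
  have hd : ∀ s : ℝ, HasDerivAt (fun s : ℝ => g (s • x + (1 - s) • y))
      (fderiv ℝ g (s • x + (1 - s) • y) (x - y)) s := fun s => by
    have h1 : HasDerivAt (fun s : ℝ => s • x + (1 - s) • y) (x - y) s := by
      have := ((hasDerivAt_id s).smul_const x).add (((hasDerivAt_id s).const_sub 1).smul_const y)
      convert! this using 1
      module
    exact (((hg.differentiable (by norm_num)) _).hasFDerivAt).comp_hasDerivAt s h1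
  have hcont : Continuous fun s : ℝ => fderiv ℝ g (s • x + (1 - s) • y) (x - y) := by
    have := hg.continuous_fderiv (by norm_num)
    fun_prop
  have hftc := intervalIntegral.integral_eq_sub_of_hasDerivAt (a := 0) (b := 1)
    (fun s _ => hd s) (hcont.intervalIntegrable _ _)
  simp only [one_smul, sub_self, zero_smul, add_zero, sub_zero, zero_add] at hftc
  rw [← hftc, intervalIntegral.integral_of_le zero_le_one]
  refine (enorm_integral_le_lintegral_enorm _).trans ?_
  rw [← lintegral_const_mul' _ _ ENNReal.ofReal_ne_top]
  refine lintegral_mono fun s => ?_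
  have hxy : ‖x - y‖ₑ ≤ ENNReal.ofReal (2 * r) := by
    rw [← ofReal_norm]
    apply ENNReal.ofReal_le_ofReal
    have := norm_sub_le x y
    simp only [Metric.mem_ball, dist_zero_right] at hx hy
    linarith
  calc ‖fderiv ℝ g (s • x + (1 - s) • y) (x - y)‖ₑ
      ≤ ‖fderiv ℝ g (s • x + (1 - s) • y)‖ₑ * ‖x - y‖ₑ := ContinuousLinearMap.le_opENorm _ _
    _ ≤ _ := by rw [mul_comm]; gcongr

/-- The Poincaré inequality is kept as a double integral of differences, so no mean value enters:
integrate the derivative along segments, exchange the integrals, and use the preceding bound for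
each fixed `s`. -/
theorem poincare_smooth {n : ℕ} {r : ℝ} {g : EuclideanSpace ℝ (Fin n) → ℝ}
    (hg : ContDiff ℝ 1 g) :
    ∫⁻ x in Metric.ball 0 r, ∫⁻ y in Metric.ball 0 r, ‖g x - g y‖ₑ ≤
      ENNReal.ofReal (2 * r) * volume (Metric.ball (0 : EuclideanSpace ℝ (Fin n)) r) * 2 ^ n *
        ∫⁻ x in Metric.ball 0 r, ENNReal.ofReal √(gradSq g x) := by
  set B := Metric.ball (0 : EuclideanSpace ℝ (Fin n)) r
  have hB : MeasurableSet B := Metric.isOpen_ball.measurableSet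
  have hcont : Continuous (fderiv ℝ g) := hg.continuous_fderiv (by norm_num)
  have hm : Measurable fun x => ‖fderiv ℝ g x‖ₑ := hcont.measurable.enorm
  have hgrad : ∀ x, ENNReal.ofReal √(gradSq g x) = ‖fderiv ℝ g x‖ₑ := fun x => by
    rw [← norm_fderiv_sq (hg.differentiable (by norm_num) x), Real.sqrt_sq (norm_nonneg _),
      ofReal_norm]
  simp_rw [hgrad]
  have hcomp : Continuous fun p : (EuclideanSpace ℝ (Fin n) × EuclideanSpace ℝ (Fin n)) × ℝ =>
      p.2 • p.1.1 + (1 - p.2) • p.1.2 := by fun_prop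
  have hH : Measurable fun p : (EuclideanSpace ℝ (Fin n) × EuclideanSpace ℝ (Fin n)) × ℝ =>
      ‖fderiv ℝ g (p.2 • p.1.1 + (1 - p.2) • p.1.2)‖ₑ :=
    hm.comp hcomp.measurable
  calc ∫⁻ x in B, ∫⁻ y in B, ‖g x - g y‖ₑ
      ≤ ∫⁻ x in B, ∫⁻ y in B, ENNReal.ofReal (2 * r) *
          ∫⁻ s in Ioc (0 : ℝ) 1, ‖fderiv ℝ g (s • x + (1 - s) • y)‖ₑ :=
        setLIntegral_mono' hB fun x hx => setLIntegral_mono' hB fun y hy =>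
          enorm_sub_le_lintegral_fderiv hg hx hy
    _ = ENNReal.ofReal (2 * r) * ∫⁻ x in B, ∫⁻ y in B,
          ∫⁻ s in Ioc (0 : ℝ) 1, ‖fderiv ℝ g (s • x + (1 - s) • y)‖ₑ := by
        simp_rw [lintegral_const_mul' _ _ ENNReal.ofReal_ne_top]
    _ = ENNReal.ofReal (2 * r) * ∫⁻ s in Ioc (0 : ℝ) 1, ∫⁻ x in B, ∫⁻ y in B,
          ‖fderiv ℝ g (s • x + (1 - s) • y)‖ₑ := by
        congr 1
        have h1 : ∀ x, ∫⁻ y in B, ∫⁻ s in Ioc (0 : ℝ) 1, ‖fderiv ℝ g (s • x + (1 - s) • y)‖ₑ =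
            ∫⁻ s in Ioc (0 : ℝ) 1, ∫⁻ y in B, ‖fderiv ℝ g (s • x + (1 - s) • y)‖ₑ := fun x => by
          refine lintegral_lintegral_swap (Measurable.aemeasurable ?_)
          exact hm.comp (Continuous.measurable (by fun_prop))
        simp_rw [h1]
        refine lintegral_lintegral_swap (Measurable.aemeasurable ?_)
        exact Measurable.lintegral_prod_right'
          (f := fun p : (EuclideanSpace ℝ (Fin n) × ℝ) × EuclideanSpace ℝ (Fin n) =>
            ‖fderiv ℝ g (p.1.2 • p.1.1 + (1 - p.1.2) • p.2)‖ₑ)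
          (hm.comp (Continuous.measurable (by fun_prop)))
    _ ≤ ENNReal.ofReal (2 * r) * ∫⁻ s in Ioc (0 : ℝ) 1,
          (volume B * (2 ^ n * ∫⁻ x in B, ‖fderiv ℝ g x‖ₑ)) := by
        refine mul_le_mul_right ?_ _
        exact setLIntegral_mono' measurableSet_Ioc fun s hs =>
          lintegral_ball_ball_comp_convex_le hs.1.le hs.2 hm
    _ = _ := by
        rw [lintegral_const, Measure.restrict_apply_univ, Real.volume_Ioc]
        simp only [sub_zero, ENNReal.ofReal_one, mul_one]
        ring

/-- The `L¹` Poincaré inequality on a ball for Lipschitz functions. -/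
theorem poincare_lipschitz {n : ℕ} (r : ℝ) {C : ℝ≥0} {f : EuclideanSpace ℝ (Fin n) → ℝ}
    (hf : LipschitzWith C f) :
    ∫⁻ x in Metric.ball 0 r, ∫⁻ y in Metric.ball 0 r, ‖f x - f y‖ₑ ≤
      ENNReal.ofReal (2 * r) * volume (Metric.ball (0 : EuclideanSpace ℝ (Fin n)) r) * 2 ^ n *
        ∫⁻ x in Metric.ball 0 r, ENNReal.ofReal √(gradSq f x) := by
  set B := Metric.ball (0 : EuclideanSpace ℝ (Fin n)) r
  have hBfin : volume B ≠ ⊤ := Metric.isBounded_ball.measure_lt_top.ne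
  obtain ⟨g, hg, hgL, hlim, hlim', -, -⟩ := exists_smooth_approx volume hf
  have hG : Tendsto (fun k => ∫⁻ x in B, ENNReal.ofReal √(gradSq (g k) x)) atTop
      (𝓝 (∫⁻ x in B, ENNReal.ofReal √(gradSq f x))) := by
    refine tendsto_lintegral_of_dominated_convergence
      (fun _ => ENNReal.ofReal √(n * C ^ 2)) ?_ ?_ ?_ ?_
    · exact fun k => ((measurable_gradSq (hgL k).continuous).sqrt).ennreal_ofReal
    · exact fun k => Eventually.of_forall fun x => ENNReal.ofReal_le_ofReal
        (Real.sqrt_le_sqrt (gradSq_le_of_lipschitz (hgL k) x))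
    · rw [lintegral_const, Measure.restrict_apply_univ]
      exact ENNReal.mul_ne_top ENNReal.ofReal_ne_top hBfin
    · have : ∀ᵐ x, ∀ i : Fin n, Tendsto (fun k => lineDeriv ℝ (g k) x (EuclideanSpace.single i 1))
          atTop (𝓝 (lineDeriv ℝ f x (EuclideanSpace.single i 1))) :=
        ae_all_iff.2 fun i => hlim' _
      filter_upwards [ae_restrict_of_ae this] with x hx
      exact ENNReal.tendsto_ofReal ((Real.continuous_sqrt.tendsto _).comp
        (tendsto_finsetSum _ fun i _ => (hx i).pow 2))
  have hR := ENNReal.Tendsto.const_mul (a := ENNReal.ofReal (2 * r) * volume B * 2 ^ n) hG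
    (Or.inr (by finiteness))
  rw [← hR.liminf_eq]
  have hcont : ∀ {h : EuclideanSpace ℝ (Fin n) → ℝ}, Continuous h → Measurable
      fun p : EuclideanSpace ℝ (Fin n) × EuclideanSpace ℝ (Fin n) => ‖h p.1 - h p.2‖ₑ :=
    fun hh => (Continuous.measurable (by fun_prop))
  calc ∫⁻ x in B, ∫⁻ y in B, ‖f x - f y‖ₑ
      = ∫⁻ p, ‖f p.1 - f p.2‖ₑ ∂((volume.restrict B).prod (volume.restrict B)) :=
        (lintegral_prod _ (hcont hf.continuous).aemeasurable).symm
    _ = ∫⁻ p, liminf (fun k => ‖g k p.1 - g k p.2‖ₑ) atTop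
          ∂((volume.restrict B).prod (volume.restrict B)) := by
        refine lintegral_congr fun p => ?_
        exact ((continuous_enorm.tendsto _).comp ((hlim p.1).sub (hlim p.2))).liminf_eq.symm
    _ ≤ liminf (fun k => ∫⁻ p, ‖g k p.1 - g k p.2‖ₑ
          ∂((volume.restrict B).prod (volume.restrict B))) atTop :=
        lintegral_liminf_le fun k => hcont (hgL k).continuous
    _ ≤ _ := by
        refine liminf_le_liminf (Eventually.of_forall fun k => ?_)
        rw [lintegral_prod _ (hcont (hgL k).continuous).aemeasurable]
        exact poincare_smooth ((hg k).of_le (by norm_cast))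

/-- De Giorgi's isoperimetric inequality. -/
theorem isoperimetric {n : ℕ} (r : ℝ) {C : ℝ≥0} {f : EuclideanSpace ℝ (Fin n) → ℝ}
    (hf : LipschitzWith C f) {c : ℝ} (hc : 0 ≤ c) {S T : Set (EuclideanSpace ℝ (Fin n))}
    (hS : MeasurableSet S) (hT : MeasurableSet T) (hSB : S ⊆ Metric.ball 0 r)
    (hTB : T ⊆ Metric.ball 0 r) (hfS : ∀ x ∈ S, f x = c) (hfT : ∀ x ∈ T, f x = 0) :
    ENNReal.ofReal c * volume S * volume T ≤
      ENNReal.ofReal (2 * r) * volume (Metric.ball (0 : EuclideanSpace ℝ (Fin n)) r) * 2 ^ n *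
        ∫⁻ x in Metric.ball 0 r, ENNReal.ofReal √(gradSq f x) := by
  refine le_trans ?_ (poincare_lipschitz r hf)
  calc ENNReal.ofReal c * volume S * volume T
      = ∫⁻ _x in S, ∫⁻ _y in T, ENNReal.ofReal c := by
        simp only [lintegral_const, Measure.restrict_apply_univ]; ring
    -- On `S × T` the difference is the constant `c`, so this rectangle alone accounts for the
    -- left-hand side.
    _ = ∫⁻ x in S, ∫⁻ y in T, ‖f x - f y‖ₑ := by
        refine setLIntegral_congr_fun hS fun x hx => ?_
        refine setLIntegral_congr_fun hT fun y hy => ?_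
        rw [hfS x hx, hfT y hy, sub_zero, Real.enorm_of_nonneg hc]
    _ ≤ ∫⁻ x in Metric.ball 0 r, ∫⁻ y in T, ‖f x - f y‖ₑ := lintegral_mono_set hSB
    _ ≤ _ := lintegral_mono fun x => lintegral_mono_set hTB

/-! ### Bounded Lipschitz functions -/

/-- Bounded Lipschitz real functions. -/
def BddLip {X : Type*} [PseudoMetricSpace X] (f : X → ℝ) : Prop :=
  (∃ C : ℝ≥0, LipschitzWith C f) ∧ ∃ M : ℝ, ∀ x, |f x| ≤ M

theorem BddLip.continuous {X : Type*} [PseudoMetricSpace X] {f : X → ℝ} (hf : BddLip f) :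
    Continuous f := hf.1.choose_spec.continuous

/-- Boundedness is part of the class because a product of Lipschitz functions need not be Lipschitz
without it. -/
theorem BddLip.mul {X : Type*} [PseudoMetricSpace X] {f g : X → ℝ} (hf : BddLip f)
    (hg : BddLip g) : BddLip fun x => f x * g x := by
  obtain ⟨⟨C, hC⟩, M, hM⟩ := hf
  obtain ⟨⟨D, hD⟩, N, hN⟩ := hg
  refine ⟨⟨Real.toNNReal (|M| * D + |N| * C), LipschitzWith.of_dist_le_mul fun x y => ?_⟩,
    |M| * |N|, fun x => ?_⟩
  · have h1 := hC.dist_le_mul x y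
    have h2 := hD.dist_le_mul x y
    rw [Real.dist_eq] at *
    rw [Real.coe_toNNReal _ (by positivity)]
    have e : f x * g x - f y * g y = f x * (g x - g y) + g y * (f x - f y) := by ring
    rw [e]
    refine (abs_add_le _ _).trans ?_
    rw [abs_mul, abs_mul]
    have hx : |f x| ≤ |M| := (hM x).trans (le_abs_self M)
    have hy : |g y| ≤ |N| := (hN y).trans (le_abs_self N)
    have := mul_le_mul hx h2 (abs_nonneg _) (abs_nonneg _)
    have := mul_le_mul hy h1 (abs_nonneg _) (abs_nonneg _)
    linarith
  · rw [abs_mul]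
    exact mul_le_mul ((hM x).trans (le_abs_self M)) ((hN x).trans (le_abs_self N)) (abs_nonneg _)
      (abs_nonneg _)

theorem BddLip.sq {X : Type*} [PseudoMetricSpace X] {f : X → ℝ} (hf : BddLip f) :
    BddLip fun x => f x ^ 2 := by
  simp_rw [pow_two]; exact hf.mul hf

/-- Trapezoidal time cutoff. -/
noncomputable def timeCut (t₁ t₂ : ℝ) (k : ℕ) (t : ℝ) : ℝ :=
  max 0 (min 1 (min (((k : ℝ) + 1) * (t - t₁)) (((k : ℝ) + 1) * (t₂ - t))))

theorem timeCut_nonneg (t₁ t₂ : ℝ) (k : ℕ) (t : ℝ) : 0 ≤ timeCut t₁ t₂ k t := le_max_left _ _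

theorem timeCut_le_one (t₁ t₂ : ℝ) (k : ℕ) (t : ℝ) : timeCut t₁ t₂ k t ≤ 1 :=
  max_le zero_le_one (min_le_left _ _)

theorem timeCut_eq_zero {t₁ t₂ : ℝ} (k : ℕ) {t : ℝ} (ht : t ∉ Ioo t₁ t₂) :
    timeCut t₁ t₂ k t = 0 := by
  apply max_eq_left
  have hk : (0 : ℝ) < k + 1 := by positivity
  by_cases h : t₁ < t
  · have h2 : t₂ ≤ t := by
      by_contra h'; exact ht ⟨h, not_le.1 h'⟩
    refine (min_le_right _ _).trans ((min_le_right _ _).trans ?_)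
    exact mul_nonpos_of_nonneg_of_nonpos hk.le (by linarith)
  · refine (min_le_right _ _).trans ((min_le_left _ _).trans ?_)
    exact mul_nonpos_of_nonneg_of_nonpos hk.le (by linarith)

theorem tendsto_timeCut {t₁ t₂ t : ℝ} (ht : t ∈ Ioo t₁ t₂) :
    Tendsto (fun k => timeCut t₁ t₂ k t) atTop (𝓝 1) := by
  have hd : 0 < min (t - t₁) (t₂ - t) := lt_min (by linarith [ht.1]) (by linarith [ht.2])
  obtain ⟨N, hN⟩ := exists_nat_gt (1 / min (t - t₁) (t₂ - t))
  refine tendsto_const_nhds.congr' ?_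
  filter_upwards [eventually_ge_atTop N] with k hk
  have hk' : (N : ℝ) ≤ k := by exact_mod_cast hk
  rw [div_lt_iff₀ hd] at hN
  have h1 : 1 ≤ ((k : ℝ) + 1) * min (t - t₁) (t₂ - t) := by nlinarith
  have h2 : 1 ≤ ((k : ℝ) + 1) * (t - t₁) :=
    h1.trans (mul_le_mul_of_nonneg_left (min_le_left _ _) (by positivity))
  have h3 : 1 ≤ ((k : ℝ) + 1) * (t₂ - t) :=
    h1.trans (mul_le_mul_of_nonneg_left (min_le_right _ _) (by positivity))
  rw [timeCut, min_eq_left (le_min h2 h3), max_eq_right zero_le_one]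

theorem bddLip_timeCut {n : ℕ} (t₁ t₂ : ℝ) (k : ℕ) :
    BddLip fun z : SpaceTime n => timeCut t₁ t₂ k z.2 := by
  refine ⟨?_, 1, fun z => ?_⟩
  · have hlin : ∀ c : ℝ, LipschitzWith ((k : ℝ≥0) + 1)
        fun z : SpaceTime n => ((k : ℝ) + 1) * (z.2 - c) := fun c =>
      LipschitzWith.of_dist_le_mul fun z z' => by
        rw [Real.dist_eq, ← mul_sub, abs_mul, abs_of_pos (by positivity : (0 : ℝ) < k + 1)]
        refine mul_le_mul_of_nonneg_left ?_ (by positivity)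
        rw [sub_sub_sub_cancel_right, ← Real.dist_eq]
        exact (LipschitzWith.prod_snd.dist_le_mul z z').trans (by simp)
    have hlin' : LipschitzWith ((k : ℝ≥0) + 1)
        fun z : SpaceTime n => ((k : ℝ) + 1) * (t₂ - z.2) := by
      have h := (hlin t₂).neg
      have e : (-fun z : SpaceTime n => ((k : ℝ) + 1) * (z.2 - t₂)) =
          fun z => ((k : ℝ) + 1) * (t₂ - z.2) := by
        funext z; simp only [Pi.neg_apply]; ring
      rwa [e] at h
    exact ⟨_, (((hlin t₁).min hlin').const_min 1).const_max 0⟩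
  · rw [abs_of_nonneg (timeCut_nonneg _ _ _ _)]; exact timeCut_le_one _ _ _ _

/-! ### Lipschitz test functions -/

theorem measurableSet_cyl (n : ℕ) (R : ℝ) : MeasurableSet (cyl n R) :=
  Metric.isOpen_ball.measurableSet.prod measurableSet_Ioo

theorem isOpen_cyl (n : ℕ) (R : ℝ) : IsOpen (cyl n R) :=
  Metric.isOpen_ball.prod isOpen_Ioo

theorem volume_cyl_lt_top (n : ℕ) (R : ℝ) : volume (cyl n R) < ⊤ := by
  have : Bornology.IsBounded (cyl n R) := Metric.isBounded_ball.prod (Metric.isBounded_Ioo _ _)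
  exact this.measure_lt_top

instance isAddHaarMeasure_spaceTime (n : ℕ) :
    (volume : Measure (SpaceTime n)).IsAddHaarMeasure := by
  rw [Measure.volume_eq_prod]; infer_instance

theorem integrableOn_mul_lineDeriv {n : ℕ} {Q : Set (SpaceTime n)} {f φ : SpaceTime n → ℝ}
    {C : ℝ≥0} (hf : IntegrableOn f Q) (hφ : LipschitzWith C φ) (v : SpaceTime n) :
    IntegrableOn (fun z => f z * lineDeriv ℝ φ z v) Q :=
  hf.mul_bdd (c := C * ‖v‖) (measurable_lineDeriv hφ.continuous).aestronglyMeasurable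
    (Eventually.of_forall fun _ => norm_lineDeriv_le_of_lipschitz ℝ hφ)

theorem integrableOn_coord {n : ℕ} {Q : Set (SpaceTime n)}
    {b : SpaceTime n → EuclideanSpace ℝ (Fin n)} (hb : IntegrableOn b Q) (i : Fin n) :
    IntegrableOn (fun z => b z i) Q :=
  (EuclideanSpace.proj (𝕜 := ℝ) i).integrable_comp hb

/-- `div b ≤ 0` may be tested with nonnegative compactly supported Lipschitz functions. -/
theorem DivNonpos.lipschitz {n : ℕ} {Q : Set (SpaceTime n)}
    {b : SpaceTime n → EuclideanSpace ℝ (Fin n)} (hdiv : DivNonpos Q b) (hQ : IsOpen Q)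
    (hb : IntegrableOn b Q) {φ : SpaceTime n → ℝ} {C : ℝ≥0} (hφ : LipschitzWith C φ)
    (hc : HasCompactSupport φ) (hs : tsupport φ ⊆ Q) (h0 : ∀ z, 0 ≤ φ z) :
    0 ≤ ∫ z in Q, ∑ i, b z i * spaceDeriv i φ z := by
  obtain ⟨g, hg, hgL, -, hlim', hpos, hsup⟩ := exists_smooth_approx volume hφ
  -- A closed thickening of the compact support still lies in `Q`, so the late mollifications are
  -- admissible smooth test functions.
  obtain ⟨δ, hδ, hδQ⟩ := hc.isCompact.exists_cthickening_subset_open hQ hs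
  have hsub : ∀ k : ℕ, 1 / ((k : ℝ) + 1) ≤ δ → tsupport (g k) ⊆ Metric.cthickening δ (tsupport φ) := by
    intro k hk
    refine closure_minimal (fun x hx => ?_) Metric.isClosed_cthickening
    obtain ⟨y, hy, hxy⟩ := hsup k x hx
    exact Metric.mem_cthickening_of_dist_le x y δ _ (subset_tsupport _ hy) (hxy.le.trans hk)
  have hev : ∀ᶠ k : ℕ in atTop, 1 / ((k : ℝ) + 1) ≤ δ :=
    (tendsto_one_div_add_atTop_nhds_zero_nat.eventually (ge_mem_nhds hδ))
  have hT : Tendsto (fun k => ∫ z in Q, ∑ i, b z i * spaceDeriv i (g k) z) atTop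
      (𝓝 (∫ z in Q, ∑ i, b z i * spaceDeriv i φ z)) := by
    refine tendsto_integral_of_dominated_convergence
      (fun z => ∑ i : Fin n, |b z i| * (C * ‖((EuclideanSpace.single i 1, 0) : SpaceTime n)‖))
      ?_ ?_ ?_ ?_
    · intro k
      exact (integrable_finsetSum _ fun i _ =>
        integrableOn_mul_lineDeriv (integrableOn_coord hb i) (hgL k) _).aestronglyMeasurable
    · exact integrable_finsetSum _ fun i _ => (integrableOn_coord hb i).abs.mul_const _
    · refine fun k => Eventually.of_forall fun z => ?_
      refine (norm_sum_le _ _).trans (Finset.sum_le_sum fun i _ => ?_)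
      rw [norm_mul, Real.norm_eq_abs]
      exact mul_le_mul_of_nonneg_left (norm_lineDeriv_le_of_lipschitz ℝ (hgL k)) (abs_nonneg _)
    · have : ∀ᵐ z, ∀ i : Fin n, Tendsto (fun k => spaceDeriv i (g k) z) atTop
          (𝓝 (spaceDeriv i φ z)) := ae_all_iff.2 fun i => hlim' _
      filter_upwards [ae_restrict_of_ae this] with z hz
      exact tendsto_finsetSum _ fun i _ => (hz i).const_mul _
  refine ge_of_tendsto hT ?_
  filter_upwards [hev] with k hk
  have := hdiv (g k) (hg k)
    (hc.isCompact.cthickening.of_isClosed_subset (isClosed_tsupport _) (hsub k hk))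
    ((hsub k hk).trans hδQ) (hpos h0 k)
  linarith

/-- The part of the unit cylinder between two times. -/
def slab (n : ℕ) (t₁ t₂ : ℝ) : Set (SpaceTime n) :=
  Metric.ball (0 : EuclideanSpace ℝ (Fin n)) 1 ×ˢ Ioo t₁ t₂

theorem measurableSet_slab (n : ℕ) (t₁ t₂ : ℝ) : MeasurableSet (slab n t₁ t₂) :=
  Metric.isOpen_ball.measurableSet.prod measurableSet_Ioo

theorem volume_slab_lt_top (n : ℕ) (t₁ t₂ : ℝ) : volume (slab n t₁ t₂) < ⊤ := by
  have : Bornology.IsBounded (slab n t₁ t₂) :=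
    Metric.isBounded_ball.prod (Metric.isBounded_Ioo _ _)
  exact this.measure_lt_top

theorem slab_subset_cyl {n : ℕ} {t₁ t₂ : ℝ} (h₁ : -1 ≤ t₁) (h₂ : t₂ ≤ 0) :
    slab n t₁ t₂ ⊆ cyl n 1 :=
  prod_mono subset_rfl (Ioo_subset_Ioo (by simpa using h₁) h₂)

/-- Turns identities tested with compactly supported functions into identities on a sharp time slab.
-/
theorem tendsto_integral_mul_timeCut {n : ℕ} {t₁ t₂ : ℝ} (h₁ : -1 ≤ t₁) (h₂ : t₂ ≤ 0)
    {f : SpaceTime n → ℝ} (hf : IntegrableOn f (cyl n 1)) :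
    Tendsto (fun k => ∫ z in cyl n 1, f z * timeCut t₁ t₂ k z.2) atTop
      (𝓝 (∫ z in slab n t₁ t₂, f z)) := by
  have hS := measurableSet_slab n t₁ t₂
  have e : ∫ z in slab n t₁ t₂, f z = ∫ z in cyl n 1, (slab n t₁ t₂).indicator f z := by
    rw [setIntegral_indicator hS, inter_eq_self_of_subset_right (slab_subset_cyl h₁ h₂)]
  rw [e]
  refine tendsto_integral_of_dominated_convergence (fun z => |f z|) ?_ hf.abs ?_ ?_
  · exact fun k => hf.aestronglyMeasurable.mul
      (bddLip_timeCut t₁ t₂ k).continuous.aestronglyMeasurable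
  · refine fun k => Eventually.of_forall fun z => ?_
    rw [norm_mul, Real.norm_eq_abs, Real.norm_of_nonneg (timeCut_nonneg _ _ _ _)]
    exact mul_le_of_le_one_right (abs_nonneg _) (timeCut_le_one _ _ _ _)
  · filter_upwards [ae_restrict_mem (measurableSet_cyl n 1)] with z hz
    by_cases ht : z.2 ∈ Ioo t₁ t₂
    · rw [indicator_of_mem (show z ∈ slab n t₁ t₂ from ⟨hz.1, ht⟩)]
      simpa using (tendsto_timeCut ht).const_mul (f z)
    · rw [indicator_of_notMem (fun h => ht h.2)]
      simp [timeCut_eq_zero _ ht]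

/-- The time factor is constant along spatial directions, so the formula needs no differentiability
of `F`. -/
theorem spaceDeriv_mul_time {n : ℕ} (i : Fin n) (F : SpaceTime n → ℝ) (χ : ℝ → ℝ)
    (z : SpaceTime n) :
    spaceDeriv i (fun z => F z * χ z.2) z = spaceDeriv i F z * χ z.2 := by
  simp only [spaceDeriv, lineDeriv, Prod.snd_add, Prod.smul_snd, smul_zero, add_zero]
  exact deriv_mul_const_field _

theorem support_mul_timeCut {n : ℕ} {t₁ t₂ ρ : ℝ} (k : ℕ) {Ψ : SpaceTime n → ℝ}
    (hΨ : ∀ z : SpaceTime n, ρ < ‖z.1‖ → Ψ z = 0) :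
    Function.support (fun z => Ψ z * timeCut t₁ t₂ k z.2) ⊆
      Metric.closedBall (0 : EuclideanSpace ℝ (Fin n)) ρ ×ˢ Icc t₁ t₂ := by
  intro z hz
  refine ⟨?_, ?_⟩
  · by_contra h
    exact hz (by simp [hΨ z (by simpa using h)])
  · by_contra h
    exact hz (by
      simp only
      rw [timeCut_eq_zero k (fun h' => h (Ioo_subset_Icc_self h')), mul_zero])

theorem closedBall_prod_Icc_subset_cyl {n : ℕ} {t₁ t₂ ρ : ℝ} (hρ : ρ < 1) (h₁ : -1 < t₁)
    (h₂ : t₂ < 0) :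
    Metric.closedBall (0 : EuclideanSpace ℝ (Fin n)) ρ ×ˢ Icc t₁ t₂ ⊆ cyl n 1 :=
  prod_mono (Metric.closedBall_subset_ball hρ) fun t ht =>
    ⟨by rw [one_pow]; linarith [ht.1], by linarith [ht.2]⟩

theorem hasCompactSupport_mul_timeCut {n : ℕ} {t₁ t₂ ρ : ℝ} (k : ℕ) {Ψ : SpaceTime n → ℝ}
    (hΨ : ∀ z : SpaceTime n, ρ < ‖z.1‖ → Ψ z = 0) :
    HasCompactSupport (fun z => Ψ z * timeCut t₁ t₂ k z.2) :=
  HasCompactSupport.of_support_subset_isCompact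
    ((isCompact_closedBall _ _).prod isCompact_Icc) (support_mul_timeCut k hΨ)

theorem tsupport_mul_timeCut_subset {n : ℕ} {t₁ t₂ ρ : ℝ} (hρ : ρ < 1) (h₁ : -1 < t₁)
    (h₂ : t₂ < 0) (k : ℕ) {Ψ : SpaceTime n → ℝ}
    (hΨ : ∀ z : SpaceTime n, ρ < ‖z.1‖ → Ψ z = 0) :
    tsupport (fun z => Ψ z * timeCut t₁ t₂ k z.2) ⊆ cyl n 1 :=
  (closure_minimal (support_mul_timeCut k hΨ)
    ((isCompact_closedBall _ _).prod isCompact_Icc).isClosed).trans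
      (closedBall_prod_Icc_subset_cyl hρ h₁ h₂)

/-- The divergence condition on a time slab. -/
theorem DivNonpos.slab {n : ℕ} {b : SpaceTime n → EuclideanSpace ℝ (Fin n)}
    (hdiv : DivNonpos (cyl n 1) b) (hb : IntegrableOn b (cyl n 1)) {t₁ t₂ ρ : ℝ} (hρ : ρ < 1)
    (h₁ : -1 < t₁) (h₂ : t₂ < 0) {Ψ : SpaceTime n → ℝ} (hL : BddLip Ψ)
    (hΨ : ∀ z : SpaceTime n, ρ < ‖z.1‖ → Ψ z = 0) (h0 : ∀ z, 0 ≤ Ψ z) :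
    0 ≤ ∫ z in ParabolicHolder.slab n t₁ t₂, ∑ i, b z i * spaceDeriv i Ψ z := by
  obtain ⟨C, hC⟩ := hL.1
  refine ge_of_tendsto' (tendsto_integral_mul_timeCut h₁.le h₂.le
    (integrable_finsetSum _ fun i _ =>
      integrableOn_mul_lineDeriv (integrableOn_coord hb i) hC _)) fun k => ?_
  obtain ⟨D, hD⟩ := (hL.mul (bddLip_timeCut t₁ t₂ k)).1
  have := hdiv.lipschitz (isOpen_cyl n 1) hb hD (hasCompactSupport_mul_timeCut k hΨ)
    (tsupport_mul_timeCut_subset hρ h₁ h₂ k hΨ)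
    fun z => mul_nonneg (h0 z) (timeCut_nonneg _ _ _ _)
  refine this.trans_eq (integral_congr_ae (Eventually.of_forall fun z => ?_))
  simp only [spaceDeriv_mul_time, Finset.sum_mul, ← mul_assoc]

/-- Integration of a time derivative over a slab. -/
theorem integral_timeDeriv_slab {n : ℕ} {t₁ t₂ : ℝ} (h : t₁ ≤ t₂) {F : SpaceTime n → ℝ}
    (hF : BddLip F) :
    ∫ z in slab n t₁ t₂, timeDeriv F z =
      (∫ x in Metric.ball (0 : EuclideanSpace ℝ (Fin n)) 1, F (x, t₂)) -
        ∫ x in Metric.ball (0 : EuclideanSpace ℝ (Fin n)) 1, F (x, t₁) := by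
  obtain ⟨C, hC⟩ := hF.1
  have hfin : ∀ t : ℝ, IntegrableOn (fun x => F (x, t))
      (Metric.ball (0 : EuclideanSpace ℝ (Fin n)) 1) := fun t => by
    obtain ⟨M, hM⟩ := hF.2
    exact Measure.integrableOn_of_bounded (M := M) Metric.isBounded_ball.measure_lt_top.ne
      (hF.continuous.comp (by fun_prop)).aestronglyMeasurable
      (Eventually.of_forall fun x => hM _)
  rw [← integral_sub (hfin _) (hfin _), slab, Measure.volume_eq_prod, setIntegral_prod]
  · refine integral_congr_ae (Eventually.of_forall fun x => ?_)
    simp only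
    have hslice : LipschitzWith (C * 1) fun t : ℝ => F (x, t) :=
      hC.comp (LipschitzWith.prodMk_left x)
    -- Fundamental theorem of calculus on each vertical segment; Lipschitz slices are absolutely
    -- continuous.
    have := (hslice.lipschitzOnWith (s := uIcc t₁ t₂)).absolutelyContinuousOnInterval.integral_deriv_eq_sub
    rw [intervalIntegral.integral_of_le h, integral_Ioc_eq_integral_Ioo] at this
    rw [← this]
    refine integral_congr_ae (Eventually.of_forall fun t => ?_)
    simp only [timeDeriv, lineDeriv, Prod.mk_add_mk, Prod.smul_mk, smul_zero, add_zero, smul_eq_mul,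
      mul_one]
    rw [deriv_comp_const_add (fun s => F (x, s)) t 0, add_zero]
  · rw [← Measure.volume_eq_prod]
    exact Measure.integrableOn_of_bounded (M := C * ‖((0, 1) : SpaceTime n)‖)
      (volume_slab_lt_top n t₁ t₂).ne
      (measurable_lineDeriv hC.continuous).aestronglyMeasurable
      (Eventually.of_forall fun x => norm_lineDeriv_le_of_lipschitz ℝ hC)

/-! ### Solutions on the unit cylinder and their weak formulation. -/

/-- Nonnegative Lipschitz solutions on the unit cylinder with the hypotheses needed for the
energy estimates. -/
structure UnitSolution {n : ℕ} (ν : ℝ) (a : SpaceTime n → Matrix (Fin n) (Fin n) ℝ)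
    (b : SpaceTime n → EuclideanSpace ℝ (Fin n)) (u : SpaceTime n → ℝ) : Prop where
  pos : 0 < ν
  parabolic : UniformlyParabolic ν (cyl n 1) a
  integrable : IntegrableOn b (cyl n 1)
  div : DivNonpos (cyl n 1) b
  lipschitz : ∃ C : ℝ≥0, LipschitzWith C u
  nonneg : ∀ z, 0 ≤ u z
  weak : ∀ η : SpaceTime n → ℝ, (∃ C : ℝ≥0, LipschitzWith C η) → HasCompactSupport η →
    tsupport η ⊆ cyl n 1 →
    ∫ z in cyl n 1, (timeDeriv u z * η z
      + ∑ i, ∑ j, a z i j * spaceDeriv j u z * spaceDeriv i η z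
      + (∑ i, b z i * spaceDeriv i u z) * η z) = 0

theorem lineDeriv_affine {n : ℕ} (u : SpaceTime n → ℝ) (c d : ℝ) (z v : SpaceTime n) :
    lineDeriv ℝ (fun z => c * u z + d) z v = c * lineDeriv ℝ u z v := by
  simp only [lineDeriv]
  rw [deriv_add_const]
  exact deriv_const_mul_field c

/-- The equation is linear without zeroth-order term. The two uses are `k⁻¹ u`, which brings a small
level up to one, and `1 - u`, which exchanges upper and lower bounds. -/
theorem UnitSolution.affine {n : ℕ} {ν : ℝ} {a : SpaceTime n → Matrix (Fin n) (Fin n) ℝ}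
    {b : SpaceTime n → EuclideanSpace ℝ (Fin n)} {u : SpaceTime n → ℝ}
    (hu : UnitSolution ν a b u) (c d : ℝ) (h : ∀ z, 0 ≤ c * u z + d) :
    UnitSolution ν a b fun z => c * u z + d := by
  refine ⟨hu.pos, hu.parabolic, hu.integrable, hu.div, ?_, h, fun η h1 h2 h3 => ?_⟩
  · obtain ⟨C, hC⟩ := hu.lipschitz
    refine ⟨‖c‖₊ * C, LipschitzWith.of_dist_le_mul fun x y => ?_⟩
    have := hC.dist_le_mul x y
    rw [Real.dist_eq] at *
    rw [add_sub_add_right_eq_sub, ← mul_sub, abs_mul]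
    push_cast
    rw [Real.norm_eq_abs, mul_assoc]
    exact mul_le_mul_of_nonneg_left this (abs_nonneg c)
  · have := hu.weak η h1 h2 h3
    simp only [timeDeriv, spaceDeriv] at this ⊢
    simp only [lineDeriv_affine]
    refine Eq.trans ?_ ((congrArg (c * ·) this).trans (mul_zero c))
    rw [← integral_const_mul]
    refine integral_congr_ae (Eventually.of_forall fun z => ?_)
    simp only [mul_add, Finset.mul_sum, Finset.sum_mul]
    congr 1
    · congr 1
      · ring
      · exact Finset.sum_congr rfl fun i _ => Finset.sum_congr rfl fun j _ => by ring
    · exact Finset.sum_congr rfl fun i _ => by ring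

/-- The weak formulation integrand. -/
noncomputable def weakIntegrand {n : ℕ} (a : SpaceTime n → Matrix (Fin n) (Fin n) ℝ)
    (b : SpaceTime n → EuclideanSpace ℝ (Fin n)) (u η : SpaceTime n → ℝ) (z : SpaceTime n) : ℝ :=
  timeDeriv u z * η z + ∑ i, ∑ j, a z i j * spaceDeriv j u z * spaceDeriv i η z
    + (∑ i, b z i * spaceDeriv i u z) * η z

theorem UniformlyParabolic.integrableOn {n : ℕ} {ν : ℝ} {Q : Set (SpaceTime n)}
    {a : SpaceTime n → Matrix (Fin n) (Fin n) ℝ} (ha : UniformlyParabolic ν Q a)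
    (hQ : volume Q ≠ ⊤) (i j : Fin n) : IntegrableOn (fun z => a z i j) Q := by
  refine ⟨(ha.aemeasurable i j).aestronglyMeasurable,
    HasFiniteIntegral.restrict_of_bounded ν⁻¹ hQ.lt_top ?_⟩
  filter_upwards [ha.bound] with z hz
  have := hz (EuclideanSpace.single i 1) (EuclideanSpace.single j 1)
  simpa [Finset.sum_ite_eq, PiLp.single_apply] using this

theorem integrableOn_lineDeriv {n : ℕ} {Q : Set (SpaceTime n)} (hQ : volume Q ≠ ⊤)
    {φ : SpaceTime n → ℝ} {C : ℝ≥0} (hφ : LipschitzWith C φ) (v : SpaceTime n) :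
    IntegrableOn (fun z => lineDeriv ℝ φ z v) Q :=
  Measure.integrableOn_of_bounded (M := C * ‖v‖) hQ
    (measurable_lineDeriv hφ.continuous).aestronglyMeasurable
    (Eventually.of_forall fun _ => norm_lineDeriv_le_of_lipschitz ℝ hφ)

theorem IntegrableOn.mul_bddLip {n : ℕ} {Q : Set (SpaceTime n)} {f φ : SpaceTime n → ℝ}
    (hf : IntegrableOn f Q) (hφ : BddLip φ) : IntegrableOn (fun z => f z * φ z) Q := by
  obtain ⟨M, hM⟩ := hφ.2
  exact Integrable.mul_bdd (c := M) hf hφ.continuous.aestronglyMeasurable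
    (Eventually.of_forall hM)

theorem UnitSolution.integrableOn_weakIntegrand {n : ℕ} {ν : ℝ}
    {a : SpaceTime n → Matrix (Fin n) (Fin n) ℝ}
    {b : SpaceTime n → EuclideanSpace ℝ (Fin n)} {u : SpaceTime n → ℝ}
    (hu : UnitSolution ν a b u) {Ψ : SpaceTime n → ℝ} (hL : BddLip Ψ) :
    IntegrableOn (weakIntegrand a b u Ψ) (cyl n 1) := by
  obtain ⟨C, hC⟩ := hu.lipschitz
  obtain ⟨D, hD⟩ := hL.1
  have hQ := (volume_cyl_lt_top n 1).ne
  refine Integrable.add (Integrable.add ?_ ?_) ?_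
  · exact IntegrableOn.mul_bddLip (integrableOn_lineDeriv hQ hC _) hL
  · exact integrable_finsetSum _ fun i _ => integrable_finsetSum _ fun j _ =>
      integrableOn_mul_lineDeriv
        (integrableOn_mul_lineDeriv (hu.parabolic.integrableOn hQ i j) hC _) hD _
  · refine IntegrableOn.mul_bddLip ?_ hL
    exact integrable_finsetSum _ fun i _ =>
      integrableOn_mul_lineDeriv (integrableOn_coord hu.integrable i) hC _

/-- The weak formulation on a time slab. -/
theorem UnitSolution.integral_weakIntegrand_slab {n : ℕ} {ν : ℝ}
    {a : SpaceTime n → Matrix (Fin n) (Fin n) ℝ}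
    {b : SpaceTime n → EuclideanSpace ℝ (Fin n)} {u : SpaceTime n → ℝ}
    (hu : UnitSolution ν a b u) {t₁ t₂ ρ : ℝ} (hρ : ρ < 1)
    (h₁ : -1 < t₁) (h₂ : t₂ < 0) {Ψ : SpaceTime n → ℝ} (hL : BddLip Ψ)
    (hΨ : ∀ z : SpaceTime n, ρ < ‖z.1‖ → Ψ z = 0) :
    ∫ z in slab n t₁ t₂, weakIntegrand a b u Ψ z = 0 := by
  -- The weak form puts no time derivative on the test function. The steep time cutoff is therefore
  -- never differentiated, and no boundary term arises in the limit.
  refine tendsto_nhds_unique (tendsto_integral_mul_timeCut h₁.le h₂.le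
    (hu.integrableOn_weakIntegrand hL)) (tendsto_const_nhds.congr fun k => ?_)
  have := hu.weak _ (hL.mul (bddLip_timeCut t₁ t₂ k)).1 (hasCompactSupport_mul_timeCut k hΨ)
    (tsupport_mul_timeCut_subset hρ h₁ h₂ k hΨ)
  rw [← this]
  refine integral_congr_ae (Eventually.of_forall fun z => ?_)
  simp only [spaceDeriv_mul_time, weakIntegrand, add_mul, Finset.sum_mul, ← mul_assoc]

/-! ### Space gradients, truncations and the energy inequality. -/

/-- The squared length of the space gradient. -/
noncomputable def spaceGradSq {n : ℕ} (F : SpaceTime n → ℝ) (z : SpaceTime n) : ℝ :=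
  ∑ i, spaceDeriv i F z ^ 2

theorem spaceGradSq_eq_gradSq {n : ℕ} (F : SpaceTime n → ℝ) (x : EuclideanSpace ℝ (Fin n)) (t : ℝ) :
    spaceGradSq F (x, t) = gradSq (fun y => F (y, t)) x := by
  simp [spaceGradSq, gradSq, spaceDeriv, lineDeriv]

theorem spaceGradSq_nonneg {n : ℕ} (F : SpaceTime n → ℝ) (z : SpaceTime n) :
    0 ≤ spaceGradSq F z := Finset.sum_nonneg fun _ _ => sq_nonneg _

theorem measurable_spaceGradSq {n : ℕ} {F : SpaceTime n → ℝ} (hF : Continuous F) :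
    Measurable (spaceGradSq F) :=
  Finset.measurable_sum _ fun _ _ => (measurable_lineDeriv hF).pow_const 2

theorem lipschitz_slice {n : ℕ} {F : SpaceTime n → ℝ} {C : ℝ≥0} (hF : LipschitzWith C F) (t : ℝ) :
    LipschitzWith C fun x => F (x, t) :=
  LipschitzWith.of_dist_le_mul fun x y => by
    have := hF.dist_le_mul (x, t) (y, t)
    simpa [Prod.dist_eq] using this

theorem spaceGradSq_le_mul {n : ℕ} {F : SpaceTime n → ℝ} {C : ℝ≥0} (hF : LipschitzWith C F)
    (z : SpaceTime n) : spaceGradSq F z ≤ n * C ^ 2 := by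
  obtain ⟨x, t⟩ := z
  rw [spaceGradSq_eq_gradSq]; exact gradSq_le_of_lipschitz (lipschitz_slice hF t) x

/-- At points of differentiability the space gradient is a restriction of the full derivative. This
gives `C²` without the factor `n` of `spaceGradSq_le_mul`, as the energy inequality requires for the
cutoff. -/
theorem spaceGradSq_le {n : ℕ} {F : SpaceTime n → ℝ} {C : ℝ≥0} (hF : LipschitzWith C F)
    {z : SpaceTime n} (hd : DifferentiableAt ℝ F z) : spaceGradSq F z ≤ C ^ 2 := by
  have h := norm_sq_eq_sum_apply_single
    ((fderiv ℝ F z).comp (ContinuousLinearMap.inl ℝ (EuclideanSpace ℝ (Fin n)) ℝ))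
  have e : spaceGradSq F z = ‖(fderiv ℝ F z).comp
      (ContinuousLinearMap.inl ℝ (EuclideanSpace ℝ (Fin n)) ℝ)‖ ^ 2 := by
    rw [h, spaceGradSq]
    exact Finset.sum_congr rfl fun i _ => by rw [spaceDeriv, hd.lineDeriv_eq_fderiv]; rfl
  rw [e]
  refine pow_le_pow_left₀ (norm_nonneg _) ?_ 2
  refine (ContinuousLinearMap.opNorm_comp_le _ _).trans ?_
  have h1 := norm_fderiv_le_of_lipschitz ℝ hF (x₀ := z)
  have h2 := ContinuousLinearMap.norm_inl_le_one ℝ (EuclideanSpace ℝ (Fin n)) ℝ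
  calc _ ≤ (C : ℝ) * 1 := mul_le_mul h1 h2 (norm_nonneg _) (C.2)
    _ = C := mul_one _

/-- The truncation `(k - u)₊`. -/
def trunc {X : Type*} (k : ℝ) (u : X → ℝ) (z : X) : ℝ := max (k - u z) 0

theorem trunc_nonneg {X : Type*} (k : ℝ) (u : X → ℝ) (z : X) : 0 ≤ trunc k u z := le_max_right _ _

theorem trunc_le {X : Type*} {k : ℝ} (hk : 0 ≤ k) {u : X → ℝ} (hu : ∀ z, 0 ≤ u z) (z : X) :
    trunc k u z ≤ k := max_le (by linarith [hu z]) hk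

theorem lipschitz_trunc {X : Type*} [PseudoMetricSpace X] (k : ℝ) {u : X → ℝ} {C : ℝ≥0}
    (hu : LipschitzWith C u) : LipschitzWith C (trunc k u) := by
  have : LipschitzWith C fun z => k - u z := LipschitzWith.of_dist_le_mul fun x y => by
    rw [dist_sub_left]; exact hu.dist_le_mul x y
  exact this.max_const 0

theorem bddLip_trunc {X : Type*} [PseudoMetricSpace X] {k : ℝ} (hk : 0 ≤ k) {u : X → ℝ}
    (hu : ∃ C : ℝ≥0, LipschitzWith C u) (h0 : ∀ z, 0 ≤ u z) : BddLip (trunc k u) := by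
  obtain ⟨C, hC⟩ := hu
  exact ⟨⟨C, lipschitz_trunc k hC⟩, k, fun z => by
    rw [abs_of_nonneg (trunc_nonneg _ _ _)]; exact trunc_le hk h0 z⟩

/-- On `{u ≥ k}` the truncation is at its minimum zero, so its derivative vanishes wherever it
exists. The level set `{u = k}` thus needs no separate argument. -/
theorem lineDeriv_trunc {E : Type*} [NormedAddCommGroup E] [NormedSpace ℝ E] (k : ℝ) {u : E → ℝ}
    {z : E} (hu : DifferentiableAt ℝ u z)
    (hw : DifferentiableAt ℝ (trunc k u) z) :
    (∀ v, lineDeriv ℝ (trunc k u) z v = -lineDeriv ℝ u z v) ∨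
      (trunc k u z = 0 ∧ ∀ v, lineDeriv ℝ (trunc k u) z v = 0) := by
  rcases lt_or_ge (u z) k with h | h
  · left
    intro v
    have he : trunc k u =ᶠ[𝓝 z] fun y => k - u y := by
      filter_upwards [hu.continuousAt.eventually (gt_mem_nhds h)] with y hy
      exact max_eq_left (by linarith)
    rw [he.lineDeriv_eq (𝕜 := ℝ), (hu.const_sub k).lineDeriv_eq_fderiv, hu.lineDeriv_eq_fderiv,
      fderiv_const_sub]
    rfl
  · right
    have h0 : trunc k u z = 0 := max_eq_right (by linarith)
    refine ⟨h0, fun v => ?_⟩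
    have hmin : IsLocalMin (trunc k u) z := Eventually.of_forall fun y => by
      rw [h0]; exact trunc_nonneg _ _ _
    rw [hw.lineDeriv_eq_fderiv, hmin.fderiv_eq_zero]; rfl

theorem lineDeriv_mul_sq {E : Type*} [NormedAddCommGroup E] [NormedSpace ℝ E] {w ζ : E → ℝ}
    {z : E} (hw : DifferentiableAt ℝ w z) (hζ : DifferentiableAt ℝ ζ z) (v : E) :
    lineDeriv ℝ (fun y => w y * ζ y ^ 2) z v =
      lineDeriv ℝ w z v * ζ z ^ 2 + 2 * w z * ζ z * lineDeriv ℝ ζ z v := by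
  have h1 := hw.hasFDerivAt.mul (hζ.hasFDerivAt.pow 2)
  rw [hw.lineDeriv_eq_fderiv, hζ.lineDeriv_eq_fderiv]
  refine (h1.hasLineDerivAt v).lineDeriv.trans ?_
  simp
  ring

theorem lineDeriv_sq_mul_sq {E : Type*} [NormedAddCommGroup E] [NormedSpace ℝ E] {w ζ : E → ℝ}
    {z : E} (hw : DifferentiableAt ℝ w z) (hζ : DifferentiableAt ℝ ζ z) (v : E) :
    lineDeriv ℝ (fun y => w y ^ 2 * ζ y ^ 2) z v =
      2 * w z * lineDeriv ℝ w z v * ζ z ^ 2 + 2 * w z ^ 2 * ζ z * lineDeriv ℝ ζ z v := by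
  have h1 := (hw.hasFDerivAt.pow 2).mul (hζ.hasFDerivAt.pow 2)
  rw [hw.lineDeriv_eq_fderiv, hζ.lineDeriv_eq_fderiv]
  refine (h1.hasLineDerivAt v).lineDeriv.trans ?_
  simp
  ring

/-- The algebra behind the energy inequality. -/
theorem energy_pointwise {n : ℕ} {ν L : ℝ} (hν : 0 < ν) (hL : 1 ≤ L)
    (A : Matrix (Fin n) (Fin n) ℝ) (β p e : EuclideanSpace ℝ (Fin n)) {ω ζ pt et : ℝ}
    (hω : 0 ≤ ω) (hζ : 0 ≤ ζ) (hζ1 : ζ ≤ 1)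
    (hlow : ν * ‖p‖ ^ 2 ≤ ∑ i, ∑ j, A i j * p i * p j)
    (hbd : |∑ i, ∑ j, A i j * e i * p j| ≤ ν⁻¹ * ‖e‖ * ‖p‖)
    (he : ‖e‖ ≤ L) (het : |et| ≤ L) :
    1 / 2 * (2 * ω * pt * ζ ^ 2 + 2 * ω ^ 2 * ζ * et)
      + 1 / 2 * ∑ i, β i * (2 * ω * p i * ζ ^ 2 + 2 * ω ^ 2 * ζ * e i)
      + ν / 2 * (‖p‖ ^ 2 * ζ ^ 2) ≤
    (pt * (ω * ζ ^ 2) + ∑ i, ∑ j, A i j * p j * (p i * ζ ^ 2 + 2 * ω * ζ * e i)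
      + (∑ i, β i * p i) * (ω * ζ ^ 2)) +
    1 / 2 * ((2 + 4 * (ν⁻¹) ^ 3) * L ^ 2) * (ω ^ 2 * (1 + ‖β‖)) := by
  have s1 : ∑ i, β i * (2 * ω * p i * ζ ^ 2 + 2 * ω ^ 2 * ζ * e i) =
      2 * ω * ζ ^ 2 * ∑ i, β i * p i + 2 * ω ^ 2 * ζ * ∑ i, β i * e i := by
    rw [Finset.mul_sum, Finset.mul_sum, ← Finset.sum_add_distrib]
    exact Finset.sum_congr rfl fun i _ => by ring
  have s2 : ∑ i, ∑ j, A i j * p j * (p i * ζ ^ 2 + 2 * ω * ζ * e i) =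
      ζ ^ 2 * ∑ i, ∑ j, A i j * p i * p j + 2 * ω * ζ * ∑ i, ∑ j, A i j * e i * p j := by
    simp only [Finset.mul_sum]
    rw [← Finset.sum_add_distrib]
    refine Finset.sum_congr rfl fun i _ => ?_
    rw [← Finset.sum_add_distrib]
    exact Finset.sum_congr rfl fun j _ => by ring
  have hβe : ∑ i, β i * e i ≤ ‖β‖ * ‖e‖ := by
    have := real_inner_le_norm e β
    rw [PiLp.inner_apply] at this
    simp only [RCLike.inner_apply, conj_trivial] at this
    linarith
  rw [s1, s2]
  set P := ‖p‖
  set B := ‖β‖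
  set N := ‖e‖
  have hP : 0 ≤ P := norm_nonneg _
  have hB : 0 ≤ B := norm_nonneg _
  have hN : 0 ≤ N := norm_nonneg _
  set μ := ν⁻¹
  have hμ : 0 < μ := inv_pos.2 hν
  have hμν : μ * ν = 1 := inv_mul_cancel₀ hν.ne'
  -- With `L ≥ 1` the single factor `L²` dominates `|Dζ|²`, `|Dζ|` and `|∂ₜζ|`.
  have hLL : L ≤ L ^ 2 := by nlinarith
  have hN2 : N ^ 2 ≤ L ^ 2 := pow_le_pow_left₀ hN he 2
  set X := ∑ i, ∑ j, A i j * p i * p j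
  set Y := ∑ i, ∑ j, A i j * e i * p j
  set Z := ∑ i, β i * p i
  set W := ∑ i, β i * e i
  have hY : -(μ * N * P) ≤ Y := (abs_le.1 hbd).1
  have h1 : ζ ^ 2 * (ν * P ^ 2) ≤ ζ ^ 2 * X := mul_le_mul_of_nonneg_left hlow (sq_nonneg ζ)
  have h2 : -(2 * ω * ζ * (μ * N * P)) ≤ 2 * ω * ζ * Y := by
    have := mul_le_mul_of_nonneg_left hY (by positivity : 0 ≤ 2 * ω * ζ)
    linarith
  -- Young's inequality, weighted so that exactly half of the elliptic term `ν P² ζ²` is spent on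
  -- the cross term.
  have h3 : 2 * ω * ζ * (μ * N * P) ≤ ν / 2 * (P ^ 2 * ζ ^ 2) + 2 * μ ^ 3 * ω ^ 2 * N ^ 2 := by
    have hsq : 0 ≤ ν / 2 * (P * ζ - 2 * μ ^ 2 * ω * N) ^ 2 := by positivity
    have e1 : ν / 2 * (P * ζ - 2 * μ ^ 2 * ω * N) ^ 2 =
        ν / 2 * (P ^ 2 * ζ ^ 2) - 2 * ω * ζ * ((μ * ν) * μ * N * P)
          + 2 * (μ * ν) * μ ^ 3 * ω ^ 2 * N ^ 2 := by ring
    rw [e1, hμν] at hsq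
    linarith
  have h4 : 2 * μ ^ 3 * ω ^ 2 * N ^ 2 ≤ 2 * μ ^ 3 * ω ^ 2 * L ^ 2 := by gcongr
  have h5 : ω ^ 2 * ζ * et ≤ ω ^ 2 * L ^ 2 := by
    calc ω ^ 2 * ζ * et ≤ ω ^ 2 * ζ * L :=
          mul_le_mul_of_nonneg_left ((le_abs_self et).trans het) (by positivity)
      _ ≤ ω ^ 2 * 1 * L := by gcongr
      _ ≤ ω ^ 2 * L ^ 2 := by rw [mul_one]; gcongr
  have h6 : ω ^ 2 * ζ * W ≤ ω ^ 2 * L ^ 2 * B := by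
    calc ω ^ 2 * ζ * W ≤ ω ^ 2 * ζ * (B * N) := mul_le_mul_of_nonneg_left hβe (by positivity)
      _ ≤ ω ^ 2 * 1 * (B * L ^ 2) := by
        gcongr
        exact he.trans hLL
      _ = ω ^ 2 * L ^ 2 * B := by ring
  have h7 : 0 ≤ 2 * μ ^ 3 * ω ^ 2 * L ^ 2 * B := by positivity
  have h8 : 0 ≤ ω ^ 2 * L ^ 2 * B := by positivity
  linarith

theorem abs_lineDeriv_time_le {n : ℕ} {F : SpaceTime n → ℝ} {C : ℝ≥0} (hF : LipschitzWith C F)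
    (z : SpaceTime n) : |timeDeriv F z| ≤ C := by
  have := norm_lineDeriv_le_of_lipschitz ℝ hF (x₀ := z) (v := ((0, 1) : SpaceTime n))
  simpa [Prod.norm_def, timeDeriv] using this

/-- The energy inequality before integration. -/
theorem UnitSolution.energy_ae {n : ℕ} {ν : ℝ}
    {a : SpaceTime n → Matrix (Fin n) (Fin n) ℝ}
    {b : SpaceTime n → EuclideanSpace ℝ (Fin n)} {u : SpaceTime n → ℝ}
    (hu : UnitSolution ν a b u) (k : ℝ) {ζ : SpaceTime n → ℝ} {L : ℝ≥0} (hL : 1 ≤ L)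
    (hζ : LipschitzWith L ζ) (h0 : ∀ z, 0 ≤ ζ z) (h1 : ∀ z, ζ z ≤ 1) :
    ∀ᵐ z ∂(volume.restrict (cyl n 1)),
      1 / 2 * timeDeriv (fun z => trunc k u z ^ 2 * ζ z ^ 2) z
      + 1 / 2 * ∑ i, b z i * spaceDeriv i (fun z => trunc k u z ^ 2 * ζ z ^ 2) z
      + ν / 2 * (spaceGradSq (trunc k u) z * ζ z ^ 2) ≤
      -weakIntegrand a b u (fun z => trunc k u z * ζ z ^ 2) z +
      1 / 2 * ((2 + 4 * (ν⁻¹) ^ 3) * L ^ 2) *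
        {z | ζ z ≠ 0}.indicator (fun z => trunc k u z ^ 2 * (1 + ‖b z‖)) z := by
  obtain ⟨C, hC⟩ := hu.lipschitz
  have hw := lipschitz_trunc k hC
  filter_upwards [ae_restrict_of_ae (hC.ae_differentiableAt (μ := volume)),
    ae_restrict_of_ae (hw.ae_differentiableAt (μ := volume)),
    ae_restrict_of_ae (hζ.ae_differentiableAt (μ := volume)),
    hu.parabolic.lower, hu.parabolic.bound] with z hdu hdw hdζ hlow hbd
  set w := trunc k u with hwdef
  -- Where `Dw = -Du` the equation is rewritten for `w` with the opposite sign; elsewhere `w` and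
  -- `Dw` vanish and so do both sides.
  have hT : weakIntegrand a b u (fun z => w z * ζ z ^ 2) z =
      -(timeDeriv w z * (w z * ζ z ^ 2) +
        ∑ i, ∑ j, a z i j * spaceDeriv j w z *
          (spaceDeriv i w z * ζ z ^ 2 + 2 * w z * ζ z * spaceDeriv i ζ z)
        + (∑ i, b z i * spaceDeriv i w z) * (w z * ζ z ^ 2)) := by
    simp only [weakIntegrand, timeDeriv, spaceDeriv, lineDeriv_mul_sq hdw hdζ]
    rcases lineDeriv_trunc k hdu hdw with h | ⟨hz, h⟩
    · simp only [← hwdef] at h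
      have h' : ∀ v, lineDeriv ℝ u z v = -lineDeriv ℝ w z v := fun v => by rw [h v, neg_neg]
      simp only [h', mul_neg, neg_mul, Finset.sum_neg_distrib]
      ring
    · simp only [← hwdef] at h hz
      simp [h, hz]
  rw [hT, neg_neg]
  simp only [timeDeriv, spaceDeriv, lineDeriv_sq_mul_sq hdw hdζ]
  by_cases hz : ζ z = 0
  · rw [indicator_of_notMem (by simp [hz])]
    simp [hz]
  · rw [indicator_of_mem (by simpa using hz)]
    have hnorm : ∀ F : SpaceTime n → ℝ,
        ‖(WithLp.toLp 2 fun i => spaceDeriv i F z : EuclideanSpace ℝ (Fin n))‖ ^ 2 =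
          spaceGradSq F z := fun F => by
      rw [EuclideanSpace.norm_sq_eq]; simp [spaceGradSq]
    have := energy_pointwise (L := L) hu.pos (by exact_mod_cast hL) (a z) (b z)
      (WithLp.toLp 2 fun i => spaceDeriv i w z) (WithLp.toLp 2 fun i => spaceDeriv i ζ z)
      (ω := w z) (ζ := ζ z) (pt := timeDeriv w z) (et := timeDeriv ζ z) (trunc_nonneg _ _ _) (h0 z) (h1 z)
      (hlow _) (hbd _ _) ?_ (abs_lineDeriv_time_le hζ z)
    · rw [hnorm] at this
      exact this
    · have h2 := spaceGradSq_le hζ hdζ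
      rw [← hnorm] at h2
      exact le_of_sq_le_sq h2 L.2

/-- The energy inequality on a time slab. -/
theorem UnitSolution.energy {n : ℕ} {ν : ℝ}
    {a : SpaceTime n → Matrix (Fin n) (Fin n) ℝ}
    {b : SpaceTime n → EuclideanSpace ℝ (Fin n)} {u : SpaceTime n → ℝ}
    (hu : UnitSolution ν a b u) {k : ℝ} (hk : 0 ≤ k) {ζ : SpaceTime n → ℝ} {L : ℝ≥0} (hL : 1 ≤ L)
    (hζ : LipschitzWith L ζ) (h0 : ∀ z, 0 ≤ ζ z) (h1 : ∀ z, ζ z ≤ 1) {ρ : ℝ} (hρ : ρ < 1)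
    (hs : ∀ z : SpaceTime n, ρ < ‖z.1‖ → ζ z = 0) {t₁ t₂ : ℝ} (ht₁ : -1 < t₁) (ht : t₁ ≤ t₂)
    (ht₂ : t₂ < 0) :
    (∫ x in Metric.ball (0 : EuclideanSpace ℝ (Fin n)) 1, trunc k u (x, t₂) ^ 2 * ζ (x, t₂) ^ 2) +
      ν * ∫ z in slab n t₁ t₂, spaceGradSq (trunc k u) z * ζ z ^ 2 ≤
    (∫ x in Metric.ball (0 : EuclideanSpace ℝ (Fin n)) 1, trunc k u (x, t₁) ^ 2 * ζ (x, t₁) ^ 2) +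
      (2 + 4 * (ν⁻¹) ^ 3) * L ^ 2 * ∫ z in slab n t₁ t₂,
        {z | ζ z ≠ 0}.indicator (fun z => trunc k u z ^ 2 * (1 + ‖b z‖)) z := by
  obtain ⟨C, hC⟩ := hu.lipschitz
  have hw := bddLip_trunc hk hu.lipschitz hu.nonneg
  have hζb : BddLip ζ := ⟨⟨L, hζ⟩, 1, fun z => by rw [abs_of_nonneg (h0 z)]; exact h1 z⟩
  have hF : BddLip fun z => trunc k u z ^ 2 * ζ z ^ 2 := hw.sq.mul hζb.sq
  obtain ⟨CF, hCF⟩ := hF.1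
  have hΨ : BddLip fun z => trunc k u z * ζ z ^ 2 := hw.mul hζb.sq
  have hsub : slab n t₁ t₂ ⊆ cyl n 1 := slab_subset_cyl ht₁.le ht₂.le
  have hfin := (volume_slab_lt_top n t₁ t₂).ne
  have hbS : IntegrableOn b (slab n t₁ t₂) := hu.integrable.mono_set hsub
  have i1 : IntegrableOn (timeDeriv fun z => trunc k u z ^ 2 * ζ z ^ 2) (slab n t₁ t₂) :=
    integrableOn_lineDeriv hfin hCF _
  have i2 : IntegrableOn (fun z => ∑ i, b z i *
      spaceDeriv i (fun z => trunc k u z ^ 2 * ζ z ^ 2) z) (slab n t₁ t₂) :=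
    integrable_finsetSum _ fun i _ => integrableOn_mul_lineDeriv (integrableOn_coord hbS i) hCF _
  have i3 : IntegrableOn (fun z => spaceGradSq (trunc k u) z * ζ z ^ 2) (slab n t₁ t₂) := by
    refine IntegrableOn.mul_bddLip ⟨(measurable_spaceGradSq hw.continuous).aestronglyMeasurable,
      HasFiniteIntegral.restrict_of_bounded (n * C ^ 2) hfin.lt_top
      (Eventually.of_forall fun z => ?_)⟩ hζb.sq
    rw [Real.norm_of_nonneg (spaceGradSq_nonneg _ _)]
    exact spaceGradSq_le_mul (lipschitz_trunc k hC) z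
  have i4 : IntegrableOn (weakIntegrand a b u fun z => trunc k u z * ζ z ^ 2) (slab n t₁ t₂) :=
    (hu.integrableOn_weakIntegrand hΨ).mono_set hsub
  have i5 : IntegrableOn ({z | ζ z ≠ 0}.indicator fun z => trunc k u z ^ 2 * (1 + ‖b z‖))
      (slab n t₁ t₂) := by
    refine Integrable.indicator ?_
      (measurableSet_eq_fun hζ.continuous.measurable measurable_const).compl
    have : IntegrableOn (fun z => 1 + ‖b z‖) (slab n t₁ t₂) :=
      (integrableOn_const hfin).add hbS.norm
    refine (IntegrableOn.mul_bddLip this hw.sq).congr (Eventually.of_forall fun z => ?_)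
    exact mul_comm _ _
  have hmain := integral_mono_ae (((i1.const_mul (1 / 2)).add (i2.const_mul (1 / 2))).add
    (i3.const_mul (ν / 2))) (i4.neg.add (i5.const_mul (1 / 2 * ((2 + 4 * (ν⁻¹) ^ 3) * L ^ 2))))
    (ae_restrict_of_ae_restrict_of_subset hsub (hu.energy_ae k hL hζ h0 h1))
  have hzero := hu.integral_weakIntegrand_slab hρ ht₁ ht₂ hΨ (fun z hz => by simp [hs z hz])
  -- The one place where the sign of `div b` acts: this integral is nonnegative and is dropped from
  -- the left of the integrated inequality.
  have hdiv := hu.div.slab hu.integrable hρ ht₁ ht₂ hF (fun z hz => by simp [hs z hz])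
    (fun z => by positivity)
  have htime := integral_timeDeriv_slab ht hF
  rw [integral_add' ((i1.const_mul (1 / 2)).add (i2.const_mul (1 / 2))) (i3.const_mul (ν / 2)),
    integral_add' (i1.const_mul (1 / 2)) (i2.const_mul (1 / 2)),
    integral_add' i4.neg (i5.const_mul _), integral_const_mul, integral_const_mul,
    integral_const_mul, integral_const_mul, integral_neg', hzero, htime] at hmain
  linarith

/-! ### The energy inequality with extended nonnegative integrals. -/

/-- The drift majorant `1 + |b|`. -/
noncomputable def weight {n : ℕ} (b : SpaceTime n → EuclideanSpace ℝ (Fin n)) (z : SpaceTime n) :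
    ℝ≥0∞ := 1 + ‖b z‖ₑ

/-- The right-hand side of the energy inequality. -/
noncomputable def energyRHS {n : ℕ} (ν : ℝ) (b : SpaceTime n → EuclideanSpace ℝ (Fin n))
    (w ζ : SpaceTime n → ℝ) (L : ℝ≥0) (t₁ t₂ : ℝ) : ℝ≥0∞ :=
  (∫⁻ x in Metric.ball (0 : EuclideanSpace ℝ (Fin n)) 1,
      ENNReal.ofReal ((w (x, t₁) * ζ (x, t₁)) ^ 2)) +
    ENNReal.ofReal ((2 + 4 * (ν⁻¹) ^ 3) * L ^ 2) * ∫⁻ z in slab n t₁ t₂ ∩ {z | ζ z ≠ 0},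
      ENNReal.ofReal (w z ^ 2) * weight b z

theorem energyRHS_mono {n : ℕ} (ν : ℝ) (b : SpaceTime n → EuclideanSpace ℝ (Fin n))
    (w ζ : SpaceTime n → ℝ) (L : ℝ≥0) (t₁ : ℝ) {t₂ t₃ : ℝ} (h : t₂ ≤ t₃) :
    energyRHS ν b w ζ L t₁ t₂ ≤ energyRHS ν b w ζ L t₁ t₃ := by
  unfold energyRHS
  gcongr
  exact prod_mono subset_rfl (Ioo_subset_Ioo_right h)

theorem UnitSolution.energy_lintegral_aux {n : ℕ} {ν : ℝ}
    {a : SpaceTime n → Matrix (Fin n) (Fin n) ℝ}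
    {b : SpaceTime n → EuclideanSpace ℝ (Fin n)} {u : SpaceTime n → ℝ}
    (hu : UnitSolution ν a b u) {k : ℝ} (hk : 0 ≤ k) {ζ : SpaceTime n → ℝ} {L : ℝ≥0} (hL : 1 ≤ L)
    (hζ : LipschitzWith L ζ) (h0 : ∀ z, 0 ≤ ζ z) (h1 : ∀ z, ζ z ≤ 1) {ρ : ℝ} (hρ : ρ < 1)
    (hs : ∀ z : SpaceTime n, ρ < ‖z.1‖ → ζ z = 0) {t₁ t₂ : ℝ} (ht₁ : -1 < t₁) (ht : t₁ ≤ t₂)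
    (ht₂ : t₂ < 0) :
    (∫⁻ x in Metric.ball (0 : EuclideanSpace ℝ (Fin n)) 1,
      ENNReal.ofReal ((trunc k u (x, t₂) * ζ (x, t₂)) ^ 2)) +
      ENNReal.ofReal ν * ∫⁻ z in slab n t₁ t₂,
        ENNReal.ofReal (spaceGradSq (trunc k u) z * ζ z ^ 2) ≤
    energyRHS ν b (trunc k u) ζ L t₁ t₂ := by
  obtain ⟨C, hC⟩ := hu.lipschitz
  have hw := bddLip_trunc hk hu.lipschitz hu.nonneg
  have hζb : BddLip ζ := ⟨⟨L, hζ⟩, 1, fun z => by rw [abs_of_nonneg (h0 z)]; exact h1 z⟩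
  have hF : BddLip fun z => trunc k u z ^ 2 * ζ z ^ 2 := hw.sq.mul hζb.sq
  have hsub : slab n t₁ t₂ ⊆ cyl n 1 := slab_subset_cyl ht₁.le ht₂.le
  have hfin := (volume_slab_lt_top n t₁ t₂).ne
  have hbS : IntegrableOn b (slab n t₁ t₂) := hu.integrable.mono_set hsub
  have hζm : MeasurableSet {z | ζ z ≠ 0} :=
    (measurableSet_eq_fun hζ.continuous.measurable measurable_const).compl
  have i3 : IntegrableOn (fun z => spaceGradSq (trunc k u) z * ζ z ^ 2) (slab n t₁ t₂) := by
    refine IntegrableOn.mul_bddLip ⟨(measurable_spaceGradSq hw.continuous).aestronglyMeasurable,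
      HasFiniteIntegral.restrict_of_bounded (n * C ^ 2) hfin.lt_top
      (Eventually.of_forall fun z => ?_)⟩ hζb.sq
    rw [Real.norm_of_nonneg (spaceGradSq_nonneg _ _)]
    exact spaceGradSq_le_mul (lipschitz_trunc k hC) z
  have i5' : IntegrableOn (fun z => trunc k u z ^ 2 * (1 + ‖b z‖)) (slab n t₁ t₂) := by
    have : IntegrableOn (fun z => 1 + ‖b z‖) (slab n t₁ t₂) :=
      (integrableOn_const hfin).add hbS.norm
    refine (IntegrableOn.mul_bddLip this hw.sq).congr (Eventually.of_forall fun z => ?_)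
    exact mul_comm _ _
  have i5 : IntegrableOn ({z | ζ z ≠ 0}.indicator fun z => trunc k u z ^ 2 * (1 + ‖b z‖))
      (slab n t₁ t₂) := i5'.indicator hζm
  have hslice : ∀ t : ℝ, ENNReal.ofReal (∫ x in Metric.ball (0 : EuclideanSpace ℝ (Fin n)) 1,
      trunc k u (x, t) ^ 2 * ζ (x, t) ^ 2) = ∫⁻ x in Metric.ball (0 : EuclideanSpace ℝ (Fin n)) 1,
      ENNReal.ofReal ((trunc k u (x, t) * ζ (x, t)) ^ 2) := fun t => by
    obtain ⟨M, hM⟩ := hF.2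
    simp only [mul_pow]
    refine ofReal_integral_eq_lintegral_ofReal ?_ (Eventually.of_forall fun x => by positivity)
    exact Measure.integrableOn_of_bounded (M := M) Metric.isBounded_ball.measure_lt_top.ne
      (hF.continuous.comp (by fun_prop : Continuous fun x : EuclideanSpace ℝ (Fin n) => (x, t))).aestronglyMeasurable
      (Eventually.of_forall fun x => hM _)
  have hg : ENNReal.ofReal (∫ z in slab n t₁ t₂, spaceGradSq (trunc k u) z * ζ z ^ 2) =
      ∫⁻ z in slab n t₁ t₂, ENNReal.ofReal (spaceGradSq (trunc k u) z * ζ z ^ 2) :=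
    ofReal_integral_eq_lintegral_ofReal i3
      (Eventually.of_forall fun z => mul_nonneg (spaceGradSq_nonneg _ _) (sq_nonneg _))
  have hr : ENNReal.ofReal (∫ z in slab n t₁ t₂,
        {z | ζ z ≠ 0}.indicator (fun z => trunc k u z ^ 2 * (1 + ‖b z‖)) z) =
      ∫⁻ z in slab n t₁ t₂ ∩ {z | ζ z ≠ 0}, ENNReal.ofReal (trunc k u z ^ 2) * weight b z := by
    rw [ofReal_integral_eq_lintegral_ofReal i5
      (Eventually.of_forall fun z => indicator_nonneg (fun z _ => by positivity) z),
      inter_comm, ← Measure.restrict_restrict hζm, ← lintegral_indicator hζm]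
    refine lintegral_congr fun z => ?_
    by_cases hz : z ∈ {z | ζ z ≠ 0}
    · rw [indicator_of_mem hz, indicator_of_mem hz, ENNReal.ofReal_mul (sq_nonneg _),
        ENNReal.ofReal_add zero_le_one (norm_nonneg _), ENNReal.ofReal_one, ofReal_norm, weight]
    · rw [indicator_of_notMem hz, indicator_of_notMem hz, ENNReal.ofReal_zero]
  have hν := hu.pos
  have := ENNReal.ofReal_le_ofReal (hu.energy hk hL hζ h0 h1 hρ hs ht₁ ht ht₂)
  rw [ENNReal.ofReal_add (integral_nonneg fun x => by positivity) (mul_nonneg hν.le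
      (integral_nonneg fun z => mul_nonneg (spaceGradSq_nonneg _ _) (sq_nonneg _))),
    ENNReal.ofReal_add (integral_nonneg fun x => by positivity) (mul_nonneg (by positivity)
      (integral_nonneg fun z => indicator_nonneg (fun z _ => by positivity) z)),
    hslice, hslice, ENNReal.ofReal_mul hν.le, hg, ENNReal.ofReal_mul (by positivity), hr] at this
  exact this

theorem UnitSolution.energy_slice {n : ℕ} {ν : ℝ}
    {a : SpaceTime n → Matrix (Fin n) (Fin n) ℝ}
    {b : SpaceTime n → EuclideanSpace ℝ (Fin n)} {u : SpaceTime n → ℝ}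
    (hu : UnitSolution ν a b u) {k : ℝ} (hk : 0 ≤ k) {ζ : SpaceTime n → ℝ} {L : ℝ≥0} (hL : 1 ≤ L)
    (hζ : LipschitzWith L ζ) (h0 : ∀ z, 0 ≤ ζ z) (h1 : ∀ z, ζ z ≤ 1) {ρ : ℝ} (hρ : ρ < 1)
    (hs : ∀ z : SpaceTime n, ρ < ‖z.1‖ → ζ z = 0) {t₁ t : ℝ} (ht₁ : -1 < t₁) (ht : t₁ ≤ t)
    (ht₂ : t < 0) :
    ∫⁻ x in Metric.ball (0 : EuclideanSpace ℝ (Fin n)) 1,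
      ENNReal.ofReal ((trunc k u (x, t) * ζ (x, t)) ^ 2) ≤
    energyRHS ν b (trunc k u) ζ L t₁ 0 :=
  (le_self_add.trans (hu.energy_lintegral_aux hk hL hζ h0 h1 hρ hs ht₁ ht ht₂)).trans
    (energyRHS_mono _ _ _ _ _ _ ht₂.le)

/-- Test functions are compactly supported in the open cylinder, so the energy inequality stops at
times `t₂ < 0`. Exhausting the slab by such times recovers the top, as the right-hand side is
monotone in `t₂`. -/
theorem UnitSolution.energy_grad {n : ℕ} {ν : ℝ}
    {a : SpaceTime n → Matrix (Fin n) (Fin n) ℝ}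
    {b : SpaceTime n → EuclideanSpace ℝ (Fin n)} {u : SpaceTime n → ℝ}
    (hu : UnitSolution ν a b u) {k : ℝ} (hk : 0 ≤ k) {ζ : SpaceTime n → ℝ} {L : ℝ≥0} (hL : 1 ≤ L)
    (hζ : LipschitzWith L ζ) (h0 : ∀ z, 0 ≤ ζ z) (h1 : ∀ z, ζ z ≤ 1) {ρ : ℝ} (hρ : ρ < 1)
    (hs : ∀ z : SpaceTime n, ρ < ‖z.1‖ → ζ z = 0) {t₁ : ℝ} (ht₁ : -1 < t₁) :
    ENNReal.ofReal ν * ∫⁻ z in slab n t₁ 0,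
        ENNReal.ofReal (spaceGradSq (trunc k u) z * ζ z ^ 2) ≤
    energyRHS ν b (trunc k u) ζ L t₁ 0 := by
  have hU : slab n t₁ 0 = ⋃ m : ℕ, slab n t₁ (-(1 / ((m : ℝ) + 1))) := by
    ext z
    simp only [slab, mem_iUnion, mem_prod, mem_Ioo]
    constructor
    · rintro ⟨hz, h2, h3⟩
      obtain ⟨m, hm⟩ := exists_nat_one_div_lt (neg_pos.2 h3)
      exact ⟨m, hz, h2, by linarith⟩
    · rintro ⟨m, hz, h2, h3⟩
      have : (0 : ℝ) < 1 / ((m : ℝ) + 1) := by positivity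
      exact ⟨hz, h2, by linarith⟩
  have hmono : Monotone fun m : ℕ => slab n t₁ (-(1 / ((m : ℝ) + 1))) := fun m m' h =>
    prod_mono subset_rfl (Ioo_subset_Ioo_right (neg_le_neg (one_div_le_one_div_of_le
      (by positivity) (by exact_mod_cast Nat.add_le_add_right h 1))))
  rw [hU, setLIntegral_iUnion_of_directed _ hmono.directed_le, ENNReal.mul_iSup]
  refine iSup_le fun m => ?_
  have hm : (0 : ℝ) < 1 / ((m : ℝ) + 1) := by positivity
  rcases le_or_gt t₁ (-(1 / ((m : ℝ) + 1))) with h | h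
  · exact (le_add_self.trans (hu.energy_lintegral_aux hk hL hζ h0 h1 hρ hs ht₁ h
      (by linarith))).trans (energyRHS_mono _ _ _ _ _ _ (by linarith))
  · rw [slab, Ioo_eq_empty (by linarith), prod_empty]
    simp

/-! ### Weighted parabolic interpolation. -/

theorem lintegral_mul_mul_rpow_le {α : Type*} [MeasurableSpace α] {μ : Measure α}
    {f g h : α → ℝ≥0∞} (hf : AEMeasurable f μ) (hg : AEMeasurable g μ) (hh : AEMeasurable h μ)
    {p q r : ℝ} (hp : 0 ≤ p) (hq : 0 ≤ q) (hr : 0 ≤ r) (hpqr : p + q + r = 1) :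
    ∫⁻ a, f a ^ p * g a ^ q * h a ^ r ∂μ ≤
      (∫⁻ a, f a ∂μ) ^ p * (∫⁻ a, g a ∂μ) ^ q * (∫⁻ a, h a ∂μ) ^ r := by
  have := ENNReal.lintegral_prod_norm_pow_le (μ := μ) (Finset.univ : Finset (Fin 3))
    (f := ![f, g, h]) (p := ![p, q, r])
    (by intro i _; fin_cases i <;> simpa) (by simp [Fin.sum_univ_three, hpqr])
    (by intro i _; fin_cases i <;> simpa)
  simpa [Fin.prod_univ_three] using this

theorem measurable_weight {n : ℕ} {b : SpaceTime n → EuclideanSpace ℝ (Fin n)}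
    (hb : Measurable b) : Measurable (weight b) := measurable_const.add hb.enorm

/-- The scale-invariant size of the drift majorant. -/
noncomputable def weightNorm {n : ℕ} (q l : ℝ) (b : SpaceTime n → EuclideanSpace ℝ (Fin n)) :
    ℝ≥0∞ :=
  ∫⁻ t in Ioo (-1 : ℝ) 0,
    (∫⁻ x in Metric.ball (0 : EuclideanSpace ℝ (Fin n)) 1, weight b (x, t) ^ q) ^ (l / q)

theorem lintegral_slab {n : ℕ} {t₁ t₂ : ℝ} {f : SpaceTime n → ℝ≥0∞} (hf : Measurable f) :
    ∫⁻ z in slab n t₁ t₂, f z = ∫⁻ t in Ioo t₁ t₂,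
      ∫⁻ x in Metric.ball (0 : EuclideanSpace ℝ (Fin n)) 1, f (x, t) := by
  rw [slab, Measure.volume_eq_prod, ← Measure.prod_restrict,
    lintegral_prod_symm' _ hf]

theorem lintegral_gradSq_eq_ball {n : ℕ} {W : EuclideanSpace ℝ (Fin n) → ℝ} {ρ : ℝ} (hρ : ρ < 1)
    (hW : ∀ x, ρ < ‖x‖ → W x = 0) :
    ∫⁻ x, ENNReal.ofReal (gradSq W x) =
      ∫⁻ x in Metric.ball (0 : EuclideanSpace ℝ (Fin n)) 1, ENNReal.ofReal (gradSq W x) := by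
  symm
  apply setLIntegral_eq_of_support_subset
  intro x hx
  by_contra h
  have h1 : 1 ≤ ‖x‖ := by simpa using h
  exact hx (by simp [gradSq_eq_zero_of_support hW (hρ.trans_le h1)])

/-- Exponents for the parabolic interpolation inequality. -/
theorem exists_exponents {n : ℕ} (hn : 2 ≤ n) {q l : ℝ} (hq : 1 < q) (hl : 1 < l)
    (hql : (n : ℝ) / (2 * q) + 1 / l < 1) :
    ∃ m β γ δ : ℝ, 2 < m ∧ 1 / 2 - 1 / (n : ℝ) < 1 / m ∧ 0 ≤ β ∧ 0 ≤ γ ∧ 0 < δ ∧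
      1 / q + β + γ = 1 ∧ 2 * β + m * γ = 2 + 2 * δ ∧ m / 2 * γ = 1 - 1 / l := by
  have hn0 : (0 : ℝ) < n := by positivity
  have hn2 : (2 : ℝ) ≤ n := by exact_mod_cast hn
  have hl1 : 0 < 1 - 1 / l := by
    rw [sub_pos, div_lt_one (by linarith)]; exact hl
  have hq0 : 0 < 1 / q := by positivity
  set s := (1 / q) / (1 - 1 / l) with hs
  have hs0 : 0 < s := by positivity
  have hsn : s < 2 / n := by
    rw [hs, div_lt_div_iff₀ hl1 hn0]
    have : (n : ℝ) / (2 * q) = 1 / q * n / 2 := by field_simp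
    rw [this] at hql
    linarith
  have hnle : 2 / (n : ℝ) ≤ 1 := by rw [div_le_one hn0]; exact hn2
  obtain ⟨θ, hθ1, hθ2⟩ := exists_between hsn
  have hθ0 : 0 < θ := hs0.trans hθ1
  have hθ3 : θ < 1 := hθ2.trans_le hnle
  have h1θ : 0 < 1 - θ := by linarith
  have hkey : 1 / q < θ * (1 - 1 / l) := by
    rw [hs, div_lt_iff₀ hl1] at hθ1; exact hθ1
  refine ⟨2 / (1 - θ), 1 - 1 / q - (1 - 1 / l) * (1 - θ), (1 - 1 / l) * (1 - θ),
    (1 - 1 / l) * θ - 1 / q, ?_, ?_, ?_, by positivity, by linarith, by ring, ?_, ?_⟩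
  · rw [lt_div_iff₀ h1θ]; linarith
  · rw [one_div_div]
    have : 2 / (n : ℝ) = 2 * (1 / n) := by ring
    linarith
  · have : 0 < 1 / l := by positivity
    nlinarith
  · field_simp; ring
  · field_simp

/-- The parabolic interpolation inequality with a mixed-norm weight. -/
theorem exists_interpolation {n : ℕ} (hn : 2 ≤ n) {q l : ℝ} (hq : 1 < q) (hl : 1 < l)
    (hql : (n : ℝ) / (2 * q) + 1 / l < 1) :
    ∃ (δ : ℝ) (A : ℝ≥0), 0 < δ ∧ ∀ (b : SpaceTime n → EuclideanSpace ℝ (Fin n)), Measurable b →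
      ∀ (W : SpaceTime n → ℝ) (C : ℝ≥0), LipschitzWith C W → ∀ ρ : ℝ, ρ < 1 →
      (∀ z : SpaceTime n, ρ < ‖z.1‖ → W z = 0) → ∀ (t₁ : ℝ), -1 ≤ t₁ → ∀ M : ℝ≥0∞,
      (∀ t ∈ Ioo t₁ 0, ∫⁻ x in Metric.ball (0 : EuclideanSpace ℝ (Fin n)) 1,
        ENNReal.ofReal (W (x, t) ^ 2) ≤ M) →
      (∫⁻ z in slab n t₁ 0, ENNReal.ofReal (spaceGradSq W z) ≤ M) →
      ∫⁻ z in slab n t₁ 0, weight b z * ‖W z‖ₑ ^ (2 + 2 * δ) ≤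
        A * weightNorm q l b ^ (1 / l) * M ^ (1 + δ) := by
  obtain ⟨m, β, γ, δ, hm, hmn, hβ, hγ, hδ, h1, h2, h3⟩ := exists_exponents hn hq hl hql
  obtain ⟨A, hA⟩ := sobolev_lipschitz hn hm hmn
  have hq0 : 0 < q := by linarith
  have hl0 : 0 < l := by linarith
  have hm0 : 0 < m := by linarith
  refine ⟨δ, A ^ γ, hδ, fun b hb W C hW ρ hρ hs t₁ ht₁ M hM1 hM2 => ?_⟩
  set B := Metric.ball (0 : EuclideanSpace ℝ (Fin n)) 1
  have hB : MeasurableSet B := Metric.isOpen_ball.measurableSet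
  have hg := measurable_weight hb
  have hWm : Measurable fun z => ‖W z‖ₑ := hW.continuous.measurable.enorm
  have hslice : ∀ t : ℝ, Measurable fun x : EuclideanSpace ℝ (Fin n) => (x, t) :=
    fun t => by fun_prop
  have hDm : Measurable fun z => ENNReal.ofReal (spaceGradSq W z) :=
    (measurable_spaceGradSq hW.continuous).ennreal_ofReal
  let G : ℝ → ℝ≥0∞ := fun t => ∫⁻ x in B, weight b (x, t) ^ q
  let D : ℝ → ℝ≥0∞ := fun t => ∫⁻ x in B, ENNReal.ofReal (spaceGradSq W (x, t))
  have hGm : Measurable G := Measurable.lintegral_prod_left' (hg.pow_const q)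
  have hDm' : Measurable D := Measurable.lintegral_prod_left' hDm
  have hx : ∀ t ∈ Ioo t₁ 0, ∫⁻ x in B, weight b (x, t) * ‖W (x, t)‖ₑ ^ (2 + 2 * δ) ≤
      A ^ γ * M ^ β * ((G t ^ (l / q)) ^ (1 / l) * D t ^ (1 - 1 / l)) := by
    intro t ht
    -- Split for Hölder in `x`: the weight in `L^q`, a power of `W` controlled by the slice energy,
    -- and a power controlled by Sobolev. The relation `m γ / 2 = 1 - 1/l` then leaves the gradient
    -- integral to the power dual to `l`, ready for Hölder in `t`.
    have e0 : ∀ x, weight b (x, t) * ‖W (x, t)‖ₑ ^ (2 + 2 * δ) =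
        (weight b (x, t) ^ q) ^ (1 / q) * (ENNReal.ofReal (W (x, t) ^ 2)) ^ β *
          (‖W (x, t)‖ₑ ^ m) ^ γ := fun x => by
      have e1 : ENNReal.ofReal (W (x, t) ^ 2) = ‖W (x, t)‖ₑ ^ (2 : ℝ) := by
        rw [← sq_abs, ENNReal.ofReal_pow (abs_nonneg _), ← Real.norm_eq_abs, ofReal_norm]
        norm_cast
      rw [e1, ← ENNReal.rpow_mul, ← ENNReal.rpow_mul, ← ENNReal.rpow_mul, mul_one_div_cancel hq0.ne',
        ENNReal.rpow_one, mul_assoc, ← ENNReal.rpow_add_of_nonneg _ _ (by positivity) (by positivity),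
        h2]
    simp_rw [e0]
    have hol := lintegral_mul_mul_rpow_le (μ := volume.restrict B) (p := 1 / q) (q := β) (r := γ)
      (((hg.comp (hslice t)).pow_const q).aemeasurable)
      (((hW.continuous.measurable.comp (hslice t)).pow_const 2).ennreal_ofReal.aemeasurable)
      (((hWm.comp (hslice t)).pow_const m).aemeasurable) (by positivity) hβ hγ h1
    refine hol.trans ?_
    have hsob := hA (fun x => W (x, t)) C (lipschitz_slice hW t)
      (fun x hx => hs (x, t) (hρ.trans hx))
    rw [lintegral_gradSq_eq_ball hρ (fun x hx => hs (x, t) hx)] at hsob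
    have hD : (∫⁻ x in B, ENNReal.ofReal (gradSq (fun x => W (x, t)) x)) = D t := by
      simp only [D, spaceGradSq_eq_gradSq]
    rw [hD] at hsob
    have hsob' : ∫⁻ x in B, ‖W (x, t)‖ₑ ^ m ≤ A * D t ^ (m / 2) :=
      (setLIntegral_le_lintegral _ _).trans hsob
    calc (∫⁻ x in B, weight b (x, t) ^ q) ^ (1 / q) *
          (∫⁻ x in B, ENNReal.ofReal (W (x, t) ^ 2)) ^ β * (∫⁻ x in B, ‖W (x, t)‖ₑ ^ m) ^ γ
        ≤ (G t) ^ (1 / q) * M ^ β * (A * D t ^ (m / 2)) ^ γ := by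
          gcongr
          exact hM1 t ht
      _ = _ := by
          rw [ENNReal.mul_rpow_of_nonneg _ _ hγ, ← ENNReal.rpow_mul, h3, ← ENNReal.rpow_mul]
          have : l / q * (1 / l) = 1 / q := by field_simp
          rw [this]
          ring
  have hl1 : 0 ≤ 1 - 1 / l := by
    rw [sub_nonneg, div_le_one hl0]; exact hl.le
  have hl2 : 0 ≤ 1 / l := by positivity
  calc ∫⁻ z in slab n t₁ 0, weight b z * ‖W z‖ₑ ^ (2 + 2 * δ)
      = ∫⁻ t in Ioo t₁ 0, ∫⁻ x in B, weight b (x, t) * ‖W (x, t)‖ₑ ^ (2 + 2 * δ) :=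
        lintegral_slab (hg.mul (hWm.pow_const _))
    _ ≤ ∫⁻ t in Ioo t₁ 0, A ^ γ * M ^ β * ((G t ^ (l / q)) ^ (1 / l) * D t ^ (1 - 1 / l)) :=
        setLIntegral_mono' measurableSet_Ioo hx
    _ = A ^ γ * M ^ β * ∫⁻ t in Ioo t₁ 0, (G t ^ (l / q)) ^ (1 / l) * D t ^ (1 - 1 / l) := by
        rw [lintegral_const_mul]
        exact ((hGm.pow_const _).pow_const _).mul (hDm'.pow_const _)
    _ ≤ A ^ γ * M ^ β * ((∫⁻ t in Ioo t₁ 0, G t ^ (l / q)) ^ (1 / l) *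
          (∫⁻ t in Ioo t₁ 0, D t) ^ (1 - 1 / l)) := by
        gcongr
        exact ENNReal.lintegral_mul_norm_pow_le (hGm.pow_const _).aemeasurable hDm'.aemeasurable
          hl2 hl1 (by ring)
    _ ≤ A ^ γ * M ^ β * (weightNorm q l b ^ (1 / l) * M ^ (1 - 1 / l)) := by
        gcongr
        · exact lintegral_mono_set (Ioo_subset_Ioo_left ht₁)
        · rw [← lintegral_slab hDm]; exact hM2
    _ = _ := by
        have : M ^ (1 + δ) = M ^ β * M ^ (1 - 1 / l) := by
          rw [← ENNReal.rpow_add_of_nonneg _ _ hβ hl1]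
          congr 1
          have : m / 2 * γ = m * γ / 2 := by ring
          linarith
        rw [this, ENNReal.coe_rpow_of_nonneg _ hγ]
        ring

/-- The weight has small integral over sets of small measure. -/
theorem exists_lintegral_weight_le (n : ℕ) {q l : ℝ} (hq : 1 < q) (hl : 1 < l) :
    ∃ (s : ℝ) (A : ℝ≥0), 0 < s ∧ ∀ (b : SpaceTime n → EuclideanSpace ℝ (Fin n)), Measurable b →
      ∀ S : Set (SpaceTime n), MeasurableSet S → S ⊆ slab n (-1) 0 →
      ∫⁻ z in S, weight b z ≤ A * weightNorm q l b ^ (1 / l) * volume S ^ s := by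
  have hq0 : 0 < q := by linarith
  have hl0 : 0 < l := by linarith
  have hq1 : 0 < 1 - 1 / q := by rw [sub_pos, div_lt_one hq0]; exact hq
  have hl1 : 0 < 1 - 1 / l := by rw [sub_pos, div_lt_one hl0]; exact hl
  -- A common exponent for space and time: surplus powers are absorbed by the volume of the ball in
  -- `x` and by a factor one in the three-term Hölder inequality in `t`.
  set s := min (1 - 1 / q) (1 - 1 / l) with hs
  have hs0 : 0 < s := lt_min hq1 hl1
  have hsq : 0 ≤ 1 - 1 / q - s := sub_nonneg.2 (min_le_left _ _)
  have hsl : 0 ≤ 1 - 1 / l - s := sub_nonneg.2 (min_le_right _ _)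
  set B := Metric.ball (0 : EuclideanSpace ℝ (Fin n)) 1
  have hBfin : volume B ≠ ⊤ := Metric.isBounded_ball.measure_lt_top.ne
  refine ⟨s, (volume B ^ (1 - 1 / q - s)).toNNReal, hs0, fun b hb S hS hSs => ?_⟩
  rw [ENNReal.coe_toNNReal (ENNReal.rpow_ne_top_of_nonneg hsq hBfin)]
  have hg := measurable_weight hb
  have hslice : ∀ t : ℝ, Measurable fun x : EuclideanSpace ℝ (Fin n) => (x, t) :=
    fun t => by fun_prop
  let G : ℝ → ℝ≥0∞ := fun t => ∫⁻ x in B, weight b (x, t) ^ q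
  let V : ℝ → ℝ≥0∞ := fun t => ∫⁻ x in B, S.indicator 1 (x, t)
  have h1m : Measurable (S.indicator (1 : SpaceTime n → ℝ≥0∞)) := measurable_one.indicator hS
  have hGm : Measurable G := Measurable.lintegral_prod_left' (hg.pow_const q)
  have hVm : Measurable V := Measurable.lintegral_prod_left' h1m
  have hVB : ∀ t, V t ≤ volume B := fun t => by
    calc V t ≤ ∫⁻ x in B, 1 := lintegral_mono fun x => indicator_le_self' (fun _ _ => zero_le) _
      _ = volume B := by simp
  have hx : ∀ t, ∫⁻ x in B, S.indicator (weight b) (x, t) ≤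
      volume B ^ (1 - 1 / q - s) * ((G t ^ (l / q)) ^ (1 / l) * V t ^ s * 1 ^ (1 - 1 / l - s)) := by
    intro t
    have e0 : ∀ x, S.indicator (weight b) (x, t) =
        (weight b (x, t) ^ q) ^ (1 / q) * (S.indicator 1 (x, t)) ^ (1 - 1 / q) := fun x => by
      rw [← ENNReal.rpow_mul, mul_one_div_cancel hq0.ne', ENNReal.rpow_one]
      by_cases h : (x, t) ∈ S
      · simp [h]
      · rw [indicator_of_notMem h, indicator_of_notMem h, ENNReal.zero_rpow_of_pos hq1, mul_zero]
    simp_rw [e0]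
    refine (ENNReal.lintegral_mul_norm_pow_le ((hg.comp (hslice t)).pow_const q).aemeasurable
      (h1m.comp (hslice t)).aemeasurable (by positivity) hq1.le (by ring)).trans ?_
    have e2 : V t ^ (1 - 1 / q) ≤ volume B ^ (1 - 1 / q - s) * V t ^ s := by
      have : V t ^ (1 - 1 / q) = V t ^ (1 - 1 / q - s) * V t ^ s := by
        rw [← ENNReal.rpow_add_of_nonneg _ _ hsq hs0.le]; congr 1; ring
      rw [this]
      gcongr
      exact hVB t
    calc (∫⁻ x in B, weight b (x, t) ^ q) ^ (1 / q) *
          (∫⁻ x in B, S.indicator 1 (x, t)) ^ (1 - 1 / q)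
        ≤ G t ^ (1 / q) * (volume B ^ (1 - 1 / q - s) * V t ^ s) := by gcongr
      _ = _ := by
        rw [← ENNReal.rpow_mul, ENNReal.one_rpow]
        have : l / q * (1 / l) = 1 / q := by field_simp
        rw [this]; ring
  have hVS : ∫⁻ t in Ioo (-1 : ℝ) 0, V t ≤ volume S := by
    rw [← lintegral_slab h1m, lintegral_indicator_one hS]
    exact Measure.restrict_apply_le _ _
  calc ∫⁻ z in S, weight b z = ∫⁻ z in slab n (-1) 0, S.indicator (weight b) z := by
        rw [lintegral_indicator hS, Measure.restrict_restrict hS, inter_eq_self_of_subset_left hSs]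
    _ = ∫⁻ t in Ioo (-1 : ℝ) 0, ∫⁻ x in B, S.indicator (weight b) (x, t) :=
        lintegral_slab (hg.indicator hS)
    _ ≤ ∫⁻ t in Ioo (-1 : ℝ) 0, volume B ^ (1 - 1 / q - s) *
          ((G t ^ (l / q)) ^ (1 / l) * V t ^ s * 1 ^ (1 - 1 / l - s)) :=
        lintegral_mono fun t => hx t
    _ = volume B ^ (1 - 1 / q - s) * ∫⁻ t in Ioo (-1 : ℝ) 0,
          (G t ^ (l / q)) ^ (1 / l) * V t ^ s * 1 ^ (1 - 1 / l - s) :=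
        lintegral_const_mul _ ((((hGm.pow_const _).pow_const _).mul (hVm.pow_const _)).mul
          measurable_const)
    _ ≤ volume B ^ (1 - 1 / q - s) * ((∫⁻ t in Ioo (-1 : ℝ) 0, G t ^ (l / q)) ^ (1 / l) *
          (∫⁻ t in Ioo (-1 : ℝ) 0, V t) ^ s * (∫⁻ _t in Ioo (-1 : ℝ) 0, 1) ^ (1 - 1 / l - s)) := by
        gcongr
        exact lintegral_mul_mul_rpow_le (hGm.pow_const _).aemeasurable hVm.aemeasurable
          aemeasurable_const (by positivity) hs0.le hsl (by ring)
    _ ≤ volume B ^ (1 - 1 / q - s) * (weightNorm q l b ^ (1 / l) * volume S ^ s * 1) := by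
        gcongr
        · rfl
        · rw [lintegral_one, Measure.restrict_apply_univ, Real.volume_Ioo]
          simp
    _ = _ := by ring

/-! ### Cutoffs and the localized energy estimate. -/

/-- A space-time cutoff. -/
noncomputable def cutoff {n : ℕ} (r c s d : ℝ) (z : SpaceTime n) : ℝ :=
  max 0 (min 1 (min (c * (r - ‖z.1‖)) (d * (z.2 - s))))

theorem cutoff_nonneg {n : ℕ} (r c s d : ℝ) (z : SpaceTime n) : 0 ≤ cutoff r c s d z :=
  le_max_left _ _

theorem cutoff_le_one {n : ℕ} (r c s d : ℝ) (z : SpaceTime n) : cutoff r c s d z ≤ 1 :=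
  max_le zero_le_one (min_le_left _ _)

theorem cutoff_eq_one {n : ℕ} {r c s d : ℝ} {z : SpaceTime n} (h1 : 1 ≤ c * (r - ‖z.1‖))
    (h2 : 1 ≤ d * (z.2 - s)) : cutoff r c s d z = 1 := by
  rw [cutoff, min_eq_left (le_min h1 h2), max_eq_right zero_le_one]

theorem lt_of_cutoff_ne_zero {n : ℕ} {r c s d : ℝ} (hc : 0 < c) (hd : 0 < d) {z : SpaceTime n}
    (h : cutoff r c s d z ≠ 0) : ‖z.1‖ < r ∧ s < z.2 := by
  have h0 : 0 < min 1 (min (c * (r - ‖z.1‖)) (d * (z.2 - s))) := by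
    by_contra h'
    exact h (max_eq_left (not_lt.1 h'))
  simp only [lt_min_iff] at h0
  exact ⟨by linarith [(mul_pos_iff_of_pos_left hc).1 h0.2.1],
    by linarith [(mul_pos_iff_of_pos_left hd).1 h0.2.2]⟩

theorem cutoff_eq_zero {n : ℕ} {r c s d : ℝ} (hc : 0 < c) (hd : 0 < d) {z : SpaceTime n}
    (h : r < ‖z.1‖) : cutoff r c s d z = 0 := by
  by_contra h'
  exact absurd (lt_of_cutoff_ne_zero hc hd h').1 (not_lt.2 h.le)

theorem lipschitzWith_cutoff {n : ℕ} (r s : ℝ) {c d : ℝ} (hc : 0 ≤ c) (hd : 0 ≤ d) {L : ℝ≥0}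
    (hcL : c ≤ L) (hdL : d ≤ L) : LipschitzWith L (cutoff (n := n) r c s d) := by
  have h1 : LipschitzWith L fun z : SpaceTime n => c * (r - ‖z.1‖) :=
    LipschitzWith.of_dist_le_mul fun z z' => by
      rw [Real.dist_eq, ← mul_sub, abs_mul, abs_of_nonneg hc, sub_sub_sub_cancel_left]
      refine mul_le_mul hcL ?_ (abs_nonneg _) L.2
      refine (abs_norm_sub_norm_le _ _).trans ?_
      rw [← dist_eq_norm, dist_comm]
      exact le_max_left _ _
  have h2 : LipschitzWith L fun z : SpaceTime n => d * (z.2 - s) :=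
    LipschitzWith.of_dist_le_mul fun z z' => by
      rw [Real.dist_eq, ← mul_sub, abs_mul, abs_of_nonneg hd, sub_sub_sub_cancel_right,
        ← Real.dist_eq]
      exact mul_le_mul hdL (le_max_right _ _) dist_nonneg L.2
  have := ((h1.min h2).const_min 1).const_max 0
  rwa [max_self] at this

theorem lineDeriv_mul_of_differentiableAt {E : Type*} [NormedAddCommGroup E] [NormedSpace ℝ E]
    {w ζ : E → ℝ} {z : E} (hw : DifferentiableAt ℝ w z) (hζ : DifferentiableAt ℝ ζ z) (v : E) :
    lineDeriv ℝ (fun y => w y * ζ y) z v =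
      lineDeriv ℝ w z v * ζ z + w z * lineDeriv ℝ ζ z v := by
  have h1 := hw.hasFDerivAt.mul hζ.hasFDerivAt
  rw [hw.lineDeriv_eq_fderiv, hζ.lineDeriv_eq_fderiv]
  refine (h1.hasLineDerivAt v).lineDeriv.trans ?_
  simp
  ring

/-- At a zero of `ζ` the cutoff is minimal, hence `Dζ = 0` there. This is why the error term lives
on `{ζ ≠ 0}`, which the iteration needs to shrink its domain. -/
theorem spaceGradSq_mul_le {n : ℕ} {w ζ : SpaceTime n → ℝ} {L : ℝ≥0} {z : SpaceTime n}
    (hw : DifferentiableAt ℝ w z) (hζ : DifferentiableAt ℝ ζ z) (hL : LipschitzWith L ζ)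
    (h0 : ∀ z, 0 ≤ ζ z) :
    spaceGradSq (fun y => w y * ζ y) z ≤ 2 * (spaceGradSq w z * ζ z ^ 2) +
      2 * L ^ 2 * {z | ζ z ≠ 0}.indicator (fun z => w z ^ 2) z := by
  have h1 : spaceGradSq (fun y => w y * ζ y) z ≤
      2 * (spaceGradSq w z * ζ z ^ 2) + 2 * (w z ^ 2 * spaceGradSq ζ z) := by
    simp only [spaceGradSq, spaceDeriv, lineDeriv_mul_of_differentiableAt hw hζ]
    simp only [Finset.sum_mul, Finset.mul_sum]
    rw [← Finset.sum_add_distrib]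
    refine Finset.sum_le_sum fun i _ => ?_
    nlinarith [sq_nonneg (lineDeriv ℝ w z (EuclideanSpace.single i 1, 0) * ζ z -
      w z * lineDeriv ℝ ζ z (EuclideanSpace.single i 1, 0))]
  refine h1.trans ?_
  by_cases hz : ζ z = 0
  · have hmin : IsLocalMin ζ z := Eventually.of_forall fun y => by rw [hz]; exact h0 y
    have : spaceGradSq ζ z = 0 := Finset.sum_eq_zero fun i _ => by
      rw [spaceDeriv, hζ.lineDeriv_eq_fderiv, hmin.fderiv_eq_zero]; simp
    rw [this, indicator_of_notMem (by simp [hz])]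
    simp
  · rw [indicator_of_mem (by simpa using hz)]
    have := mul_le_mul_of_nonneg_left (spaceGradSq_le hL hζ) (sq_nonneg (w z))
    linarith

/-- Constant in the energy estimate for the localized truncation. -/
noncomputable def energyConst (ν : ℝ) : ℝ≥0 :=
  Real.toNNReal (2 * ν⁻¹ * (2 + 4 * (ν⁻¹) ^ 3) + 2 + (2 + 4 * (ν⁻¹) ^ 3))

/-- Energy estimate for the localized truncation with vanishing initial values. -/
theorem UnitSolution.energy_localized {n : ℕ} {ν : ℝ}
    {a : SpaceTime n → Matrix (Fin n) (Fin n) ℝ}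
    {b : SpaceTime n → EuclideanSpace ℝ (Fin n)} {u : SpaceTime n → ℝ}
    (hu : UnitSolution ν a b u) {k : ℝ} (hk : 0 ≤ k) {ζ : SpaceTime n → ℝ} {L : ℝ≥0} (hL : 1 ≤ L)
    (hζ : LipschitzWith L ζ) (h0 : ∀ z, 0 ≤ ζ z) (h1 : ∀ z, ζ z ≤ 1) {ρ : ℝ} (hρ : ρ < 1)
    (hs : ∀ z : SpaceTime n, ρ < ‖z.1‖ → ζ z = 0) {t₁ : ℝ} (ht₁ : -1 < t₁)
    (hinit : ∀ x, ζ (x, t₁) = 0) :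
    (∀ t ∈ Ioo t₁ 0, ∫⁻ x in Metric.ball (0 : EuclideanSpace ℝ (Fin n)) 1,
      ENNReal.ofReal ((trunc k u (x, t) * ζ (x, t)) ^ 2) ≤ energyConst ν * L ^ 2 *
        ∫⁻ z in slab n t₁ 0 ∩ {z | ζ z ≠ 0}, ENNReal.ofReal (trunc k u z ^ 2) * weight b z) ∧
    ∫⁻ z in slab n t₁ 0, ENNReal.ofReal (spaceGradSq (fun z => trunc k u z * ζ z) z) ≤
      energyConst ν * L ^ 2 *
        ∫⁻ z in slab n t₁ 0 ∩ {z | ζ z ≠ 0}, ENNReal.ofReal (trunc k u z ^ 2) * weight b z := by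
  have hν := hu.pos
  set c₀ := 2 + 4 * (ν⁻¹) ^ 3 with hc₀
  have hc₀' : 0 ≤ c₀ := by positivity
  set I := ∫⁻ z in slab n t₁ 0 ∩ {z | ζ z ≠ 0}, ENNReal.ofReal (trunc k u z ^ 2) * weight b z
    with hI
  have hRHS : energyRHS ν b (trunc k u) ζ L t₁ 0 = ENNReal.ofReal (c₀ * L ^ 2) * I := by
    simp [energyRHS, hinit, hI, hc₀]
  have hEC : (energyConst ν : ℝ≥0∞) = ENNReal.ofReal (2 * ν⁻¹ * c₀ + 2 + c₀) := rfl
  have hLof : ((L : ℝ≥0∞)) ^ 2 = ENNReal.ofReal ((L : ℝ) ^ 2) := by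
    rw [ENNReal.ofReal_pow (NNReal.coe_nonneg L), ENNReal.ofReal_coe_nnreal]
  have hconst : ∀ c : ℝ, 0 ≤ c → c ≤ 2 * ν⁻¹ * c₀ + 2 + c₀ →
      ENNReal.ofReal (c * L ^ 2) * I ≤ energyConst ν * L ^ 2 * I := fun c h0 hc => by
    rw [hEC, hLof, ← ENNReal.ofReal_mul (by positivity)]
    gcongr
  have hc₁ : c₀ ≤ 2 * ν⁻¹ * c₀ + 2 + c₀ := by
    have : 0 ≤ 2 * ν⁻¹ * c₀ := by positivity
    linarith
  refine ⟨fun t ht => ?_, ?_⟩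
  · refine (hu.energy_slice hk hL hζ h0 h1 hρ hs ht₁ ht.1.le ht.2).trans ?_
    rw [hRHS]
    exact hconst c₀ hc₀' hc₁
  · obtain ⟨C, hC⟩ := hu.lipschitz
    have hw := lipschitz_trunc k hC
    have hgrad := hu.energy_grad hk hL hζ h0 h1 hρ hs ht₁
    rw [hRHS] at hgrad
    have hζm : MeasurableSet {z | ζ z ≠ 0} :=
      (measurableSet_eq_fun hζ.continuous.measurable measurable_const).compl
    set D := ∫⁻ z in slab n t₁ 0, ENNReal.ofReal (spaceGradSq (trunc k u) z * ζ z ^ 2) with hD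
    have hD' : D ≤ ENNReal.ofReal (ν⁻¹ * (c₀ * L ^ 2)) * I := by
      calc D = ENNReal.ofReal ν⁻¹ * (ENNReal.ofReal ν * D) := by
            rw [← mul_assoc, ← ENNReal.ofReal_mul (by positivity), inv_mul_cancel₀ hν.ne',
              ENNReal.ofReal_one, one_mul]
        _ ≤ ENNReal.ofReal ν⁻¹ * (ENNReal.ofReal (c₀ * L ^ 2) * I) := by gcongr
        _ = _ := by rw [← mul_assoc, ← ENNReal.ofReal_mul (by positivity)]
    calc ∫⁻ z in slab n t₁ 0, ENNReal.ofReal (spaceGradSq (fun z => trunc k u z * ζ z) z)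
        ≤ ∫⁻ z in slab n t₁ 0, (ENNReal.ofReal 2 *
            ENNReal.ofReal (spaceGradSq (trunc k u) z * ζ z ^ 2) +
            ENNReal.ofReal (2 * L ^ 2) *
              {z | ζ z ≠ 0}.indicator (fun z => ENNReal.ofReal (trunc k u z ^ 2) * weight b z) z) := by
          refine lintegral_mono_ae ?_
          filter_upwards [ae_restrict_of_ae (hw.ae_differentiableAt (μ := volume)),
            ae_restrict_of_ae (hζ.ae_differentiableAt (μ := volume))] with z hdw hdζ
          refine (ENNReal.ofReal_le_ofReal (spaceGradSq_mul_le hdw hdζ hζ h0)).trans ?_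
          rw [ENNReal.ofReal_add (mul_nonneg zero_le_two
              (mul_nonneg (spaceGradSq_nonneg _ _) (sq_nonneg _)))
            (mul_nonneg (by positivity) (indicator_nonneg (fun _ _ => sq_nonneg _) _)),
            ENNReal.ofReal_mul zero_le_two,
            ENNReal.ofReal_mul (p := 2 * (L : ℝ) ^ 2) (by positivity)]
          gcongr
          by_cases hz : z ∈ {z | ζ z ≠ 0}
          · rw [indicator_of_mem hz, indicator_of_mem hz]
            -- The weight is at least one, so the term `w² |Dζ|²` is absorbed in the same weighted
            -- integral as the drift.
            exact le_mul_of_one_le_right zero_le le_self_add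
          · rw [indicator_of_notMem hz, indicator_of_notMem hz, ENNReal.ofReal_zero]
      _ = ENNReal.ofReal 2 * D + ENNReal.ofReal (2 * L ^ 2) * I := by
          rw [lintegral_add_left, lintegral_const_mul' _ _ ENNReal.ofReal_ne_top,
            lintegral_const_mul' _ _ ENNReal.ofReal_ne_top, lintegral_indicator hζm,
            Measure.restrict_restrict hζm, inter_comm]
          exact (((measurable_spaceGradSq hw.continuous).mul
            (hζ.continuous.measurable.pow_const 2)).ennreal_ofReal).const_mul _
      _ ≤ ENNReal.ofReal 2 * (ENNReal.ofReal (ν⁻¹ * (c₀ * L ^ 2)) * I) +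
            ENNReal.ofReal (2 * L ^ 2) * I := by gcongr
      _ = ENNReal.ofReal ((2 * ν⁻¹ * c₀ + 2) * L ^ 2) * I := by
          rw [← mul_assoc, ← ENNReal.ofReal_mul zero_le_two, ← add_mul,
            ← ENNReal.ofReal_add (by positivity) (by positivity)]
          congr 2; ring
      _ ≤ _ := hconst _ (by positivity) (by linarith)

/-! ### De Giorgi's iteration: small measure implies a pointwise bound. -/

theorem nnreal_pow_rpow_comm (x : ℝ≥0) (i : ℕ) (δ : ℝ) : (x ^ i) ^ δ = (x ^ δ) ^ i := by
  rw [← NNReal.rpow_natCast, ← NNReal.rpow_natCast, ← NNReal.rpow_mul, ← NNReal.rpow_mul, mul_comm]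

/-- Fast geometric convergence. -/
theorem exists_geometric_supersolution {δ : ℝ} (hδ : 0 < δ) {D Λ : ℝ≥0} (hD : 1 < D)
    (hΛ : 0 < Λ) :
    ∃ M r : ℝ≥0, 0 < M ∧ r < 1 ∧ ∀ i : ℕ, Λ * D ^ i * (M * r ^ i) ^ (1 + δ) ≤ M * r ^ (i + 1) := by
  have hD0 : 0 < D := zero_lt_one.trans hD
  -- Chosen so that `r^δ` cancels the growth `D`, while `M^δ = r/Λ` fixes the amplitude; the
  -- recursion then holds with equality.
  set r : ℝ≥0 := D ^ (-1 / δ) with hr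
  have hr0 : 0 < r := NNReal.rpow_pos hD0
  have hrδ : r ^ δ = D⁻¹ := by
    rw [hr, ← NNReal.rpow_mul, div_mul_cancel₀ _ hδ.ne', NNReal.rpow_neg_one]
  set M : ℝ≥0 := (r / Λ) ^ (1 / δ) with hM
  have hM0 : 0 < M := NNReal.rpow_pos (div_pos hr0 hΛ)
  have hMδ : M ^ δ = r / Λ := by
    rw [hM, ← NNReal.rpow_mul, one_div_mul_cancel hδ.ne', NNReal.rpow_one]
  refine ⟨M, r, hM0, ?_, fun i => le_of_eq ?_⟩
  · exact NNReal.rpow_lt_one_of_one_lt_of_neg hD (div_neg_of_neg_of_pos (by norm_num) hδ)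
  · have h1 : (M * r ^ i) ^ (1 + δ) = M * r ^ i * (M ^ δ * (r ^ δ) ^ i) := by
      rw [NNReal.rpow_add (mul_pos hM0 (pow_pos hr0 i)).ne', NNReal.rpow_one, NNReal.mul_rpow,
        nnreal_pow_rpow_comm]
    rw [h1, hMδ, hrδ, inv_pow, pow_succ]
    field_simp

/-- Levels, radii, times and cutoffs of the De Giorgi iteration. -/
noncomputable def dgLevel (i : ℕ) : ℝ := 1 / 2 + (1 / 2) ^ (i + 1)

/-- For `i = 0` the level, radius and time are `1`, `1/2` and `-θ`; in the limit they are `1/2`,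
`1/4` and `-θ/2`. -/
noncomputable def dgRadius (i : ℕ) : ℝ := 1 / 4 + (1 / 2) ^ (i + 2)

noncomputable def dgTime (θ : ℝ) (i : ℕ) : ℝ := -θ / 2 - θ * (1 / 2) ^ (i + 1)

/-- The slopes are reciprocals of the gaps `2^{-(i+3)}` between consecutive radii and `θ 2^{-(i+2)}`
between consecutive times, so the cutoff of index `i` equals one on the cylinder of index `i + 1`.
-/
noncomputable def dgCutoff {n : ℕ} (θ : ℝ) (i : ℕ) (z : SpaceTime n) : ℝ :=
  cutoff (dgRadius i) (2 ^ (i + 3)) (dgTime θ i) (2 ^ (i + 2) / θ) z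

/-- Dominates both slopes, since `θ ≤ 1`. -/
noncomputable def dgLip (θ : ℝ) (i : ℕ) : ℝ≥0 := 2 ^ (i + 3) * Real.toNNReal θ⁻¹

theorem two_pow_mul_half_pow (i : ℕ) : (2 : ℝ) ^ i * (1 / 2) ^ i = 1 := by
  rw [← mul_pow]; norm_num

theorem dgLevel_sub (i : ℕ) : dgLevel i - dgLevel (i + 1) = (1 / 2) ^ (i + 2) := by
  simp only [dgLevel]; ring

theorem dgLevel_pos (i : ℕ) : 0 < dgLevel i := by unfold dgLevel; positivity

theorem dgLevel_succ_le (i : ℕ) : dgLevel (i + 1) ≤ dgLevel i := by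
  have := dgLevel_sub i
  have : (0 : ℝ) < (1 / 2) ^ (i + 2) := by positivity
  linarith

theorem dgRadius_le (i : ℕ) : dgRadius i ≤ 1 / 2 := by
  have : ((1 : ℝ) / 2) ^ (i + 2) ≤ (1 / 2) ^ 2 :=
    pow_le_pow_of_le_one (by norm_num) (by norm_num) (by omega)
  unfold dgRadius; linarith

theorem lt_dgRadius (i : ℕ) : 1 / 4 < dgRadius i := by
  have : (0 : ℝ) < (1 / 2) ^ (i + 2) := by positivity
  unfold dgRadius; linarith

theorem dgTime_lt {θ : ℝ} (hθ : 0 < θ) (i : ℕ) : dgTime θ i < -θ / 2 := by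
  have : 0 < θ * (1 / 2) ^ (i + 1) := by positivity
  unfold dgTime; linarith

theorem le_dgTime {θ : ℝ} (hθ : 0 < θ) (i : ℕ) : -θ ≤ dgTime θ i := by
  have : ((1 : ℝ) / 2) ^ (i + 1) ≤ (1 / 2) ^ 1 :=
    pow_le_pow_of_le_one (by norm_num) (by norm_num) (by omega)
  have := mul_le_mul_of_nonneg_left this hθ.le
  unfold dgTime; linarith

theorem dgCutoff_eq_one {n : ℕ} {θ : ℝ} (hθ : 0 < θ) (i : ℕ) {z : SpaceTime n}
    (h1 : ‖z.1‖ ≤ dgRadius (i + 1)) (h2 : dgTime θ (i + 1) ≤ z.2) : dgCutoff θ i z = 1 := by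
  apply cutoff_eq_one
  · calc (1 : ℝ) = 2 ^ (i + 3) * (1 / 2) ^ (i + 3) := (two_pow_mul_half_pow _).symm
      _ = 2 ^ (i + 3) * (dgRadius i - dgRadius (i + 1)) := by
        congr 1; unfold dgRadius; ring
      _ ≤ _ := by gcongr
  · calc (1 : ℝ) = 2 ^ (i + 2) / θ * (θ * (1 / 2) ^ (i + 2)) := by
          rw [← mul_assoc, div_mul_cancel₀ _ hθ.ne', two_pow_mul_half_pow]
      _ = 2 ^ (i + 2) / θ * (dgTime θ (i + 1) - dgTime θ i) := by
        congr 1; unfold dgTime; ring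
      _ ≤ _ := by gcongr

theorem lt_of_dgCutoff_ne_zero {n : ℕ} {θ : ℝ} (hθ : 0 < θ) {i : ℕ} {z : SpaceTime n}
    (h : dgCutoff θ i z ≠ 0) : ‖z.1‖ < dgRadius i ∧ dgTime θ i < z.2 :=
  lt_of_cutoff_ne_zero (by positivity) (by positivity) h

theorem lipschitzWith_dgCutoff {n : ℕ} {θ : ℝ} (hθ : 0 < θ) (hθ1 : θ ≤ 1) (i : ℕ) :
    LipschitzWith (dgLip θ i) (dgCutoff (n := n) θ i) := by
  have h1 : 1 ≤ θ⁻¹ := (one_le_inv₀ hθ).2 hθ1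
  have e : (dgLip θ i : ℝ) = 2 ^ (i + 3) * θ⁻¹ := by
    simp only [dgLip, NNReal.coe_mul, NNReal.coe_pow, NNReal.coe_ofNat,
      Real.coe_toNNReal _ (zero_le_one.trans h1)]
  refine lipschitzWith_cutoff _ _ (by positivity) (by positivity) ?_ ?_
  · rw [e]; exact le_mul_of_one_le_right (by positivity) h1
  · rw [e, div_eq_mul_inv]
    gcongr
    · norm_num
    · omega

theorem one_le_dgLip {θ : ℝ} (hθ : 0 < θ) (hθ1 : θ ≤ 1) (i : ℕ) : 1 ≤ dgLip θ i := by
  have h1 : 1 ≤ θ⁻¹ := (one_le_inv₀ hθ).2 hθ1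
  have h2 : (1 : ℝ≥0) ≤ Real.toNNReal θ⁻¹ := by rwa [Real.one_le_toNNReal]
  calc (1 : ℝ≥0) = 1 * 1 := (one_mul 1).symm
    _ ≤ _ := mul_le_mul' (one_le_pow₀ (by norm_num)) h2

/-- Both energies of the `i`-th localized truncation are at most `M`. -/
def dgBound {n : ℕ} (θ : ℝ) (u : SpaceTime n → ℝ) (i : ℕ) (M : ℝ≥0∞) : Prop :=
  (∀ t ∈ Ioo (-θ) 0, ∫⁻ x in Metric.ball (0 : EuclideanSpace ℝ (Fin n)) 1,
    ENNReal.ofReal ((trunc (dgLevel i) u (x, t) * dgCutoff θ i (x, t)) ^ 2) ≤ M) ∧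
  ∫⁻ z in slab n (-θ) 0,
    ENNReal.ofReal (spaceGradSq (fun z => trunc (dgLevel i) u z * dgCutoff θ i z) z) ≤ M

theorem dgBound.mono {n : ℕ} {θ : ℝ} {u : SpaceTime n → ℝ} {i : ℕ} {M M' : ℝ≥0∞}
    (h : dgBound θ u i M) (hM : M ≤ M') : dgBound θ u i M' :=
  ⟨fun t ht => (h.1 t ht).trans hM, h.2.trans hM⟩

theorem UnitSolution.dgBound {n : ℕ} {ν : ℝ}
    {a : SpaceTime n → Matrix (Fin n) (Fin n) ℝ}
    {b : SpaceTime n → EuclideanSpace ℝ (Fin n)} {u : SpaceTime n → ℝ}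
    (hu : UnitSolution ν a b u) {θ : ℝ} (hθ : 0 < θ) (hθ1 : θ < 1) (i : ℕ) :
    ParabolicHolder.dgBound θ u i (energyConst ν * dgLip θ i ^ 2 *
      ∫⁻ z in slab n (-θ) 0 ∩ {z | dgCutoff θ i z ≠ 0},
        ENNReal.ofReal (trunc (dgLevel i) u z ^ 2) * weight b z) := by
  refine hu.energy_localized (dgLevel_pos i).le (one_le_dgLip hθ hθ1.le i)
    (lipschitzWith_dgCutoff hθ hθ1.le i) (fun z => cutoff_nonneg _ _ _ _ z)
    (fun z => cutoff_le_one _ _ _ _ z)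
    (ρ := 1 / 2) (by norm_num) (fun z hz => ?_) (by linarith) (fun x => ?_)
  · by_contra h
    have := (lt_of_dgCutoff_ne_zero hθ h).1
    linarith [dgRadius_le i]
  -- All starting times are at least `-θ`, so the cutoff vanishes on the initial slice and the
  -- initial energy disappears.
  · by_contra h
    have := (lt_of_dgCutoff_ne_zero hθ h).2
    have h2 := le_dgTime hθ i
    simp only at this
    linarith

theorem trunc_mono {X : Type*} {k k' : ℝ} (h : k ≤ k') (u : X → ℝ) (z : X) :
    trunc k u z ≤ trunc k' u z := max_le_max (by linarith) le_rfl

/-- Chebyshev's trick: where the lower truncation is positive, the upper one is at least the level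
gap `2^{-(i+2)}`, so a factor `(2^{i+2} w)^{2δ} ≥ 1` may be inserted. This creates the power `2 +
2δ` that interpolation can handle. -/
theorem ofReal_trunc_sq_le {n : ℕ} {δ : ℝ} (hδ : 0 < δ) (u : SpaceTime n → ℝ) (i : ℕ)
    (z : SpaceTime n) :
    ENNReal.ofReal (trunc (dgLevel (i + 1)) u z ^ 2) ≤
      (2 ^ (i + 2)) ^ (2 * δ) * ‖trunc (dgLevel i) u z‖ₑ ^ (2 + 2 * δ) := by
  set w := trunc (dgLevel i) u z with hw
  set w' := trunc (dgLevel (i + 1)) u z with hw'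
  have h0 : 0 ≤ w' := trunc_nonneg _ _ _
  have hle : w' ≤ w := trunc_mono (dgLevel_succ_le i) u z
  rcases h0.eq_or_lt with h | h
  · rw [← h]; simp
  · have hlt : 0 < dgLevel (i + 1) - u z := by
      by_contra hcon
      exact h.ne' (max_eq_right (not_lt.1 hcon))
    have hw2 : (1 / 2) ^ (i + 2) ≤ w := by
      have := dgLevel_sub i
      have h3 : dgLevel i - u z ≤ w := le_max_left _ _
      linarith
    have hone : (1 : ℝ≥0∞) ≤ (2 ^ (i + 2)) * ENNReal.ofReal w := by
      have e : (2 : ℝ≥0∞) ^ (i + 2) = ENNReal.ofReal (2 ^ (i + 2)) := by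
        rw [ENNReal.ofReal_pow zero_le_two]; norm_num
      rw [e, ← ENNReal.ofReal_mul (by positivity), ENNReal.one_le_ofReal, ← two_pow_mul_half_pow (i + 2)]
      gcongr
    have hw0 : 0 ≤ w := h0.trans hle
    rw [Real.enorm_of_nonneg hw0]
    calc ENNReal.ofReal (w' ^ 2) ≤ ENNReal.ofReal (w ^ 2) := by gcongr
      _ = 1 * ENNReal.ofReal w ^ (2 : ℝ) := by
          rw [ENNReal.ofReal_pow hw0, one_mul]; norm_cast
      _ ≤ ((2 ^ (i + 2)) * ENNReal.ofReal w) ^ (2 * δ) * ENNReal.ofReal w ^ (2 : ℝ) := by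
          gcongr
          exact ENNReal.one_le_rpow hone (by positivity)
      _ = _ := by
          rw [ENNReal.mul_rpow_of_nonneg _ _ (by positivity), mul_assoc,
            ← ENNReal.rpow_add_of_nonneg _ _ (by positivity) (by positivity), add_comm (2 * δ)]

/-- De Giorgi's first lemma for solutions on the unit cylinder. -/
theorem exists_deGiorgi {n : ℕ} (hn : 2 ≤ n) {q l : ℝ} (hq : 1 < q) (hl : 1 < l)
    (hql : (n : ℝ) / (2 * q) + 1 / l < 1) (ν : ℝ) (K : ℝ≥0) {θ : ℝ} (hθ : 0 < θ) (hθ1 : θ < 1) :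
    ∃ κ : ℝ≥0, 0 < κ ∧ ∀ (a : SpaceTime n → Matrix (Fin n) (Fin n) ℝ)
      (b : SpaceTime n → EuclideanSpace ℝ (Fin n)) (u : SpaceTime n → ℝ),
      UnitSolution ν a b u → Measurable b → weightNorm q l b ≤ K →
      volume {z : SpaceTime n | ‖z.1‖ < 1 / 2 ∧ z.2 ∈ Ioo (-θ) 0 ∧ u z < 1} ≤ κ →
      ∀ z : SpaceTime n, ‖z.1‖ < 1 / 4 → z.2 ∈ Ioo (-θ / 2) 0 → 1 / 2 ≤ u z := by
  obtain ⟨δ, A, hδ, hint⟩ := exists_interpolation hn hq hl hql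
  obtain ⟨s, A', hs, hsmall⟩ := exists_lintegral_weight_le n hq hl
  have hl0 : 0 ≤ 1 / l := by positivity
  set T : ℝ≥0 := Real.toNNReal θ⁻¹ with hT
  -- Growth per step: `4` from the squared Lipschitz constant of the cutoff, `4^δ` from the
  -- Chebyshev factor.
  set D : ℝ≥0 := 4 * 4 ^ δ with hDdef
  have h4 : (1 : ℝ≥0) ≤ 4 ^ δ := NNReal.one_le_rpow (by norm_num) hδ.le
  have hD1 : 1 < D := by
    calc (1 : ℝ≥0) < 4 * 1 := by norm_num
      _ ≤ D := by rw [hDdef]; gcongr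
  set Λ : ℝ≥0 := energyConst ν * (2 ^ 8 * T ^ 2) * (4 ^ δ * 4 ^ δ) * (A * K ^ (1 / l)) + 1 with hΛ
  obtain ⟨M, r, hM, hr, hgeo⟩ := exists_geometric_supersolution hδ hD1 (Λ := Λ) (by positivity)
  set c : ℝ≥0 := energyConst ν * dgLip θ 0 ^ 2 * (A' * K ^ (1 / l)) + 1 with hc
  have hc0 : 0 < c := by positivity
  -- The threshold is what the base case asks for: the initial energy is at most `c |S|^s`, which
  -- must not exceed `M`. The summand one in `c` and in `Λ` only ensures positivity.
  refine ⟨(M / c) ^ (1 / s), NNReal.rpow_pos (div_pos hM hc0), fun a b u hu hb hbK hκ z hz1 hz2 => ?_⟩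
  obtain ⟨C, hC⟩ := hu.lipschitz
  have huc := hC.continuous
  have hKl : weightNorm q l b ^ (1 / l) ≤ ((K ^ (1 / l) : ℝ≥0) : ℝ≥0∞) := by
    rw [ENNReal.coe_rpow_of_nonneg _ hl0]; gcongr
  have hζm : ∀ i, MeasurableSet {z : SpaceTime n | dgCutoff θ i z ≠ 0} := fun i =>
    (measurableSet_eq_fun (lipschitzWith_dgCutoff hθ hθ1.le i).continuous.measurable
      measurable_const).compl
  have hslab : slab n (-θ) 0 ⊆ slab n (-1) 0 :=
    prod_mono subset_rfl (Ioo_subset_Ioo_left (by linarith))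
  have hbase : dgBound θ u 0 M := by
    refine (hu.dgBound hθ hθ1 0).mono ?_
    set S := {z : SpaceTime n | ‖z.1‖ < 1 / 2 ∧ z.2 ∈ Ioo (-θ) 0 ∧ u z < 1} with hS
    have hSo : IsOpen S := by
      refine (isOpen_lt continuous_fst.norm continuous_const).inter
        ((isOpen_Ioo.preimage continuous_snd).inter (isOpen_lt huc continuous_const))
    have hSs : S ⊆ slab n (-1) 0 := fun z hz =>
      ⟨by simpa using hz.1.trans (by norm_num), ⟨by linarith [hz.2.1.1], hz.2.1.2⟩⟩
    have h1 : ∫⁻ z in slab n (-θ) 0 ∩ {z | dgCutoff θ 0 z ≠ 0},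
        ENNReal.ofReal (trunc (dgLevel 0) u z ^ 2) * weight b z ≤ ∫⁻ z in S, weight b z := by
      rw [← lintegral_indicator ((measurableSet_slab n _ _).inter (hζm 0)),
        ← lintegral_indicator hSo.measurableSet]
      refine lintegral_mono fun z => ?_
      by_cases hz : z ∈ slab n (-θ) 0 ∩ {z | dgCutoff θ 0 z ≠ 0}
      · rw [indicator_of_mem hz]
        have hlev : dgLevel 0 = 1 := by norm_num [dgLevel]
        rw [hlev]
        by_cases hu1 : u z < 1
        · have hzS : z ∈ S :=
            ⟨(lt_of_dgCutoff_ne_zero hθ hz.2).1.trans_le (dgRadius_le 0), hz.1.2, hu1⟩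
          rw [indicator_of_mem hzS]
          have : ENNReal.ofReal (trunc 1 u z ^ 2) ≤ 1 := by
            rw [ENNReal.ofReal_le_one]
            exact pow_le_one₀ (trunc_nonneg _ _ _) (trunc_le zero_le_one hu.nonneg z)
          calc _ ≤ 1 * weight b z := by gcongr
            _ = _ := one_mul _
        · have : trunc 1 u z = 0 := max_eq_right (by linarith)
          simp [this]
      · rw [indicator_of_notMem hz]; exact zero_le
    have h2 := hsmall b hb S hSo.measurableSet hSs
    have h3 : volume S ^ s ≤ ((M / c : ℝ≥0) : ℝ≥0∞) := by
      calc volume S ^ s ≤ (((M / c) ^ (1 / s) : ℝ≥0) : ℝ≥0∞) ^ s := by gcongr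
        _ = _ := by
          rw [← ENNReal.coe_rpow_of_nonneg _ hs.le, ← NNReal.rpow_mul, one_div_mul_cancel hs.ne',
            NNReal.rpow_one]
    calc _ ≤ (energyConst ν : ℝ≥0∞) * dgLip θ 0 ^ 2 *
          (A' * ((K ^ (1 / l) : ℝ≥0) : ℝ≥0∞) * ((M / c : ℝ≥0) : ℝ≥0∞)) := by
          gcongr
          exact h1.trans (h2.trans (by gcongr))
      _ = ((energyConst ν * dgLip θ 0 ^ 2 * (A' * K ^ (1 / l)) * (M / c) : ℝ≥0) : ℝ≥0∞) := by
          push_cast; ring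
      _ ≤ ((c * (M / c) : ℝ≥0) : ℝ≥0∞) := by
          gcongr
          exact le_self_add
      _ = M := by rw [mul_div_cancel₀ _ hc0.ne']
  have hstep : ∀ i, dgBound θ u i ((M * r ^ i : ℝ≥0) : ℝ≥0∞) →
      dgBound θ u (i + 1) ((M * r ^ (i + 1) : ℝ≥0) : ℝ≥0∞) := by
    intro i hi
    refine (hu.dgBound hθ hθ1 (i + 1)).mono ?_
    have hbl := (bddLip_trunc (dgLevel_pos i).le hu.lipschitz hu.nonneg).mul
      (⟨⟨_, lipschitzWith_dgCutoff (n := n) hθ hθ1.le i⟩, 1, fun z => by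
        rw [dgCutoff, abs_of_nonneg (cutoff_nonneg _ _ _ _ z)]; exact cutoff_le_one _ _ _ _ z⟩ :
        BddLip (dgCutoff (n := n) θ i))
    obtain ⟨CW, hCW⟩ := hbl.1
    have hI := hint b hb _ CW hCW (1 / 2) (by norm_num) (fun z hz => by
      have : dgCutoff θ i z = 0 := by
        by_contra h
        have := (lt_of_dgCutoff_ne_zero hθ h).1
        linarith [dgRadius_le i]
      simp [this]) (-θ) (by linarith) _ hi.1 hi.2
    have h1 : ∫⁻ z in slab n (-θ) 0 ∩ {z | dgCutoff θ (i + 1) z ≠ 0},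
        ENNReal.ofReal (trunc (dgLevel (i + 1)) u z ^ 2) * weight b z ≤
        (2 ^ (i + 2)) ^ (2 * δ) * ∫⁻ z in slab n (-θ) 0,
          weight b z * ‖trunc (dgLevel i) u z * dgCutoff θ i z‖ₑ ^ (2 + 2 * δ) := by
      rw [← lintegral_const_mul' _ _ (by finiteness),
        ← lintegral_indicator ((measurableSet_slab n _ _).inter (hζm (i + 1))),
        ← lintegral_indicator (measurableSet_slab n _ _)]
      refine lintegral_mono fun z => ?_
      by_cases hz : z ∈ slab n (-θ) 0 ∩ {z | dgCutoff θ (i + 1) z ≠ 0}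
      · rw [indicator_of_mem hz, indicator_of_mem hz.1]
        have h2 := lt_of_dgCutoff_ne_zero hθ hz.2
        rw [dgCutoff_eq_one hθ i h2.1.le h2.2.le, mul_one]
        calc _ ≤ ((2 ^ (i + 2)) ^ (2 * δ) * ‖trunc (dgLevel i) u z‖ₑ ^ (2 + 2 * δ)) * weight b z := by
              gcongr; exact ofReal_trunc_sq_le hδ u i z
          _ = _ := by ring
      · rw [indicator_of_notMem hz]; exact zero_le
    have hpow : ((2 : ℝ≥0∞) ^ (i + 2)) ^ (2 * δ) = ((4 ^ δ * 4 ^ δ * (4 ^ δ) ^ i : ℝ≥0) : ℝ≥0∞) := by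
      have e : ((2 : ℝ≥0) ^ (i + 2)) ^ (2 * δ) = 4 ^ δ * 4 ^ δ * (4 ^ δ) ^ i := by
        have e2 : (2 : ℝ≥0) ^ (2 * δ) = 4 ^ δ := by rw [NNReal.rpow_mul]; norm_num
        rw [nnreal_pow_rpow_comm, e2]; ring
      rw [← e, ENNReal.coe_rpow_of_nonneg _ (by positivity)]
      norm_cast
    calc _ ≤ (energyConst ν : ℝ≥0∞) * dgLip θ (i + 1) ^ 2 *
          (((4 ^ δ * 4 ^ δ * (4 ^ δ) ^ i : ℝ≥0) : ℝ≥0∞) * (A * ((K ^ (1 / l) : ℝ≥0) : ℝ≥0∞) *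
            ((M * r ^ i : ℝ≥0) : ℝ≥0∞) ^ (1 + δ))) := by
          gcongr
          refine h1.trans ?_
          rw [hpow]
          gcongr
          refine hI.trans ?_
          gcongr
      _ = ((energyConst ν * (2 ^ 8 * T ^ 2) * (4 ^ δ * 4 ^ δ) * (A * K ^ (1 / l)) *
            D ^ i * (M * r ^ i) ^ (1 + δ) : ℝ≥0) : ℝ≥0∞) := by
          rw [← ENNReal.coe_rpow_of_nonneg _ (by positivity)]
          norm_cast
          rw [hDdef, mul_pow, dgLip, ← hT]
          have : ((2 : ℝ≥0) ^ (i + 1 + 3) * T) ^ 2 = 2 ^ 8 * T ^ 2 * 4 ^ i := by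
            have e4 : (4 : ℝ≥0) ^ i = 2 ^ (2 * i) := by rw [pow_mul]; norm_num
            rw [e4]; ring
          rw [this]; ring
      _ ≤ ((Λ * D ^ i * (M * r ^ i) ^ (1 + δ) : ℝ≥0) : ℝ≥0∞) := by
          gcongr
          exact le_self_add
      _ ≤ _ := by exact_mod_cast hgeo i
  have hall : ∀ i, dgBound θ u i ((M * r ^ i : ℝ≥0) : ℝ≥0∞) := fun i => by
    induction i with
    | zero => simpa using hbase
    | succ i ih => exact hstep i ih
  have ht : z.2 ∈ Ioo (-θ) 0 := ⟨by linarith [hz2.1], hz2.2⟩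
  have hle : ∀ i, ∫⁻ x in Metric.ball (0 : EuclideanSpace ℝ (Fin n)) (1 / 4),
      ENNReal.ofReal (trunc (1 / 2) u (x, z.2) ^ 2) ≤ ((M * r ^ i : ℝ≥0) : ℝ≥0∞) := fun i => by
    refine le_trans ?_ ((hall i).1 z.2 ht)
    refine (setLIntegral_mono' Metric.isOpen_ball.measurableSet fun x hx => ?_).trans
      (lintegral_mono_set (Metric.ball_subset_ball (by norm_num)))
    have hx' : ‖x‖ < 1 / 4 := by simpa using hx
    have : dgCutoff θ i (x, z.2) = 1 := dgCutoff_eq_one hθ i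
      (hx'.le.trans (lt_dgRadius _).le) ((dgTime_lt hθ _).trans hz2.1).le
    rw [this, mul_one]
    refine ENNReal.ofReal_le_ofReal (pow_le_pow_left₀ (trunc_nonneg _ _ _) (trunc_mono ?_ _ _) 2)
    have : (0 : ℝ) < (1 / 2) ^ (i + 1) := by positivity
    unfold dgLevel; linarith
  have hlim : Tendsto (fun i => ((M * r ^ i : ℝ≥0) : ℝ≥0∞)) atTop (𝓝 0) := by
    have : Tendsto (fun i => M * r ^ i) atTop (𝓝 (M * 0)) :=
      (tendsto_pow_atTop_nhds_zero_of_lt_one (zero_le) hr).const_mul M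
    rw [mul_zero] at this
    have := ENNReal.tendsto_coe.2 this
    rwa [ENNReal.coe_zero] at this
  -- The energies tend to zero while every cutoff is one on the limiting cylinder. The slice bounds
  -- hold for each time, so this is an identity at the given `z.2`, and continuity of `u` removes
  -- the exceptional null set in `x`.
  have hzero : ∫⁻ x in Metric.ball (0 : EuclideanSpace ℝ (Fin n)) (1 / 4),
      ENNReal.ofReal (trunc (1 / 2) u (x, z.2) ^ 2) = 0 :=
    le_antisymm (ge_of_tendsto' hlim hle) zero_le
  by_contra hcon
  rw [not_le] at hcon
  have hcs : Continuous fun x : EuclideanSpace ℝ (Fin n) => u (x, z.2) := huc.comp (by fun_prop)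
  have hcw : Continuous fun x : EuclideanSpace ℝ (Fin n) => trunc (1 / 2) u (x, z.2) :=
    (lipschitz_trunc (1 / 2) hC).continuous.comp (by fun_prop)
  set O := Metric.ball (0 : EuclideanSpace ℝ (Fin n)) (1 / 4) ∩ {x | u (x, z.2) < 1 / 2} with hO
  have hOo : IsOpen O := Metric.isOpen_ball.inter (isOpen_lt hcs continuous_const)
  rw [lintegral_eq_zero_iff (hcw.measurable.pow_const 2).ennreal_ofReal,
    Filter.EventuallyEq, ae_restrict_iff' Metric.isOpen_ball.measurableSet] at hzero
  have hO0 : volume O = 0 := by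
    rw [measure_eq_zero_iff_ae_notMem]
    filter_upwards [hzero] with x hx hxO
    have h1 := hx hxO.1
    have h2 : 0 < trunc (1 / 2) u (x, z.2) := lt_max_of_lt_left (by linarith [hxO.2.out])
    have h3 : 0 < trunc (1 / 2) u (x, z.2) ^ 2 := by positivity
    rw [Pi.zero_apply, ENNReal.ofReal_eq_zero] at h1
    linarith
  rw [hOo.measure_eq_zero_iff (μ := volume)] at hO0
  have : z.1 ∈ O := ⟨by simpa using hz1, hcon⟩
  rw [hO0] at this
  exact this

/-! ### Propagation of positivity in measure. -/

/-- Volume of the ball of radius one half. -/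
noncomputable def halfBall (n : ℕ) : ℝ≥0∞ := volume (Metric.ball (0 : EuclideanSpace ℝ (Fin n)) (1 / 2))

theorem halfBall_ne_top (n : ℕ) : halfBall n ≠ ⊤ := Metric.isBounded_ball.measure_lt_top.ne

theorem halfBall_pos (n : ℕ) : 0 < halfBall n := Metric.measure_ball_pos _ _ (by norm_num)

theorem volume_slab_eq (n : ℕ) (t₁ t₂ : ℝ) : volume (slab n t₁ t₂) =
    volume (Metric.ball (0 : EuclideanSpace ℝ (Fin n)) 1) * ENNReal.ofReal (t₂ - t₁) := by
  rw [slab, Measure.volume_eq_prod, Measure.prod_prod, Real.volume_Ioo]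

/-- Most of the ball of radius `1/2` lies at distance at least `1/(16n)` from its boundary. -/
theorem volume_shell_le {n : ℕ} (hn : 0 < n) :
    halfBall n ≤ volume (Metric.ball (0 : EuclideanSpace ℝ (Fin n)) (1 / 2 - 1 / (16 * n))) +
      ENNReal.ofReal (1 / 8) * halfBall n := by
  have hn1 : (1 : ℝ) ≤ n := by exact_mod_cast hn
  have h16 : 1 / (16 * (n : ℝ)) ≤ 1 / 16 := one_div_le_one_div_of_le (by norm_num) (by linarith)
  -- Bernoulli's inequality for `(1 - 1/(8n))ⁿ ≥ 7/8`.
  have hpow : (1 / 2 : ℝ) ^ n * (7 / 8) ≤ (1 / 2 - 1 / (16 * n)) ^ n := by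
    have hb := one_add_mul_le_pow (a := -(1 / (8 * (n : ℝ)))) (by
      have : 1 / (8 * (n : ℝ)) ≤ 1 / 8 := one_div_le_one_div_of_le (by norm_num) (by linarith)
      linarith) n
    have e : (1 / 2 - 1 / (16 * n) : ℝ) = 1 / 2 * (1 + -(1 / (8 * (n : ℝ)))) := by
      field_simp; ring
    rw [e, mul_pow]
    refine mul_le_mul_of_nonneg_left (le_trans (le_of_eq ?_) hb) (by positivity)
    field_simp; ring
  have hv : ∀ r : ℝ, 0 ≤ r → volume (Metric.ball (0 : EuclideanSpace ℝ (Fin n)) r) =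
      ENNReal.ofReal (r ^ n) * volume (Metric.ball (0 : EuclideanSpace ℝ (Fin n)) 1) := fun r hr => by
    have : Nonempty (Fin n) := ⟨⟨0, hn⟩⟩
    rw [Measure.addHaar_ball _ _ hr, finrank_euclideanSpace_fin]
  rw [halfBall, hv _ (by norm_num), hv (1 / 2 - 1 / (16 * n)) (by linarith), ← mul_assoc,
    ← ENNReal.ofReal_mul (by norm_num), ← add_mul,
    ← ENNReal.ofReal_add (pow_nonneg (by linarith) _) (by positivity)]
  gcongr
  linarith

/-- Propagation of positivity in measure forward in time. -/
theorem exists_propagation {n : ℕ} (hn : 2 ≤ n) {q l : ℝ} (hq : 1 < q) (hl : 1 < l) (ν : ℝ)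
    (K : ℝ≥0) :
    ∃ θ : ℝ, 0 < θ ∧ θ < 1 ∧ ∀ (a : SpaceTime n → Matrix (Fin n) (Fin n) ℝ)
      (b : SpaceTime n → EuclideanSpace ℝ (Fin n)) (u : SpaceTime n → ℝ),
      UnitSolution ν a b u → Measurable b → weightNorm q l b ≤ K →
      volume {x : EuclideanSpace ℝ (Fin n) | ‖x‖ < 1 / 2 ∧ u (x, -θ) < 1 / 2} ≤
        ENNReal.ofReal (1 / 2) * halfBall n →
      ∀ t ∈ Ioo (-θ) 0, volume {x : EuclideanSpace ℝ (Fin n) | ‖x‖ < 1 / 2 ∧ u (x, t) < 1 / 64} ≤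
        ENNReal.ofReal (3 / 4) * halfBall n := by
  obtain ⟨s, A, hs, hsmall⟩ := exists_lintegral_weight_le n hq hl
  have hn0 : 0 < n := by omega
  have hn1 : (1 : ℝ) ≤ n := by exact_mod_cast hn0
  have hl0 : 0 ≤ 1 / l := by positivity
  set L : ℝ≥0 := 16 * n with hL
  set c₀ : ℝ≥0∞ := ENNReal.ofReal ((2 + 4 * (ν⁻¹) ^ 3) * L ^ 2) with hc₀
  set V₁ := volume (Metric.ball (0 : EuclideanSpace ℝ (Fin n)) 1) with hV₁
  have hV₁fin : V₁ ≠ ⊤ := Metric.isBounded_ball.measure_lt_top.ne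
  set X : ℝ≥0∞ := c₀ * (A * (K : ℝ≥0∞) ^ (1 / l)) with hX
  have hXfin : X ≠ ⊤ := by
    rw [hX, hc₀]
    exact ENNReal.mul_ne_top ENNReal.ofReal_ne_top (ENNReal.mul_ne_top ENNReal.coe_ne_top
      (ENNReal.rpow_ne_top_of_nonneg hl0 ENNReal.coe_ne_top))
  -- Over a time span `θ` the drift and cutoff errors are at most `X (V₁ θ)^s / 4`, so a short span
  -- makes them negligible against the volume of the ball.
  have htend : Tendsto (fun θ : ℝ => X * (V₁ * ENNReal.ofReal θ) ^ s) (𝓝 0) (𝓝 0) := by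
    have h1 : Tendsto (fun θ : ℝ => ENNReal.ofReal θ) (𝓝 0) (𝓝 0) := by
      have := (ENNReal.continuous_ofReal).tendsto (0 : ℝ)
      rwa [ENNReal.ofReal_zero] at this
    have h2 : Tendsto (fun θ : ℝ => V₁ * ENNReal.ofReal θ) (𝓝 0) (𝓝 0) := by
      have := ENNReal.Tendsto.const_mul h1 (Or.inr hV₁fin)
      rwa [mul_zero] at this
    have h3 : Tendsto (fun θ : ℝ => (V₁ * ENNReal.ofReal θ) ^ s) (𝓝 0) (𝓝 0) := by
      have := ((ENNReal.continuous_rpow_const (y := s)).tendsto 0).comp h2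
      rwa [ENNReal.zero_rpow_of_pos hs] at this
    have := ENNReal.Tendsto.const_mul h3 (Or.inr hXfin)
    rwa [mul_zero] at this
  have hε : 0 < ENNReal.ofReal (1 / 16) * halfBall n :=
    ENNReal.mul_pos (by simp) (halfBall_pos n).ne'
  have hev : ∀ᶠ θ : ℝ in 𝓝[>] 0,
      X * (V₁ * ENNReal.ofReal θ) ^ s < ENNReal.ofReal (1 / 16) * halfBall n :=
    (htend.mono_left nhdsWithin_le_nhds).eventually (gt_mem_nhds hε)
  have hev2 : ∀ᶠ θ : ℝ in 𝓝[>] 0, θ < 1 := nhdsWithin_le_nhds (gt_mem_nhds zero_lt_one)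
  obtain ⟨θ, ⟨hθX, hθ1⟩, hθ0⟩ := ((hev.and hev2).and self_mem_nhdsWithin).exists
  have hθ : 0 < θ := hθ0
  refine ⟨θ, hθ, hθ1, fun a b u hu hb hbK hinit t ht => ?_⟩
  obtain ⟨C, hC⟩ := hu.lipschitz
  have huc := hC.continuous
  set B := Metric.ball (0 : EuclideanSpace ℝ (Fin n)) 1
  -- The time factor `t + 2` exceeds one on the unit cylinder, so this cutoff acts in space only.
  -- Its slope `16 n` matches the shell of width `1/(16 n)`.
  let ζ : SpaceTime n → ℝ := cutoff (1 / 2) (16 * n) (-2) 1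
  have hcpos : (0 : ℝ) < 16 * n := by positivity
  have hζL : LipschitzWith L ζ := lipschitzWith_cutoff _ _ hcpos.le zero_le_one
    (by rw [hL]; push_cast; exact le_rfl) (by rw [hL]; push_cast; linarith)
  have hL1 : 1 ≤ L := by
    rw [← NNReal.coe_le_coe, hL]; push_cast; linarith
  have hen := hu.energy_slice (k := 1 / 2) (by norm_num) hL1 hζL (fun z => cutoff_nonneg _ _ _ _ z)
    (fun z => cutoff_le_one _ _ _ _ z) (ρ := 1 / 2) (by norm_num)
    (fun z hz => cutoff_eq_zero hcpos one_pos hz) (by linarith : -1 < -θ) ht.1.le ht.2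
  set w := trunc (1 / 2) u with hw
  have hw1 : ∀ z, w z ≤ 1 / 2 := trunc_le (by norm_num) hu.nonneg
  have hw0 : ∀ z, 0 ≤ w z := trunc_nonneg _ _
  set S₀ := {x : EuclideanSpace ℝ (Fin n) | ‖x‖ < 1 / 2 ∧ u (x, -θ) < 1 / 2} with hS₀
  have hcs : ∀ t : ℝ, Continuous fun x : EuclideanSpace ℝ (Fin n) => u (x, t) := fun t =>
    huc.comp (by fun_prop)
  have hS₀m : MeasurableSet S₀ :=
    ((isOpen_lt continuous_norm continuous_const).inter
      (isOpen_lt (hcs _) continuous_const)).measurableSet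
  have hterm1 : ∫⁻ x in B, ENNReal.ofReal ((w (x, -θ) * ζ (x, -θ)) ^ 2) ≤
      ENNReal.ofReal (1 / 8) * halfBall n := by
    calc ∫⁻ x in B, ENNReal.ofReal ((w (x, -θ) * ζ (x, -θ)) ^ 2)
        ≤ ∫⁻ x, S₀.indicator (fun _ => ENNReal.ofReal (1 / 4)) x := by
          refine (setLIntegral_le_lintegral _ _).trans (lintegral_mono fun x => ?_)
          by_cases hx : x ∈ S₀
          · rw [indicator_of_mem hx]
            refine ENNReal.ofReal_le_ofReal ?_
            have h1 : w (x, -θ) * ζ (x, -θ) ≤ 1 / 2 * 1 :=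
              mul_le_mul (hw1 _) (cutoff_le_one _ _ _ _ _) (cutoff_nonneg _ _ _ _ _) (by norm_num)
            have h2 : 0 ≤ w (x, -θ) * ζ (x, -θ) := mul_nonneg (hw0 _) (cutoff_nonneg _ _ _ _ _)
            nlinarith
          · have : w (x, -θ) * ζ (x, -θ) = 0 := by
              by_contra hne
              have h1 := left_ne_zero_of_mul hne
              have h2 := (lt_of_cutoff_ne_zero hcpos one_pos (right_ne_zero_of_mul hne)).1
              refine hx ⟨h2, ?_⟩
              by_contra h3
              exact h1 (max_eq_right (by linarith))
            simp [this]
      _ = ENNReal.ofReal (1 / 4) * volume S₀ := by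
          rw [lintegral_indicator_const hS₀m]
      _ ≤ ENNReal.ofReal (1 / 4) * (ENNReal.ofReal (1 / 2) * halfBall n) := by gcongr
      _ = _ := by rw [← mul_assoc, ← ENNReal.ofReal_mul (by norm_num)]; norm_num
  have hterm2 : c₀ * ∫⁻ z in slab n (-θ) 0 ∩ {z | ζ z ≠ 0}, ENNReal.ofReal (w z ^ 2) * weight b z ≤
      ENNReal.ofReal (1 / 64) * halfBall n := by
    have hslab : slab n (-θ) 0 ⊆ slab n (-1) 0 :=
      prod_mono subset_rfl (Ioo_subset_Ioo_left (by linarith))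
    have h1 := hsmall b hb _ (measurableSet_slab n (-θ) 0) hslab
    rw [volume_slab_eq, sub_neg_eq_add, zero_add] at h1
    calc c₀ * ∫⁻ z in slab n (-θ) 0 ∩ {z | ζ z ≠ 0}, ENNReal.ofReal (w z ^ 2) * weight b z
        ≤ c₀ * ∫⁻ z in slab n (-θ) 0, ENNReal.ofReal (1 / 4) * weight b z := by
          refine mul_le_mul_right (α := ℝ≥0∞) ?_ _
          refine (lintegral_mono fun z => ?_).trans (lintegral_mono_set inter_subset_left)
          gcongr
          nlinarith [hw0 z, hw1 z]
      _ = ENNReal.ofReal (1 / 4) * (c₀ * ∫⁻ z in slab n (-θ) 0, weight b z) := by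
          rw [lintegral_const_mul' _ _ ENNReal.ofReal_ne_top]; ring
      _ ≤ ENNReal.ofReal (1 / 4) * (c₀ * (A * (K : ℝ≥0∞) ^ (1 / l) * (V₁ * ENNReal.ofReal θ) ^ s)) := by
          gcongr
          refine h1.trans ?_
          gcongr
      _ = ENNReal.ofReal (1 / 4) * (X * (V₁ * ENNReal.ofReal θ) ^ s) := by rw [hX]; ring
      _ ≤ ENNReal.ofReal (1 / 4) * (ENNReal.ofReal (1 / 16) * halfBall n) := by
          gcongr
      _ = _ := by rw [← mul_assoc, ← ENNReal.ofReal_mul (by norm_num)]; norm_num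
  -- `9/64 = 1/8 + 1/64`, the initial energy plus the error.
  have hRHS : ∫⁻ x in B, ENNReal.ofReal ((w (x, t) * ζ (x, t)) ^ 2) ≤
      ENNReal.ofReal (9 / 64) * halfBall n := by
    refine hen.trans ((add_le_add hterm1 hterm2).trans (le_of_eq ?_))
    rw [← add_mul, ← ENNReal.ofReal_add (by norm_num) (by norm_num)]; norm_num
  set B' := Metric.ball (0 : EuclideanSpace ℝ (Fin n)) (1 / 2 - 1 / (16 * n)) with hB'
  set S := {x : EuclideanSpace ℝ (Fin n) | ‖x‖ < 1 / 2 ∧ u (x, t) < 1 / 64} with hS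
  set S' := B' ∩ {x | u (x, t) < 1 / 64} with hS'
  have hS'm : MeasurableSet S' :=
    (Metric.isOpen_ball.inter (isOpen_lt (hcs _) continuous_const)).measurableSet
  have hinv : 0 < 1 / (16 * (n : ℝ)) := by positivity
  have hlow : ENNReal.ofReal ((31 / 64) ^ 2) * volume S' ≤
      ∫⁻ x in B, ENNReal.ofReal ((w (x, t) * ζ (x, t)) ^ 2) := by
    have hSB : S' ⊆ B := fun x hx => Metric.ball_subset_ball (by linarith) hx.1
    rw [← lintegral_indicator_const hS'm, lintegral_indicator hS'm]
    refine le_trans ?_ (lintegral_mono_set hSB)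
    refine setLIntegral_mono' hS'm fun x hx => ENNReal.ofReal_le_ofReal ?_
    have hx1 : ‖x‖ < 1 / 2 - 1 / (16 * n) := by simpa [hB'] using hx.1
    have hone : ζ (x, t) = 1 := by
      refine cutoff_eq_one ?_ ?_
      · calc (1 : ℝ) = 16 * n * (1 / (16 * n)) := by field_simp
          _ ≤ _ := by
            refine mul_le_mul_of_nonneg_left ?_ hcpos.le
            linarith
      · have := ht.1
        simp only
        linarith
    have hux : u (x, t) < 1 / 64 := hx.2
    have hwx : 31 / 64 ≤ w (x, t) := le_max_of_le_left (by linarith)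
    rw [hone, mul_one]
    exact pow_le_pow_left₀ (by norm_num) hwx 2
  -- Where `u < 1/64` the truncation is at least `31/64`, and `(9/64)/(31/64)² = 576/961 < 5/8`.
  -- Adding the shell, at most `1/8`, leaves `3/4 < 1`.
  have hS'le : volume S' ≤ ENNReal.ofReal (5 / 8) * halfBall n := by
    have h1 : ENNReal.ofReal ((31 / 64) ^ 2) * volume S' ≤
        ENNReal.ofReal ((31 / 64) ^ 2) * (ENNReal.ofReal (5 / 8) * halfBall n) := by
      refine (hlow.trans hRHS).trans ?_
      rw [← mul_assoc, ← ENNReal.ofReal_mul (by positivity)]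
      gcongr
      norm_num
    exact (ENNReal.mul_le_mul_iff_right (by simp) ENNReal.ofReal_ne_top).1 h1
  have hshell : volume (Metric.ball (0 : EuclideanSpace ℝ (Fin n)) (1 / 2) \ B') ≤
      ENNReal.ofReal (1 / 8) * halfBall n := by
    have hsub : B' ⊆ Metric.ball (0 : EuclideanSpace ℝ (Fin n)) (1 / 2) :=
      Metric.ball_subset_ball (by linarith)
    rw [measure_sdiff hsub Metric.isOpen_ball.measurableSet.nullMeasurableSet
      Metric.isBounded_ball.measure_lt_top.ne]
    exact tsub_le_iff_left.2 (volume_shell_le hn0)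
  calc volume S ≤ volume (S' ∪ (Metric.ball (0 : EuclideanSpace ℝ (Fin n)) (1 / 2) \ B')) := by
        refine measure_mono fun x hx => ?_
        by_cases hxB : x ∈ B'
        · exact Or.inl ⟨hxB, hx.2⟩
        · exact Or.inr ⟨by simpa using hx.1, hxB⟩
    _ ≤ _ := measure_union_le _ _
    _ ≤ ENNReal.ofReal (5 / 8) * halfBall n + ENNReal.ofReal (1 / 8) * halfBall n :=
        add_le_add hS'le hshell
    _ = _ := by
        rw [← add_mul, ← ENNReal.ofReal_add (by norm_num) (by norm_num)]; norm_num

/-! ### Shrinking of the sublevel sets. -/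

/-- No differentiability is assumed: at an extremum each line derivative is zero, either by Fermat
or by convention. -/
theorem gradSq_eq_zero_of_forall_le {n : ℕ} {f : EuclideanSpace ℝ (Fin n) → ℝ}
    {x : EuclideanSpace ℝ (Fin n)} (h : (∀ y, f x ≤ f y) ∨ ∀ y, f y ≤ f x) : gradSq f x = 0 := by
  refine Finset.sum_eq_zero fun i _ => ?_
  rw [sq_eq_zero_iff]
  have h' : IsLocalExtr (fun t : ℝ => f (x + t • EuclideanSpace.single i (1 : ℝ))) 0 := by
    refine h.imp (fun h => ?_) (fun h => ?_)
    · exact Eventually.of_forall fun t => by simpa using h _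
    · exact Eventually.of_forall fun t => by simpa using h _
  exact h'.deriv_eq_zero

theorem gradSq_congr {n : ℕ} {f g : EuclideanSpace ℝ (Fin n) → ℝ} {x : EuclideanSpace ℝ (Fin n)}
    (h : f =ᶠ[𝓝 x] g) : gradSq f x = gradSq g x :=
  Finset.sum_congr rfl fun i _ => by rw [h.lineDeriv_eq (𝕜 := ℝ)]

/-- The part of the cylinder of radius `1/2` and height `θ` where `u < k`. -/
def lowSet {n : ℕ} (u : SpaceTime n → ℝ) (θ k : ℝ) : Set (SpaceTime n) :=
  {z | ‖z.1‖ < 1 / 2 ∧ z.2 ∈ Ioo (-θ) 0 ∧ u z < k}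

theorem lowSet_subset_slab {n : ℕ} (u : SpaceTime n → ℝ) (θ k : ℝ) :
    lowSet u θ k ⊆ slab n (-θ) 0 := fun z hz =>
  ⟨by simpa using lt_trans hz.1 (by norm_num), hz.2.1⟩

theorem isOpen_lowSet {n : ℕ} {u : SpaceTime n → ℝ} (hu : Continuous u) (θ k : ℝ) :
    IsOpen (lowSet u θ k) :=
  (isOpen_lt continuous_fst.norm continuous_const).inter
    ((isOpen_Ioo.preimage continuous_snd).inter (isOpen_lt hu continuous_const))

theorem lowSet_mono {n : ℕ} (u : SpaceTime n → ℝ) (θ : ℝ) {k k' : ℝ} (h : k ≤ k') :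
    lowSet u θ k ⊆ lowSet u θ k' := fun _ hz => ⟨hz.1, hz.2.1, hz.2.2.trans_le h⟩

theorem volume_lowSet_lt_top {n : ℕ} (u : SpaceTime n → ℝ) (θ k : ℝ) :
    volume (lowSet u θ k) < ⊤ :=
  (measure_mono (lowSet_subset_slab u θ k)).trans_lt (volume_slab_lt_top n _ _)

/-- De Giorgi's isoperimetric inequality on a time slice. -/
theorem isoperimetric_slice {n : ℕ} {f : EuclideanSpace ℝ (Fin n) → ℝ} {C : ℝ≥0}
    (hf : LipschitzWith C f) {k : ℝ} (hk : 0 < k)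
    (hlow : volume {x | ‖x‖ < 1 / 2 ∧ f x < k} ≤ ENNReal.ofReal (3 / 4) * halfBall n) :
    ENNReal.ofReal (k / 2) * volume {x | ‖x‖ < 1 / 2 ∧ f x < k / 2} ≤
      4 * 2 ^ n * ∫⁻ x in {x | ‖x‖ < 1 / 2 ∧ f x < k} \ {x | ‖x‖ < 1 / 2 ∧ f x < k / 2},
        ENNReal.ofReal √(gradSq (trunc k f) x) := by
  have hfc := hf.continuous
  have hm : ∀ c : ℝ, MeasurableSet {x | ‖x‖ < 1 / 2 ∧ f x < c} := fun c =>
    ((isOpen_lt continuous_norm continuous_const).inter (isOpen_lt hfc continuous_const)).measurableSet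
  set B := Metric.ball (0 : EuclideanSpace ℝ (Fin n)) (1 / 2) with hB
  set A := {x | ‖x‖ < 1 / 2 ∧ f x < k} with hA
  set S := {x | ‖x‖ < 1 / 2 ∧ f x < k / 2} with hS
  have hAB : A ⊆ B := fun x hx => by simpa [hB] using hx.1
  have hSB : S ⊆ B := fun x hx => by simpa [hB] using hx.1
  -- The doubly truncated function equals `k/2` on `{f ≤ k/2}` and `0` on `{f ≥ k}`, both extremal
  -- values, so its gradient is confined to the layer between the levels.
  set g : EuclideanSpace ℝ (Fin n) → ℝ := fun x => min (trunc k f x) (k / 2) with hg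
  have hgL : LipschitzWith C g := (lipschitz_trunc k hf).min_const _
  have hg0 : ∀ x, 0 ≤ g x := fun x => le_min (trunc_nonneg _ _ _) (by linarith)
  have hg1 : ∀ x, g x ≤ k / 2 := fun x => min_le_right _ _
  have hgS : ∀ x, f x ≤ k / 2 → g x = k / 2 := fun x hx =>
    min_eq_right (le_max_of_le_left (by linarith))
  have hgT : ∀ x, k ≤ f x → g x = 0 := fun x hx => by
    simp only [hg, trunc]
    rw [max_eq_right (by linarith), min_eq_left (by linarith)]
  have hiso := isoperimetric (1 / 2) hgL (by linarith : 0 ≤ k / 2) (hm _)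
    (Metric.isOpen_ball.measurableSet.diff (hm k)) hSB sdiff_subset
    (fun x hx => hgS x hx.2.le) (fun x hx => hgT x (by
      by_contra h
      exact hx.2 ⟨by simpa [hB] using hx.1, not_le.1 h⟩))
  -- The bound `3/4` leaves at least a quarter of the ball for the set where `g` vanishes; this
  -- quarter is the origin of the factor `4`.
  have hT : ENNReal.ofReal (1 / 4) * halfBall n ≤ volume (B \ A) := by
    rw [measure_sdiff hAB (hm k).nullMeasurableSet
      ((measure_mono hAB).trans_lt Metric.isBounded_ball.measure_lt_top).ne]
    refine le_trans ?_ (tsub_le_tsub_left hlow _)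
    refine ENNReal.le_sub_of_add_le_right
      (ENNReal.mul_ne_top ENNReal.ofReal_ne_top (halfBall_ne_top n)) ?_
    rw [← add_mul, ← ENNReal.ofReal_add (by norm_num) (by norm_num)]
    norm_num [halfBall, hB]
  have hgrad : ∫⁻ x in B, ENNReal.ofReal √(gradSq g x) ≤
      ∫⁻ x in A \ S, ENNReal.ofReal √(gradSq (trunc k f) x) := by
    rw [← lintegral_indicator ((hm k).diff (hm _))]
    refine (setLIntegral_mono' Metric.isOpen_ball.measurableSet fun x hx => ?_).trans
      (setLIntegral_le_lintegral _ _)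
    have hx' : ‖x‖ < 1 / 2 := by simpa [hB] using hx
    rcases le_or_gt (f x) (k / 2) with h1 | h1
    · rw [gradSq_eq_zero_of_forall_le (Or.inr fun y => (hg1 y).trans_eq (hgS x h1).symm)]
      simp
    rcases le_or_gt k (f x) with h2 | h2
    · rw [gradSq_eq_zero_of_forall_le (Or.inl fun y => (hgT x h2).trans_le (hg0 y))]
      simp
    rw [indicator_of_mem (show x ∈ A \ S from ⟨⟨hx', h2⟩, fun h => absurd h.2 (not_lt.2 h1.le)⟩),
      gradSq_congr (g := trunc k f)]
    filter_upwards [hfc.continuousAt.eventually (lt_mem_nhds h1)] with y hy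
    exact min_eq_left (max_le (by linarith) (by linarith))
  have h4 : ENNReal.ofReal (k / 2) * volume S * (ENNReal.ofReal (1 / 4) * halfBall n) ≤
      halfBall n * 2 ^ n * ∫⁻ x in A \ S, ENNReal.ofReal √(gradSq (trunc k f) x) := by
    calc _ ≤ ENNReal.ofReal (k / 2) * volume S * volume (B \ A) := by gcongr
      _ ≤ _ := hiso
      _ ≤ _ := by
        rw [mul_one_div_cancel two_ne_zero, ENNReal.ofReal_one, one_mul]
        exact mul_le_mul_right (α := ℝ≥0∞) hgrad _
  have e4 : ENNReal.ofReal (1 / 4) * 4 = 1 := by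
    rw [show (4 : ℝ≥0∞) = ENNReal.ofReal 4 by norm_num, ← ENNReal.ofReal_mul (by norm_num)]
    norm_num
  refine (ENNReal.mul_le_mul_iff_right (halfBall_pos n).ne' (halfBall_ne_top n)).1 ?_
  calc halfBall n * (ENNReal.ofReal (k / 2) * volume S)
      = 4 * (ENNReal.ofReal (k / 2) * volume S * (ENNReal.ofReal (1 / 4) * halfBall n)) := by
        rw [show 4 * (ENNReal.ofReal (k / 2) * volume S * (ENNReal.ofReal (1 / 4) * halfBall n)) =
          ENNReal.ofReal (1 / 4) * 4 * (halfBall n * (ENNReal.ofReal (k / 2) * volume S)) by ring,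
          e4, one_mul]
    _ ≤ 4 * (halfBall n * 2 ^ n * ∫⁻ x in A \ S, ENNReal.ofReal √(gradSq (trunc k f) x)) := by
        gcongr
    _ = _ := by ring

/-- The isoperimetric inequality integrated in time. -/
theorem isoperimetric_lowSet {n : ℕ} {u : SpaceTime n → ℝ} {C : ℝ≥0}
    (hu : LipschitzWith C u) {k θ : ℝ} (hk : 0 < k)
    (hlow : ∀ t ∈ Ioo (-θ) 0, volume {x : EuclideanSpace ℝ (Fin n) | ‖x‖ < 1 / 2 ∧ u (x, t) < k} ≤
      ENNReal.ofReal (3 / 4) * halfBall n) :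
    ENNReal.ofReal (k / 2) * volume (lowSet u θ (k / 2)) ≤
      4 * 2 ^ n * ∫⁻ z in lowSet u θ k \ lowSet u θ (k / 2),
        ENNReal.ofReal √(spaceGradSq (trunc k u) z) := by
  have huc := hu.continuous
  have hm : ∀ c, MeasurableSet (lowSet u θ c) := fun c => (isOpen_lowSet huc θ c).measurableSet
  have hD := (hm k).diff (hm (k / 2))
  have hF : Measurable ((lowSet u θ k \ lowSet u θ (k / 2)).indicator fun z =>
      ENNReal.ofReal √(spaceGradSq (trunc k u) z)) :=
    ((measurable_spaceGradSq (lipschitz_trunc k hu).continuous).sqrt.ennreal_ofReal).indicator hD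
  have hset : ∀ (S : Set (SpaceTime n)), MeasurableSet S → S ⊆ slab n (-θ) 0 →
      ∀ F : SpaceTime n → ℝ≥0∞,
      ∫⁻ z in S, F z = ∫⁻ z in slab n (-θ) 0, S.indicator F z := fun S hS hSs F => by
    rw [lintegral_indicator hS, Measure.restrict_restrict hS, inter_eq_left.2 hSs]
  rw [← setLIntegral_one (lowSet u θ (k / 2)), hset _ (hm _) (lowSet_subset_slab _ _ _),
    hset _ hD (sdiff_subset.trans (lowSet_subset_slab _ _ _)),
    lintegral_slab (measurable_const.indicator (hm _)), lintegral_slab hF,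
    ← lintegral_const_mul' _ _ ENNReal.ofReal_ne_top,
    ← lintegral_const_mul' _ _ (ENNReal.mul_ne_top (by norm_num) (by simp))]
  refine setLIntegral_mono' measurableSet_Ioo fun t ht => ?_
  have hfL := lipschitz_slice hu t
  have hms : ∀ c : ℝ, MeasurableSet {x : EuclideanSpace ℝ (Fin n) | ‖x‖ < 1 / 2 ∧ u (x, t) < c} :=
    fun c => ((isOpen_lt continuous_norm continuous_const).inter
      (isOpen_lt hfL.continuous continuous_const)).measurableSet
  have hball : ∀ c : ℝ, {x : EuclideanSpace ℝ (Fin n) | ‖x‖ < 1 / 2 ∧ u (x, t) < c} ⊆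
      Metric.ball 0 1 := fun c x hx => by simpa using lt_trans hx.1 (by norm_num)
  refine le_trans (le_of_eq ?_) ((isoperimetric_slice hfL hk (hlow t ht)).trans (le_of_eq ?_))
  · congr 1
    rw [← setLIntegral_one, ← inter_eq_left.2 (hball (k / 2)), ← Measure.restrict_restrict (hms _),
      ← lintegral_indicator (hms _)]
    refine lintegral_congr fun x => ?_
    simp only [indicator, lowSet, mem_ofPred_eq, ht, true_and]
  · congr 1
    rw [← inter_eq_left.2 (sdiff_subset.trans (hball k)),
      ← Measure.restrict_restrict ((hms _).diff (hms _)), ← lintegral_indicator ((hms _).diff (hms _))]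
    refine lintegral_congr fun x => ?_
    simp only [indicator, lowSet, Set.mem_sdiff, mem_ofPred_eq, ht, true_and, spaceGradSq_eq_gradSq]
    rfl

/-- Cauchy–Schwarz against the constant one. It brings in the measure of the layer, which is the
quantity that telescopes over the levels. -/
theorem sq_lintegral_sqrt_le {X : Type*} [MeasurableSpace X] (μ : Measure X) (S : Set X)
    {g : X → ℝ} (hg : Measurable g) :
    (∫⁻ x in S, ENNReal.ofReal √(g x) ∂μ) ^ 2 ≤ μ S * ∫⁻ x in S, ENNReal.ofReal (g x) ∂μ := by
  have h := ENNReal.lintegral_mul_norm_pow_le (μ := μ.restrict S) (f := fun _ => (1 : ℝ≥0∞))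
    (g := fun x => ENNReal.ofReal (g x)) aemeasurable_const hg.ennreal_ofReal.aemeasurable
    (p := 1 / 2) (q := 1 / 2) (by norm_num) (by norm_num) (by norm_num)
  have e : ∀ x, ENNReal.ofReal √(g x) = ENNReal.ofReal (g x) ^ (1 / 2 : ℝ) := fun x => by
    rcases le_total 0 (g x) with h0 | h0
    · rw [Real.sqrt_eq_rpow, ENNReal.ofReal_rpow_of_nonneg h0 (by norm_num)]
    · rw [Real.sqrt_eq_zero_of_nonpos h0, ENNReal.ofReal_of_nonpos h0]; simp
  simp only [ENNReal.one_rpow, one_mul, setLIntegral_one] at h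
  simp only [e]
  refine (pow_le_pow_left₀ zero_le h 2).trans (le_of_eq ?_)
  rw [mul_pow, ← ENNReal.rpow_natCast, ← ENNReal.rpow_natCast, ← ENNReal.rpow_mul,
    ← ENNReal.rpow_mul]
  norm_num

/-- Bound for the gradient of truncations at level `k`, relative to `k`. -/
theorem exists_gradient_bound {n : ℕ} {q l : ℝ} (hq : 1 < q) (hl : 1 < l) (ν : ℝ)
    (K : ℝ≥0) {θ : ℝ} (hθ1 : θ < 1) :
    ∃ G : ℝ≥0, ∀ (a : SpaceTime n → Matrix (Fin n) (Fin n) ℝ)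
      (b : SpaceTime n → EuclideanSpace ℝ (Fin n)) (u : SpaceTime n → ℝ),
      UnitSolution ν a b u → Measurable b → weightNorm q l b ≤ K → ∀ k, 0 ≤ k →
      ∫⁻ z in lowSet u θ k, ENNReal.ofReal (spaceGradSq (trunc k u) z) ≤
        G * ENNReal.ofReal (k ^ 2) := by
  obtain ⟨s, A, hs, hsmall⟩ := exists_lintegral_weight_le n hq hl
  have hl0 : 0 ≤ 1 / l := by positivity
  set V₁ := volume (Metric.ball (0 : EuclideanSpace ℝ (Fin n)) 1) with hV₁
  have hV₁fin : V₁ ≠ ⊤ := Metric.isBounded_ball.measure_lt_top.ne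
  set c₀ : ℝ≥0∞ := ENNReal.ofReal ((2 + 4 * (ν⁻¹) ^ 3) * (4 : ℝ≥0) ^ 2) with hc₀
  set X : ℝ≥0∞ := ENNReal.ofReal ν⁻¹ * (V₁ + c₀ *
    (A * (K : ℝ≥0∞) ^ (1 / l) * volume (slab n (-1) 0) ^ s)) with hX
  have hXfin : X ≠ ⊤ := by
    refine ENNReal.mul_ne_top ENNReal.ofReal_ne_top (ENNReal.add_ne_top.2 ⟨hV₁fin,
      ENNReal.mul_ne_top ENNReal.ofReal_ne_top (ENNReal.mul_ne_top (ENNReal.mul_ne_top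
      ENNReal.coe_ne_top (ENNReal.rpow_ne_top_of_nonneg hl0 ENNReal.coe_ne_top)) ?_)⟩)
    exact ENNReal.rpow_ne_top_of_nonneg hs.le (volume_slab_lt_top n _ _).ne
  refine ⟨X.toNNReal, fun a b u hu hb hbK k hk => ?_⟩
  rw [ENNReal.coe_toNNReal hXfin]
  obtain ⟨C, hC⟩ := hu.lipschitz
  -- Equal to one for `‖x‖ ≤ 1/2` and constant in time on the unit cylinder. There is an initial
  -- energy here, but it is at most `k²` times the volume, like the other terms.
  let ζ : SpaceTime n → ℝ := cutoff (3 / 4) 4 (-2) 1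
  have hζL : LipschitzWith (4 : ℝ≥0) ζ := lipschitzWith_cutoff _ _ (by norm_num) zero_le_one
    (by norm_num) (by norm_num)
  have hen := hu.energy_grad hk (L := 4) (by norm_num) hζL (fun z => cutoff_nonneg _ _ _ _ z)
    (fun z => cutoff_le_one _ _ _ _ z) (ρ := 3 / 4) (by norm_num)
    (fun z hz => cutoff_eq_zero (by norm_num) one_pos hz) (by linarith : -1 < -θ)
  set w := trunc k u with hw
  have hwk : ∀ z, w z ≤ k := trunc_le hk hu.nonneg
  have hw0 : ∀ z, 0 ≤ w z := trunc_nonneg _ _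
  have hslab : slab n (-θ) 0 ⊆ slab n (-1) 0 :=
    prod_mono subset_rfl (Ioo_subset_Ioo_left (by linarith))
  have hrhs : energyRHS ν b w ζ 4 (-θ) 0 ≤ ENNReal.ofReal (k ^ 2) * (V₁ + c₀ *
      (A * (K : ℝ≥0∞) ^ (1 / l) * volume (slab n (-1) 0) ^ s)) := by
    rw [mul_add, energyRHS]
    refine add_le_add ?_ ?_
    · calc _ ≤ ∫⁻ _x in Metric.ball (0 : EuclideanSpace ℝ (Fin n)) 1, ENNReal.ofReal (k ^ 2) := by
            refine lintegral_mono fun x => ENNReal.ofReal_le_ofReal ?_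
            refine pow_le_pow_left₀ (mul_nonneg (hw0 _) (cutoff_nonneg _ _ _ _ _)) ?_ 2
            exact (mul_le_mul (hwk _) (cutoff_le_one _ _ _ _ _) (cutoff_nonneg _ _ _ _ _) hk).trans_eq
              (mul_one k)
        _ = _ := by rw [setLIntegral_const]
    · calc _ ≤ c₀ * ∫⁻ z in slab n (-1) 0, ENNReal.ofReal (k ^ 2) * weight b z := by
            refine mul_le_mul_right (α := ℝ≥0∞) ?_ _
            refine (lintegral_mono fun z => ?_).trans (lintegral_mono_set
              (inter_subset_left.trans hslab))
            gcongr
            exacts [hw0 z, hwk z]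
        _ = ENNReal.ofReal (k ^ 2) * (c₀ * ∫⁻ z in slab n (-1) 0, weight b z) := by
            rw [lintegral_const_mul' _ _ ENNReal.ofReal_ne_top]; ring
        _ ≤ _ := by
            refine mul_le_mul_right (α := ℝ≥0∞) (mul_le_mul_right (α := ℝ≥0∞) ?_ _) _
            refine (hsmall b hb _ (measurableSet_slab n (-1) 0) subset_rfl).trans ?_
            gcongr
  have hν : ENNReal.ofReal ν ≠ 0 := by simpa using hu.pos
  have hlhs : ∫⁻ z in lowSet u θ k, ENNReal.ofReal (spaceGradSq w z) ≤
      ∫⁻ z in slab n (-θ) 0, ENNReal.ofReal (spaceGradSq w z * ζ z ^ 2) := by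
    refine le_trans ?_ (lintegral_mono_set (lowSet_subset_slab u θ k))
    refine setLIntegral_mono' (isOpen_lowSet hC.continuous θ k).measurableSet fun z hz => ?_
    have : ζ z = 1 := cutoff_eq_one (by linarith [hz.1]) (by linarith [hz.2.1.1])
    rw [this, one_pow, mul_one]
  refine (ENNReal.mul_le_mul_iff_right hν ENNReal.ofReal_ne_top).1 ?_
  calc _ ≤ ENNReal.ofReal ν * ∫⁻ z in slab n (-θ) 0, ENNReal.ofReal (spaceGradSq w z * ζ z ^ 2) := by
        gcongr
    _ ≤ _ := hen.trans hrhs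
    _ = ENNReal.ofReal (ν * ν⁻¹) * (ENNReal.ofReal (k ^ 2) * (V₁ + c₀ *
      (A * (K : ℝ≥0∞) ^ (1 / l) * volume (slab n (-1) 0) ^ s))) := by
        rw [mul_inv_cancel₀ hu.pos.ne', ENNReal.ofReal_one, one_mul]
    _ = _ := by
        rw [ENNReal.ofReal_mul hu.pos.le, hX]; ring

/-- A decreasing sequence of nonnegative reals with `m_{j+1}² ≤ C (m_j - m_{j+1})`
tends to zero at a controlled rate. -/
theorem mul_sq_le_of_sq_le_sub {m : ℕ → ℝ} {C : ℝ} (h0 : ∀ j, 0 ≤ m j) (hC : 0 ≤ C)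
    (h : ∀ j, m (j + 1) ^ 2 ≤ C * (m j - m (j + 1))) (hanti : Antitone m) (J : ℕ) :
    J * m J ^ 2 ≤ C * m 0 := by
  -- Summing the hypothesis telescopes its right side, and each of the `J` squares on the left is at
  -- least `m_J²` by monotonicity.
  have key : ∀ J : ℕ, J * m J ^ 2 ≤ C * (m 0 - m J) := fun J => by
    induction J with
    | zero => simp
    | succ J ih =>
      have h1 : m (J + 1) ^ 2 ≤ m J ^ 2 := pow_le_pow_left₀ (h0 _) (hanti (Nat.le_succ J)) 2
      have h2 := mul_le_mul_of_nonneg_left h1 (Nat.cast_nonneg (α := ℝ) J)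
      push_cast
      nlinarith [h J]
  exact (key J).trans (by nlinarith [h0 J])

/-- De Giorgi's shrinking lemma. -/
theorem exists_shrinking {n : ℕ} {q l : ℝ} (hq : 1 < q) (hl : 1 < l) (ν : ℝ)
    (K : ℝ≥0) {θ : ℝ} (hθ1 : θ < 1) {κ : ℝ≥0} (hκ : 0 < κ) :
    ∃ J : ℕ, ∀ (a : SpaceTime n → Matrix (Fin n) (Fin n) ℝ)
      (b : SpaceTime n → EuclideanSpace ℝ (Fin n)) (u : SpaceTime n → ℝ),
      UnitSolution ν a b u → Measurable b → weightNorm q l b ≤ K →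
      (∀ t ∈ Ioo (-θ) 0, volume {x : EuclideanSpace ℝ (Fin n) | ‖x‖ < 1 / 2 ∧ u (x, t) < 1 / 64} ≤
        ENNReal.ofReal (3 / 4) * halfBall n) →
      volume (lowSet u θ (1 / 64 / 2 ^ J)) ≤ κ := by
  obtain ⟨G, hG⟩ := exists_gradient_bound (n := n) hq hl ν K hθ1
  set M : ℝ := (volume (slab n (-θ) 0)).toReal with hM
  -- The gradient bound scales like `k²`, as does the squared isoperimetric left side `(k/2)² m²`.
  -- The level cancels, and `C` serves every step.
  set C : ℝ := 4 * (4 * 2 ^ n) ^ 2 * G with hC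
  obtain ⟨J, hJ⟩ := exists_nat_gt (C * M / κ ^ 2)
  have hκ' : (0 : ℝ) < κ := hκ
  refine ⟨J, fun a b u hu hb hbK hlow => ?_⟩
  obtain ⟨L, hL⟩ := hu.lipschitz
  set m : ℕ → ℝ := fun j => (volume (lowSet u θ (1 / 64 / 2 ^ j))).toReal with hm
  have hk0 : ∀ j : ℕ, (0 : ℝ) < 1 / 64 / 2 ^ j := fun j => by positivity
  have hhalf : ∀ j : ℕ, (1 / 64 / 2 ^ (j + 1) : ℝ) = 1 / 64 / 2 ^ j / 2 := fun j => by
    rw [pow_succ, div_div _ _ (2 : ℝ)]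
  have hfin : ∀ k, volume (lowSet u θ k) ≠ ⊤ := fun k => (volume_lowSet_lt_top u θ k).ne
  have hstep : ∀ j, m (j + 1) ^ 2 ≤ C * (m j - m (j + 1)) := fun j => by
    set k : ℝ := 1 / 64 / 2 ^ j with hk
    have hkpos : 0 < k := hk0 j
    have hkle : k ≤ 1 / 64 := div_le_self (by norm_num) (one_le_pow₀ (by norm_num))
    have hsub := lowSet_mono u θ (by linarith : k / 2 ≤ k)
    have hmeas := (isOpen_lowSet hL.continuous θ (k / 2)).measurableSet
    have h1 := isoperimetric_lowSet (θ := θ) hL hkpos fun t ht =>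
      (measure_mono fun x (hx : ‖x‖ < 1 / 2 ∧ u (x, t) < k) =>
        (⟨hx.1, hx.2.trans_le hkle⟩ : ‖x‖ < 1 / 2 ∧ u (x, t) < 1 / 64)).trans (hlow t ht)
    set D := lowSet u θ k \ lowSet u θ (k / 2) with hD
    have h2 := sq_lintegral_sqrt_le volume D
      (measurable_spaceGradSq (lipschitz_trunc k hL).continuous)
    have h3 : ∫⁻ z in D, ENNReal.ofReal (spaceGradSq (trunc k u) z) ≤
      G * ENNReal.ofReal (k ^ 2) := (lintegral_mono_set sdiff_subset).trans
        (hG a b u hu hb hbK k hkpos.le)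
    have h4 : (ENNReal.ofReal (k / 2) * volume (lowSet u θ (k / 2))) ^ 2 ≤
        (4 * 2 ^ n) ^ 2 * (volume D * (G * ENNReal.ofReal (k ^ 2))) := by
      refine (pow_le_pow_left₀ zero_le h1 2).trans ?_
      rw [mul_pow]
      gcongr
      exact h2.trans (by gcongr)
    have hDfin : volume D ≠ ⊤ := ((measure_mono sdiff_subset).trans_lt (hfin k).lt_top).ne
    have h5 := ENNReal.toReal_mono (ENNReal.mul_ne_top (ENNReal.pow_ne_top
      (ENNReal.mul_ne_top (by norm_num) (by simp))) (ENNReal.mul_ne_top hDfin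
      (ENNReal.mul_ne_top ENNReal.coe_ne_top ENNReal.ofReal_ne_top))) h4
    have hDm : (volume D).toReal = m j - m (j + 1) := by
      simp only [hm, hhalf, ← hk]
      rw [hD, measure_sdiff hsub hmeas.nullMeasurableSet (hfin _),
        ENNReal.toReal_sub_of_le (measure_mono hsub) (hfin _)]
    simp only [ENNReal.toReal_pow, ENNReal.toReal_mul, ENNReal.toReal_ofReal (half_pos hkpos).le,
      ENNReal.toReal_ofReal (sq_nonneg k), hDm, ENNReal.coe_toReal] at h5
    norm_num at h5
    have h6 : (k / 2 * m (j + 1)) ^ 2 ≤ (4 * 2 ^ n) ^ 2 * ((m j - m (j + 1)) * (G * k ^ 2)) := by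
      convert h5 using 3
      simp only [hm, hhalf, ← hk]
    have hk2 : 0 < k ^ 2 / 4 := by positivity
    refine le_of_mul_le_mul_left ?_ hk2
    rw [hC]
    linarith [h6]
  have hanti : Antitone m := antitone_nat_of_succ_le fun j =>
    ENNReal.toReal_mono (hfin _) (measure_mono (lowSet_mono u θ (by
      rw [hhalf]; linarith [hk0 j])))
  have hfinal : J * m J ^ 2 ≤ C * m 0 := mul_sq_le_of_sq_le_sub (fun j => ENNReal.toReal_nonneg)
    (by rw [hC]; positivity) hstep hanti J
  have hm0 : m 0 ≤ M := ENNReal.toReal_mono (volume_slab_lt_top n _ _).ne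
    (measure_mono (lowSet_subset_slab u θ _))
  have hmJ : m J ≤ κ := by
    by_contra hcon
    push Not at hcon
    have hC0 : 0 ≤ C := by rw [hC]; positivity
    have h1 : C * m 0 ≤ C * M := mul_le_mul_of_nonneg_left hm0 hC0
    rw [div_lt_iff₀ (by positivity)] at hJ
    have h2 : (J : ℝ) * κ ^ 2 ≤ J * m J ^ 2 := by gcongr
    linarith
  rw [← ENNReal.ofReal_toReal (hfin _)]
  exact (ENNReal.ofReal_le_ofReal hmJ).trans_eq (by simp)

/-! ### Lower bound and decay of oscillation on the unit cylinder. -/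

/-- If a nonnegative solution is at least `1/2` on half of the ball at time `-θ`, then it is
bounded below later on. -/
theorem exists_lower_bound {n : ℕ} (hn : 2 ≤ n) {q l : ℝ} (hq : 1 < q) (hl : 1 < l)
    (hql : (n : ℝ) / (2 * q) + 1 / l < 1) (ν : ℝ) (K : ℝ≥0) :
    ∃ θ δ : ℝ, 0 < θ ∧ θ < 1 ∧ 0 < δ ∧ ∀ (a : SpaceTime n → Matrix (Fin n) (Fin n) ℝ)
      (b : SpaceTime n → EuclideanSpace ℝ (Fin n)) (u : SpaceTime n → ℝ),
      UnitSolution ν a b u → Measurable b → weightNorm q l b ≤ K →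
      volume {x : EuclideanSpace ℝ (Fin n) | ‖x‖ < 1 / 2 ∧ u (x, -θ) < 1 / 2} ≤
        ENNReal.ofReal (1 / 2) * halfBall n →
      ∀ z : SpaceTime n, ‖z.1‖ < 1 / 4 → z.2 ∈ Ioo (-θ / 2) 0 → δ ≤ u z := by
  obtain ⟨θ, hθ, hθ1, hprop⟩ := exists_propagation hn hq hl ν K
  obtain ⟨κ, hκ, hDG⟩ := exists_deGiorgi hn hq hl hql ν K hθ hθ1
  obtain ⟨J, hJ⟩ := exists_shrinking (n := n) hq hl ν K hθ1 hκ
  set k : ℝ := 1 / 64 / 2 ^ J with hk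
  have hk0 : 0 < k := by positivity
  refine ⟨θ, k / 2, hθ, hθ1, by positivity, fun a b u hu hb hbK hinit z hz1 hz2 => ?_⟩
  have h1 := hJ a b u hu hb hbK (hprop a b u hu hb hbK hinit)
  -- After division by `k` the small set `{u < k}` becomes the set below one of the De Giorgi lemma.
  have hv := hu.affine k⁻¹ 0 fun z => by have := hu.nonneg z; positivity
  have h2 := hDG a b _ hv hb hbK (by
    refine (measure_mono fun z hz => ?_).trans h1
    refine ⟨hz.1, hz.2.1, ?_⟩
    have := hz.2.2
    rw [add_zero, inv_mul_lt_iff₀ hk0, mul_one] at this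
    exact this) z hz1 hz2
  rw [add_zero, le_inv_mul_iff₀ hk0] at h2
  linarith

/-- One-step improvement of oscillation on the unit cylinder. -/
theorem exists_oscillation_decay {n : ℕ} (hn : 2 ≤ n) {q l : ℝ} (hq : 1 < q) (hl : 1 < l)
    (hql : (n : ℝ) / (2 * q) + 1 / l < 1) (ν : ℝ) (K : ℝ≥0) :
    ∃ ρ δ : ℝ, 0 < ρ ∧ ρ < 1 ∧ 0 < δ ∧ ∀ (a : SpaceTime n → Matrix (Fin n) (Fin n) ℝ)
      (b : SpaceTime n → EuclideanSpace ℝ (Fin n)) (u : SpaceTime n → ℝ),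
      UnitSolution ν a b u → (∀ z, u z ≤ 1) → Measurable b → weightNorm q l b ≤ K →
      (∀ z ∈ cyl n ρ, δ ≤ u z) ∨ ∀ z ∈ cyl n ρ, u z ≤ 1 - δ := by
  obtain ⟨θ, δ, hθ, hθ1, hδ, H⟩ := exists_lower_bound hn hq hl hql ν K
  -- The radius is below one, so its square is still at most `θ/2` and the cylinder fits under the
  -- lower bound in both variables.
  have hcyl : ∀ z ∈ cyl n (min (1 / 4) (θ / 2)), ‖z.1‖ < 1 / 4 ∧ z.2 ∈ Ioo (-θ / 2) 0 :=
    fun z hz => by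
    have h1 : ‖z.1‖ < min (1 / 4) (θ / 2) := by simpa using hz.1
    have h2 := hz.2.1
    have h3 : min (1 / 4) (θ / 2) ^ 2 ≤ θ / 2 := by
      have e1 : min (1 / 4) (θ / 2) ≤ θ / 2 := min_le_right _ _
      have e2 : 0 ≤ min (1 / 4) (θ / 2) := le_min (by norm_num) (by linarith)
      nlinarith
    exact ⟨h1.trans_le (min_le_left _ _), by linarith, hz.2.2⟩
  refine ⟨min (1 / 4) (θ / 2), δ, lt_min (by norm_num) (by linarith),
    (min_le_left _ _).trans_lt (by norm_num), hδ, fun a b u hu hu1 hb hbK => ?_⟩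
  by_cases hinit : volume {x : EuclideanSpace ℝ (Fin n) | ‖x‖ < 1 / 2 ∧ u (x, -θ) < 1 / 2} ≤
      ENNReal.ofReal (1 / 2) * halfBall n
  · exact Or.inl fun z hz => H a b u hu hb hbK hinit z (hcyl z hz).1 (hcyl z hz).2
  · right
    -- If `u < 1/2` on more than half of the ball, then `1 - u < 1/2` on less than half, and the
    -- lower bound for `1 - u` is an upper bound for `u`.
    have hv := hu.affine (-1) 1 fun z => by linarith [hu1 z]
    obtain ⟨C, hC⟩ := hu.lipschitz
    set S := {x : EuclideanSpace ℝ (Fin n) | ‖x‖ < 1 / 2 ∧ u (x, -θ) < 1 / 2} with hS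
    set B := Metric.ball (0 : EuclideanSpace ℝ (Fin n)) (1 / 2) with hB
    have hSB : S ⊆ B := fun x hx => by simpa [hB] using hx.1
    have hSm : MeasurableSet S := ((isOpen_lt continuous_norm continuous_const).inter
      (isOpen_lt (lipschitz_slice hC (-θ)).continuous continuous_const)).measurableSet
    have hSfin : volume S ≠ ⊤ := ((measure_mono hSB).trans_lt Metric.isBounded_ball.measure_lt_top).ne
    have hT : volume (B \ S) ≤ ENNReal.ofReal (1 / 2) * halfBall n := by
      rw [measure_sdiff hSB hSm.nullMeasurableSet hSfin]
      refine tsub_le_iff_left.2 ?_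
      calc volume B = ENNReal.ofReal (1 / 2) * halfBall n + ENNReal.ofReal (1 / 2) * halfBall n := by
            rw [← add_mul, ← ENNReal.ofReal_add (by norm_num) (by norm_num)]
            norm_num [halfBall, hB]
        _ ≤ _ := by
          gcongr
          exact (not_le.1 hinit).le
    intro z hz
    have := H a b _ hv hb hbK ((measure_mono fun x hx => ?_).trans hT) z (hcyl z hz).1 (hcyl z hz).2
    · linarith
    · refine ⟨by simpa [hB] using hx.1, fun h => ?_⟩
      linarith [hx.2, h.2]

/-! ### Parabolic scaling and restriction to smaller cylinders. -/

/-- The parabolic dilation `(x, t) ↦ (R x, R² t)`. -/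
noncomputable def dilation (n : ℕ) {R : ℝ} (hR : 0 < R) : SpaceTime n ≃L[ℝ] SpaceTime n :=
  (ContinuousLinearEquiv.smulLeft (Units.mk0 R hR.ne')).prodCongr
    (ContinuousLinearEquiv.smulLeft (Units.mk0 (R ^ 2) (pow_pos hR 2).ne'))

theorem dilation_apply {n : ℕ} {R : ℝ} (hR : 0 < R) (z : SpaceTime n) :
    dilation n hR z = (R • z.1, R ^ 2 * z.2) := rfl

theorem dilation_preimage_cyl {n : ℕ} {R : ℝ} (hR : 0 < R) :
    dilation n hR ⁻¹' cyl n R = cyl n 1 := by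
  ext z
  have h2 : 0 < R ^ 2 := by positivity
  simp only [cyl, mem_preimage, dilation_apply, mem_prod, mem_ball_zero_iff, norm_smul,
    Real.norm_eq_abs, abs_of_pos hR, mem_Ioo]
  refine and_congr ?_ (and_congr ?_ ?_)
  · constructor <;> intro h <;> nlinarith
  · constructor <;> intro h <;> nlinarith
  · constructor <;> intro h <;> nlinarith

/-- Uniqueness of Haar measure. The value of `c` is irrelevant, because the integral conditions to
be transported only compare with zero. -/
theorem map_dilation {n : ℕ} {R : ℝ} (hR : 0 < R) :
    ∃ c : ℝ≥0, Measure.map (dilation n hR) (volume : Measure (SpaceTime n)) = c • volume := by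
  have := (dilation n hR).isAddHaarMeasure_map (volume : Measure (SpaceTime n))
  exact ⟨_, Measure.isAddLeftInvariant_eq_smul _ _⟩

theorem exists_setIntegral_dilation (n : ℕ) {R : ℝ} (hR : 0 < R) :
    ∃ c : ℝ≥0, ∀ f : SpaceTime n → ℝ,
      ∫ z in cyl n 1, f (dilation n hR z) = c * ∫ z in cyl n R, f z := by
  obtain ⟨c, hc⟩ := map_dilation (n := n) hR
  refine ⟨c, fun f => ?_⟩
  have := setIntegral_map_equiv (μ := (volume : Measure (SpaceTime n)))
    (dilation n hR).toHomeomorph.toMeasurableEquiv f (cyl n R)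
  have e : ⇑(dilation n hR).toHomeomorph.toMeasurableEquiv = dilation n hR := rfl
  rw [e, dilation_preimage_cyl hR, hc, Measure.restrict_smul] at this
  rw [← this, integral_smul_nnreal_measure]
  rfl

theorem quasiMeasurePreserving_dilation (n : ℕ) {R : ℝ} (hR : 0 < R) :
    Measure.QuasiMeasurePreserving (dilation n hR) (volume.restrict (cyl n 1))
      (volume.restrict (cyl n R)) := by
  obtain ⟨c, hc⟩ := map_dilation (n := n) hR
  have hm : Measurable (dilation n hR) := (dilation n hR).continuous.measurable
  refine ⟨hm, ?_⟩
  rw [← dilation_preimage_cyl hR, ← Measure.restrict_map hm (measurableSet_cyl n R), hc,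
    Measure.restrict_smul]
  exact Measure.smul_absolutelyContinuous

theorem lineDeriv_comp_dilation {n : ℕ} {R : ℝ} (hR : 0 < R) (f : SpaceTime n → ℝ)
    (z v : SpaceTime n) :
    lineDeriv ℝ (fun y => f (dilation n hR y)) z v =
      lineDeriv ℝ f (dilation n hR z) (dilation n hR v) := by
  simp only [lineDeriv, map_add, map_smul]

theorem spaceDeriv_comp_dilation {n : ℕ} {R : ℝ} (hR : 0 < R) (f : SpaceTime n → ℝ)
    (i : Fin n) (z : SpaceTime n) :
    spaceDeriv i (fun y => f (dilation n hR y)) z = R * spaceDeriv i f (dilation n hR z) := by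
  rw [spaceDeriv, lineDeriv_comp_dilation, spaceDeriv, ← smul_eq_mul, ← lineDeriv_smul]
  simp [dilation_apply]

theorem timeDeriv_comp_dilation {n : ℕ} {R : ℝ} (hR : 0 < R) (f : SpaceTime n → ℝ)
    (z : SpaceTime n) :
    timeDeriv (fun y => f (dilation n hR y)) z = R ^ 2 * timeDeriv f (dilation n hR z) := by
  rw [timeDeriv, lineDeriv_comp_dilation, timeDeriv, ← smul_eq_mul, ← lineDeriv_smul]
  simp [dilation_apply]

theorem tsupport_comp_dilation_symm {n : ℕ} {R : ℝ} (hR : 0 < R) {η : SpaceTime n → ℝ}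
    (h : tsupport η ⊆ cyl n 1) : tsupport (fun z => η ((dilation n hR).symm z)) ⊆ cyl n R := by
  have e : tsupport (fun z => η ((dilation n hR).symm z)) =
      (dilation n hR).symm ⁻¹' tsupport η :=
    tsupport_comp_eq_preimage η (dilation n hR).symm.toHomeomorph
  rw [e]
  intro z hz
  have := h hz
  rw [← dilation_preimage_cyl hR, mem_preimage, ContinuousLinearEquiv.apply_symm_apply] at this
  exact this

theorem cyl_mono {n : ℕ} {r R : ℝ} (hr : 0 ≤ r) (h : r ≤ R) : cyl n r ⊆ cyl n R :=
  prod_mono (Metric.ball_subset_ball h) (Ioo_subset_Ioo_left (by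
    have := pow_le_pow_left₀ hr h 2
    linarith))

theorem lineDeriv_eq_zero_of_notMem_tsupport {n : ℕ} {η : SpaceTime n → ℝ} {z : SpaceTime n}
    (hz : z ∉ tsupport η) (v : SpaceTime n) : lineDeriv ℝ η z v = 0 := by
  rw [(notMem_tsupport_iff_eventuallyEq.1 hz).lineDeriv_eq (𝕜 := ℝ)]
  simp [lineDeriv]

theorem UniformlyParabolic.mono {n : ℕ} {ν : ℝ} {Q Q' : Set (SpaceTime n)}
    {a : SpaceTime n → Matrix (Fin n) (Fin n) ℝ} (h : UniformlyParabolic ν Q a) (hQ : Q' ⊆ Q) :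
    UniformlyParabolic ν Q' a :=
  ⟨fun i j => (h.aemeasurable i j).mono_measure (Measure.restrict_mono hQ le_rfl),
    ae_restrict_of_ae_restrict_of_subset hQ h.lower,
    ae_restrict_of_ae_restrict_of_subset hQ h.upper,
    ae_restrict_of_ae_restrict_of_subset hQ h.bound⟩

theorem DivNonpos.mono {n : ℕ} {Q Q' : Set (SpaceTime n)} (hQm : MeasurableSet Q)
    {b : SpaceTime n → EuclideanSpace ℝ (Fin n)} (h : DivNonpos Q b) (hQ : Q' ⊆ Q) :
    DivNonpos Q' b := fun φ h1 h2 h3 h4 => by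
  have := h φ h1 h2 (h3.trans hQ) h4
  rwa [setIntegral_eq_of_subset_of_forall_sdiff_eq_zero hQm hQ] at this
  intro z hz
  refine Finset.sum_eq_zero fun i _ => ?_
  rw [spaceDeriv, lineDeriv_eq_zero_of_notMem_tsupport fun h => hz.2 (h3 h), mul_zero]

theorem IsLipschitzSolution.mono {n : ℕ} {Q Q' : Set (SpaceTime n)} (hQm : MeasurableSet Q)
    {a : SpaceTime n → Matrix (Fin n) (Fin n) ℝ} {b : SpaceTime n → EuclideanSpace ℝ (Fin n)}
    {u : SpaceTime n → ℝ} (h : IsLipschitzSolution Q a b u) (hQ : Q' ⊆ Q) :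
    IsLipschitzSolution Q' a b u := by
  refine ⟨h.lipschitz.imp fun C hC => hC.mono hQ, fun η h1 h2 h3 => ?_⟩
  have := h.weak η h1 h2 (h3.trans hQ)
  rwa [setIntegral_eq_of_subset_of_forall_sdiff_eq_zero hQm hQ] at this
  intro z hz
  have hz' : z ∉ tsupport η := fun h => hz.2 (h3 h)
  simp only [spaceDeriv, lineDeriv_eq_zero_of_notMem_tsupport hz', image_eq_zero_of_notMem_tsupport hz']
  simp

theorem UniformlyParabolic.comp_dilation {n : ℕ} {ν R : ℝ} (hR : 0 < R)
    {a : SpaceTime n → Matrix (Fin n) (Fin n) ℝ} (h : UniformlyParabolic ν (cyl n R) a) :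
    UniformlyParabolic ν (cyl n 1) fun z => a (dilation n hR z) :=
  have hq := quasiMeasurePreserving_dilation n hR
  ⟨fun i j => (h.aemeasurable i j).comp_quasiMeasurePreserving hq, hq.ae h.lower, hq.ae h.upper,
    hq.ae h.bound⟩

theorem DivNonpos.comp_dilation {n : ℕ} {R : ℝ} (hR : 0 < R)
    {b : SpaceTime n → EuclideanSpace ℝ (Fin n)} (h : DivNonpos (cyl n R) b) :
    DivNonpos (cyl n 1) fun z => R • b (dilation n hR z) := fun φ h1 h2 h3 h4 => by
  obtain ⟨c, hc⟩ := exists_setIntegral_dilation n hR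
  have := h (fun z => φ ((dilation n hR).symm z)) (h1.comp (dilation n hR).symm.contDiff)
    (h2.comp_homeomorph (dilation n hR).symm.toHomeomorph) (tsupport_comp_dilation_symm hR h3)
    fun z => h4 _
  have e := hc fun z => ∑ i, b z i * spaceDeriv i (fun z => φ ((dilation n hR).symm z)) z
  have hφ : (fun y => φ ((dilation n hR).symm (dilation n hR y))) = φ := by
    ext y; rw [ContinuousLinearEquiv.symm_apply_apply]
  have e2 : ∀ z, ∑ i, (R • b (dilation n hR z)) i * spaceDeriv i φ z =
      R ^ 2 * ∑ i, b (dilation n hR z) i *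
        spaceDeriv i (fun z => φ ((dilation n hR).symm z)) (dilation n hR z) := fun z => by
    rw [Finset.mul_sum]
    refine Finset.sum_congr rfl fun i _ => ?_
    have := spaceDeriv_comp_dilation hR (fun z => φ ((dilation n hR).symm z)) i z
    rw [hφ] at this
    rw [this, PiLp.smul_apply, smul_eq_mul]
    ring
  simp only [e2]
  rw [integral_const_mul, e]
  have h5 := mul_le_mul_of_nonneg_left this (mul_nonneg (sq_nonneg R) c.2)
  rw [mul_zero, mul_neg, mul_assoc] at h5
  exact h5

/-- Every term acquires the factor `R²`: the time derivative directly, the diffusion from two space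
derivatives, and the drift from one derivative and the factor `R` put in front of `b`. -/
theorem IsLipschitzSolution.comp_dilation {n : ℕ} {R : ℝ} (hR : 0 < R)
    {a : SpaceTime n → Matrix (Fin n) (Fin n) ℝ} {b : SpaceTime n → EuclideanSpace ℝ (Fin n)}
    {u : SpaceTime n → ℝ} (h : IsLipschitzSolution (cyl n R) a b u) :
    IsLipschitzSolution (cyl n 1) (fun z => a (dilation n hR z))
      (fun z => R • b (dilation n hR z)) fun z => u (dilation n hR z) := by
  obtain ⟨C, hC⟩ := h.lipschitz
  have hmaps : MapsTo (dilation n hR) (cyl n 1) (cyl n R) := by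
    rw [← dilation_preimage_cyl hR]; exact fun z hz => hz
  refine ⟨⟨_, hC.comp (dilation n hR).lipschitz.lipschitzOnWith hmaps⟩, fun φ h1 h2 h3 => ?_⟩
  obtain ⟨c, hc⟩ := exists_setIntegral_dilation n hR
  obtain ⟨D, hD⟩ := h1
  set ψ : SpaceTime n → ℝ := fun z => φ ((dilation n hR).symm z) with hψ
  have := h.weak ψ ⟨_, hD.comp (dilation n hR).symm.lipschitz⟩
    (h2.comp_homeomorph (dilation n hR).symm.toHomeomorph) (tsupport_comp_dilation_symm hR h3)
  have e := hc fun z => timeDeriv u z * ψ z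
      + ∑ i, ∑ j, a z i j * spaceDeriv j u z * spaceDeriv i ψ z
      + (∑ i, b z i * spaceDeriv i u z) * ψ z
  have hφ : (fun y => ψ (dilation n hR y)) = φ := by
    ext y; simp only [hψ, ContinuousLinearEquiv.symm_apply_apply]
  rw [this, mul_zero] at e
  rw [← hφ]
  simp only [spaceDeriv_comp_dilation, timeDeriv_comp_dilation, PiLp.smul_apply, smul_eq_mul]
  rw [← mul_zero (R ^ 2), ← e, ← integral_const_mul]
  refine integral_congr_ae (Eventually.of_forall fun z => ?_)
  simp only [mul_add, Finset.mul_sum, Finset.sum_mul]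
  congr 1
  · congr 1
    · ring
    · exact Finset.sum_congr rfl fun i _ => Finset.sum_congr rfl fun j _ => by ring
  · exact Finset.sum_congr rfl fun i _ => by ring

/-- Writing the exponent with `(p⁻¹).toReal` includes `p = ∞`, where the scaling factor is one. -/
theorem eLpNorm_comp_smul {E F : Type*} [NormedAddCommGroup E] [NormedSpace ℝ E]
    [FiniteDimensional ℝ E] [MeasurableSpace E] [BorelSpace E] (μ : Measure E) [μ.IsAddHaarMeasure]
    [TopologicalSpace F] [ContinuousENorm F] {c : ℝ} (hc : 0 < c) (f : E → F) (p : ℝ≥0∞)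
    {S : Set E} (hS : MeasurableSet S) :
    eLpNorm (fun x => f (c • x)) p (μ.restrict ((fun x => c • x) ⁻¹' S)) =
      ENNReal.ofReal (c ^ (-(Module.finrank ℝ E * (p⁻¹).toReal))) * eLpNorm f p (μ.restrict S) := by
  have hemb : MeasurableEmbedding fun x : E => c • x :=
    (Homeomorph.smulOfNeZero c hc.ne').measurableEmbedding
  have h1 := hemb.eLpNorm_map_measure (μ := μ.restrict ((fun x => c • x) ⁻¹' S)) (g := f) (p := p)
  rw [← Measure.restrict_map hemb.measurable hS, Measure.map_addHaar_smul _ hc.ne',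
    Measure.restrict_smul] at h1
  have hpos : 0 < |(c ^ Module.finrank ℝ E)⁻¹| := by positivity
  rw [eLpNorm_smul_measure_of_ne_zero (by simpa using hpos), smul_eq_mul] at h1
  refine (Eq.trans ?_ h1.symm).trans ?_
  · rfl
  · congr 1
    rw [ENNReal.ofReal_rpow_of_pos hpos, abs_of_pos (by positivity), ← Real.rpow_natCast,
      ← Real.rpow_neg hc.le, ← Real.rpow_mul hc.le, one_div, neg_mul]

theorem smul_preimage_ball {E : Type*} [NormedAddCommGroup E] [NormedSpace ℝ E] {R : ℝ}
    (hR : 0 < R) : (fun x : E => R • x) ⁻¹' Metric.ball 0 R = Metric.ball 0 1 := by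
  ext x
  simp only [mem_preimage, mem_ball_zero_iff, norm_smul, Real.norm_eq_abs, abs_of_pos hR]
  constructor <;> intro h <;> nlinarith

theorem smul_preimage_Ioo {c : ℝ} (hc : 0 < c) :
    (fun t : ℝ => c • t) ⁻¹' Ioo (-c) 0 = Ioo (-1) 0 := by
  ext t
  simp only [mem_preimage, mem_Ioo, smul_eq_mul]
  refine and_congr ?_ ?_ <;> constructor <;> intro h <;> nlinarith

theorem eLpNorm_slice_comp_dilation {n : ℕ} (q : ℝ≥0∞) {R : ℝ} (hR : 0 < R)
    (b : SpaceTime n → EuclideanSpace ℝ (Fin n)) (s : ℝ) :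
    eLpNorm (fun x => R • b (dilation n hR (x, s))) q
      (volume.restrict (Metric.ball (0 : EuclideanSpace ℝ (Fin n)) 1)) =
    ENNReal.ofReal (R * R ^ (-(n * (q⁻¹).toReal))) * eLpNorm (fun x => b (x, R ^ 2 * s)) q
      (volume.restrict (Metric.ball (0 : EuclideanSpace ℝ (Fin n)) R)) := by
  have h2 := eLpNorm_comp_smul (volume : Measure (EuclideanSpace ℝ (Fin n))) hR
    (fun x => b (x, R ^ 2 * s)) q (Metric.isOpen_ball (x := 0) (ε := R)).measurableSet
  rw [smul_preimage_ball hR, finrank_euclideanSpace_fin] at h2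
  refine (eLpNorm_const_smul R (fun x => b (dilation n hR (x, s))) q _).trans ?_
  rw [ENNReal.ofReal_mul hR.le, mul_assoc, ← h2, Real.enorm_eq_ofReal hR.le]
  simp only [dilation_apply]

theorem eLpNorm_const_mul_comp_le (l : ℝ≥0∞) {c : ℝ} (hc : 0 < c) (k : ℝ) (N : ℝ → ℝ≥0∞) :
    eLpNorm (fun s => ENNReal.ofReal k * N (c * s)) l (volume.restrict (Ioo (-1) 0)) ≤
      ENNReal.ofReal k * (ENNReal.ofReal (c ^ (-(l⁻¹).toReal)) *
        eLpNorm N l (volume.restrict (Ioo (-c) 0))) := by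
  have h3 := eLpNorm_comp_smul (volume : Measure ℝ) hc N l
    (measurableSet_Ioo (a := -c) (b := (0 : ℝ)))
  rw [smul_preimage_Ioo hc, Module.finrank_self, Nat.cast_one, one_mul] at h3
  rw [← h3]
  exact eLpNorm_le_nnreal_smul_eLpNorm_of_ae_le_mul' (c := k.toNNReal)
    (Eventually.of_forall fun s => le_rfl) l

/-- The powers of `R` are `1` from the factor of `b`, `-n/q` from the space norm and `-2/ℓ` from the
time norm; they sum to `-α`. -/
theorem mixedNorm_comp_dilation_le {n : ℕ} (q l : ℝ≥0∞) {R : ℝ} (hR : 0 < R)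
    (b : SpaceTime n → EuclideanSpace ℝ (Fin n)) :
    mixedNorm q l 1 (fun z => R • b (dilation n hR z)) ≤ scaledNorm q l R b := by
  have h := eLpNorm_const_mul_comp_le l (pow_pos hR 2) (R * R ^ (-(n * (q⁻¹).toReal)))
    fun t => eLpNorm (fun x => b (x, t)) q
      (volume.restrict (Metric.ball (0 : EuclideanSpace ℝ (Fin n)) R))
  simp only [← eLpNorm_slice_comp_dilation q hR b] at h
  rw [mixedNorm, one_pow]
  refine h.trans (le_of_eq ?_)
  rw [← mul_assoc, ← ENNReal.ofReal_mul (by positivity), scaledNorm, mixedNorm]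
  congr 2
  have e : R * R ^ (-(n * (q⁻¹).toReal)) = R ^ (1 + -(n * (q⁻¹).toReal)) := by
    rw [Real.rpow_add hR, Real.rpow_one]
  rw [e, ← Real.rpow_natCast R 2, ← Real.rpow_mul hR.le, ← Real.rpow_add hR, alpha]
  congr 1
  push_cast
  ring

/-! ### From mixed norms of the drift to the weight. -/

theorem mixedNorm_congr {n : ℕ} (q l : ℝ≥0∞) {R : ℝ}
    {b b' : SpaceTime n → EuclideanSpace ℝ (Fin n)} (h : b =ᵐ[volume.restrict (cyl n R)] b') :
    mixedNorm q l R b = mixedNorm q l R b' := by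
  have h1 : ∀ᵐ z ∂((volume.restrict (Ioo (-R ^ 2) 0)).prod
      (volume.restrict (Metric.ball (0 : EuclideanSpace ℝ (Fin n)) R))), b z.swap = b' z.swap := by
    rw [cyl, Measure.volume_eq_prod, ← Measure.prod_restrict] at h
    exact Measure.measurePreserving_swap.quasiMeasurePreserving.ae h
  refine eLpNorm_congr_ae ?_
  filter_upwards [Measure.ae_ae_of_ae_prod h1] with t ht
  exact eLpNorm_congr_ae ht

theorem measurable_eLpNorm_slice {n : ℕ} {q : ℝ} (hq : 0 < q)
    {f : SpaceTime n → ℝ≥0∞} (hf : Measurable f)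
    (μ : Measure (EuclideanSpace ℝ (Fin n))) [SFinite μ] :
    Measurable fun t : ℝ => eLpNorm (fun x => f (x, t)) (ENNReal.ofReal q) μ := by
  have e : ∀ t : ℝ, eLpNorm (fun x => f (x, t)) (ENNReal.ofReal q) μ =
      (∫⁻ x, f (x, t) ^ q ∂μ) ^ (1 / q) := fun t => by
    rw [eLpNorm_eq_lintegral_rpow_enorm_toReal (by simpa using hq) ENNReal.ofReal_ne_top,
      ENNReal.toReal_ofReal hq.le]
    simp only [enorm_eq_self]
  simp only [e]
  exact ((hf.pow_const q).lintegral_prod_left').pow_const _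

theorem weightNorm_eq {n : ℕ} {q l : ℝ} (hq : 0 < q) (hl : 0 < l)
    (b : SpaceTime n → EuclideanSpace ℝ (Fin n)) :
    weightNorm q l b = eLpNorm (fun t : ℝ => eLpNorm (fun x => weight b (x, t)) (ENNReal.ofReal q)
      (volume.restrict (Metric.ball (0 : EuclideanSpace ℝ (Fin n)) 1)))
      (ENNReal.ofReal l) (volume.restrict (Ioo (-1) 0)) ^ l := by
  rw [eLpNorm_eq_lintegral_rpow_enorm_toReal (by simpa using hl) ENNReal.ofReal_ne_top,
    ENNReal.toReal_ofReal hl.le, ← ENNReal.rpow_mul, one_div_mul_cancel hl.ne', ENNReal.rpow_one,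
    weightNorm]
  refine lintegral_congr fun t => ?_
  rw [enorm_eq_self, eLpNorm_eq_lintegral_rpow_enorm_toReal (by simpa using hq)
    ENNReal.ofReal_ne_top, ENNReal.toReal_ofReal hq.le, ← ENNReal.rpow_mul, one_div_mul_eq_div]
  simp only [enorm_eq_self]

/-- A bound in `L_{q,ℓ}` gives a bound of the weight in a weaker mixed norm. -/
theorem exists_weightNorm_le_of_le (n : ℕ) {q l : ℝ≥0∞} {q₁ l₁ : ℝ} (hq₁ : 1 < q₁) (hl₁ : 1 < l₁)
    (hq : ENNReal.ofReal q₁ ≤ q) (hl : ENNReal.ofReal l₁ ≤ l) (K : ℝ≥0) :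
    ∃ K₁ : ℝ≥0, ∀ b : SpaceTime n → EuclideanSpace ℝ (Fin n), Measurable b →
      mixedNorm q l 1 b ≤ K → weightNorm q₁ l₁ b ≤ K₁ := by
  set μ := (volume : Measure (EuclideanSpace ℝ (Fin n))).restrict (Metric.ball 0 1) with hμ
  set τ := (volume : Measure ℝ).restrict (Ioo (-1) 0) with hτ
  have : IsProbabilityMeasure τ := ⟨by simp [hτ]⟩
  have hV : μ univ = volume (Metric.ball (0 : EuclideanSpace ℝ (Fin n)) 1) := by simp [hμ]
  have hV0 : μ univ ≠ 0 := by rw [hV]; exact (Metric.measure_ball_pos _ _ one_pos).ne'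
  have hVfin : μ univ ≠ ⊤ := by rw [hV]; exact Metric.isBounded_ball.measure_lt_top.ne
  have hμ0 : μ ≠ 0 := fun h => hV0 (by simp [h])
  have hq1 : (1 : ℝ≥0∞) ≤ ENNReal.ofReal q₁ := ENNReal.one_le_ofReal.2 hq₁.le
  have hl1 : (1 : ℝ≥0∞) ≤ ENNReal.ofReal l₁ := ENNReal.one_le_ofReal.2 hl₁.le
  set c₁ : ℝ≥0∞ := eLpNorm (fun _ : EuclideanSpace ℝ (Fin n) => (1 : ℝ≥0∞)) (ENNReal.ofReal q₁) μ
    with hc₁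
  have hc₁fin : c₁ ≠ ⊤ := by
    rw [hc₁, eLpNorm_const _ (by positivity) hμ0]
    refine ENNReal.mul_ne_top (by simp) (ENNReal.rpow_ne_top_of_nonneg (by positivity) hVfin)
  set c₂ : ℝ≥0∞ := μ univ ^ (1 / (ENNReal.ofReal q₁).toReal - 1 / q.toReal) with hc₂
  have hc₂fin : c₂ ≠ ⊤ := by
    rw [hc₂, Ne, ENNReal.rpow_eq_top_iff]
    tauto
  have hXfin : (c₁ + c₂ * K) ^ l₁ ≠ ⊤ := ENNReal.rpow_ne_top_of_nonneg (by linarith)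
    (ENNReal.add_ne_top.2 ⟨hc₁fin, ENNReal.mul_ne_top hc₂fin ENNReal.coe_ne_top⟩)
  refine ⟨((c₁ + c₂ * K) ^ l₁).toNNReal, fun b hb hbK => ?_⟩
  rw [ENNReal.coe_toNNReal hXfin, weightNorm_eq (by linarith) (by linarith)]
  refine ENNReal.rpow_le_rpow ?_ (by linarith)
  set N₁ : ℝ → ℝ≥0∞ := fun t => eLpNorm (fun x => ‖b (x, t)‖ₑ) (ENNReal.ofReal q₁) μ with hN₁
  set N : ℝ → ℝ≥0∞ := fun t => eLpNorm (fun x => b (x, t)) q μ with hN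
  have hN₁m : Measurable N₁ := measurable_eLpNorm_slice (by linarith) hb.enorm μ
  have hbs : ∀ t : ℝ, Measurable fun x => b (x, t) := fun t => hb.comp measurable_prodMk_right
  have hW : ∀ t, eLpNorm (fun x => weight b (x, t)) (ENNReal.ofReal q₁) μ ≤ c₁ + N₁ t := fun t =>
    eLpNorm_add_le (f := fun _ : EuclideanSpace ℝ (Fin n) => (1 : ℝ≥0∞))
      (g := fun x => ‖b (x, t)‖ₑ) aestronglyMeasurable_const
      (hbs t).enorm.aestronglyMeasurable hq1
  have hN₁N : ∀ t, N₁ t ≤ c₂ * N t := fun t => by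
    have := eLpNorm_le_eLpNorm_mul_rpow_measure_univ (μ := μ) hq (hbs t).aestronglyMeasurable
    rw [mul_comm]
    refine le_trans (le_of_eq ?_) this
    exact eLpNorm_enorm _
  calc eLpNorm (fun t : ℝ => eLpNorm (fun x => weight b (x, t)) (ENNReal.ofReal q₁) μ)
        (ENNReal.ofReal l₁) τ
      ≤ eLpNorm ((fun _ => c₁) + N₁) (ENNReal.ofReal l₁) τ :=
        eLpNorm_mono_enorm fun t => by
          rw [enorm_eq_self, enorm_eq_self]
          exact hW t
    _ ≤ eLpNorm (fun _ => c₁) (ENNReal.ofReal l₁) τ + eLpNorm N₁ (ENNReal.ofReal l₁) τ :=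
        eLpNorm_add_le aestronglyMeasurable_const hN₁m.aestronglyMeasurable hl1
    -- The order matters: the time exponent is raised on `N₁`, whose measurability comes from
    -- Tonelli. The comparison `N₁ ≤ c₂ N` comes afterwards by monotonicity, so `N` is never
    -- required to be measurable, even for `q = ∞`.
    _ ≤ c₁ + eLpNorm N₁ l τ := by
        refine add_le_add (le_of_eq ?_)
          (eLpNorm_le_eLpNorm_of_exponent_le hl hN₁m.aestronglyMeasurable)
        rw [eLpNorm_const _ (by positivity) (IsProbabilityMeasure.ne_zero τ)]
        simp
    _ ≤ c₁ + c₂ * mixedNorm q l 1 b := by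
        refine add_le_add le_rfl ?_
        have := eLpNorm_le_nnreal_smul_eLpNorm_of_ae_le_mul' (μ := τ) (f := N₁) (g := N)
          (c := c₂.toNNReal) (Eventually.of_forall fun t => by
            rw [ENNReal.coe_toNNReal hc₂fin]; exact hN₁N t) l
        rw [ENNReal.smul_def, ENNReal.coe_toNNReal hc₂fin, smul_eq_mul] at this
        rw [mixedNorm, one_pow]
        exact this
    _ ≤ _ := by gcongr

/-- The condition is strict, so both reciprocals can be increased slightly. This makes the exponents
finite, keeps them above one, and disposes of `q = ∞` and `ℓ = ∞`. -/
theorem exists_real_exponents {n : ℕ} (hn : 2 ≤ n) {q l : ℝ≥0∞} (hq : 1 ≤ q) (hl : 1 ≤ l)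
    (hα : alpha n q l < 1) :
    ∃ q₁ l₁ : ℝ, 1 < q₁ ∧ 1 < l₁ ∧ (n : ℝ) / (2 * q₁) + 1 / l₁ < 1 ∧
      ENNReal.ofReal q₁ ≤ q ∧ ENNReal.ofReal l₁ ≤ l := by
  set x := (q⁻¹).toReal with hx
  set y := (l⁻¹).toReal with hy
  have hx0 : 0 ≤ x := ENNReal.toReal_nonneg
  have hy0 : 0 ≤ y := ENNReal.toReal_nonneg
  have hn' : (2 : ℝ) ≤ n := by exact_mod_cast hn
  have hgap : n * x / 2 + y < 1 := by
    rw [alpha] at hα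
    linarith
  -- Adding `ε` to both reciprocals uses up exactly half of the gap.
  set ε := (1 - (n * x / 2 + y)) / (n + 2) with hε
  have hε0 : 0 < ε := div_pos (by linarith) (by linarith)
  have hεn : ε * (n + 2) = 1 - (n * x / 2 + y) := div_mul_cancel₀ _ (by positivity)
  have hnx : x ≤ n * x / 2 := by nlinarith
  have hεle : ε ≤ (1 - (n * x / 2 + y)) / 4 := by nlinarith
  have key : ∀ {p : ℝ≥0∞}, 1 ≤ p → ENNReal.ofReal ((p⁻¹).toReal + ε)⁻¹ ≤ p := fun {p} hp => by
    rw [ENNReal.ofReal_inv_of_pos (by positivity), ENNReal.inv_le_iff_inv_le,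
      ENNReal.ofReal_add ENNReal.toReal_nonneg hε0.le, ENNReal.ofReal_toReal (by simp; positivity)]
    exact le_self_add
  refine ⟨(x + ε)⁻¹, (y + ε)⁻¹, (one_lt_inv₀ (by linarith)).2 (by linarith),
    (one_lt_inv₀ (by linarith)).2 (by linarith), ?_, key hq, key hl⟩
  have e : (n : ℝ) / (2 * (x + ε)⁻¹) + 1 / (y + ε)⁻¹ = n * x / 2 + y + ε * (n + 2) / 2 := by
    field_simp
    ring
  rw [e, hεn]
  linarith

/-! ### Oscillation decay at every scale. -/

theorem cyl_one (n : ℕ) : cyl n 1 = slab n (-1) 0 := by rw [cyl, slab, one_pow]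

theorem isBounded_cyl (n : ℕ) (R : ℝ) : Bornology.IsBounded (cyl n R) :=
  Metric.isBounded_ball.prod (Metric.isBounded_Ioo _ _)

theorem cyl_nonempty (n : ℕ) {R : ℝ} (hR : 0 < R) : (cyl n R).Nonempty :=
  ⟨(0, -(R ^ 2 / 2)), by simpa using hR, by
    have : 0 < R ^ 2 := by positivity
    constructor <;> simp only <;> linarith⟩

theorem dilation_mem_cyl_iff {n : ℕ} {R : ℝ} (hR : 0 < R) {r : ℝ} {z : SpaceTime n} :
    dilation n hR z ∈ cyl n (R * r) ↔ z ∈ cyl n r := by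
  have h2 : 0 < R ^ 2 := by positivity
  simp only [cyl, dilation_apply, mem_prod, mem_ball_zero_iff, norm_smul,
    Real.norm_eq_abs, abs_of_pos hR, mem_Ioo, mul_pow, mul_lt_mul_iff_right₀ hR, ← mul_neg,
    mul_lt_mul_iff_right₀ h2]
  rw [mul_neg_iff]
  simp [h2, h2.not_gt]

theorem osc_le_of_forall {X : Type*} {f : X → ℝ} {S : Set X} (hS : S.Nonempty) {m M : ℝ}
    (hm : ∀ z ∈ S, m ≤ f z) (hM : ∀ z ∈ S, f z ≤ M) : osc f S ≤ M - m :=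
  sub_le_sub (csSup_le (hS.image f) (forall_mem_image.2 hM))
    (le_csInf (hS.image f) (forall_mem_image.2 hm))

theorem osc_mono {X : Type*} {f : X → ℝ} {S T : Set X} (hS : S.Nonempty) (hST : S ⊆ T)
    (hT : Bornology.IsBounded (f '' T)) : osc f S ≤ osc f T :=
  osc_le_of_forall hS (fun _ hz => csInf_le hT.bddBelow (mem_image_of_mem f (hST hz)))
    fun _ hz => le_csSup hT.bddAbove (mem_image_of_mem f (hST hz))

theorem IsLipschitzSolution.isBounded_image {n : ℕ} {R : ℝ}
    {a : SpaceTime n → Matrix (Fin n) (Fin n) ℝ} {b : SpaceTime n → EuclideanSpace ℝ (Fin n)}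
    {u : SpaceTime n → ℝ} (h : IsLipschitzSolution (cyl n R) a b u) :
    Bornology.IsBounded (u '' cyl n R) := by
  obtain ⟨C, hC⟩ := h.lipschitz
  obtain ⟨w, hw, hwu⟩ := hC.extend_real
  rw [hwu.image_eq]
  exact hw.isBounded_image (isBounded_cyl n R)

theorem DivNonpos.congr {n : ℕ} {Q : Set (SpaceTime n)}
    {b b' : SpaceTime n → EuclideanSpace ℝ (Fin n)} (h : DivNonpos Q b)
    (hb : b =ᵐ[volume.restrict Q] b') : DivNonpos Q b' := fun φ h1 h2 h3 h4 => by
  have := h φ h1 h2 h3 h4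
  rwa [integral_congr_ae (g := fun z => ∑ i, b' z i * spaceDeriv i φ z)] at this
  filter_upwards [hb] with z hz
  rw [hz]

/-- Normalization of a Lipschitz solution on the unit cylinder, extended to the whole space. -/
theorem IsLipschitzSolution.exists_unitSolution {n : ℕ} {ν : ℝ} (hν : 0 < ν)
    {a : SpaceTime n → Matrix (Fin n) (Fin n) ℝ} {b b' : SpaceTime n → EuclideanSpace ℝ (Fin n)}
    {u : SpaceTime n → ℝ} (h : IsLipschitzSolution (cyl n 1) a b u)
    (ha : UniformlyParabolic ν (cyl n 1) a) (hdiv : DivNonpos (cyl n 1) b)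
    (hbb : b =ᵐ[volume.restrict (cyl n 1)] b') (hb' : IntegrableOn b' (cyl n 1))
    {m ω : ℝ} (hω : 0 < ω) (hm : ∀ z ∈ cyl n 1, m ≤ u z) (hM : ∀ z ∈ cyl n 1, u z ≤ m + ω) :
    ∃ v : SpaceTime n → ℝ, UnitSolution ν a b' v ∧ (∀ z, v z ≤ 1) ∧
      ∀ z ∈ cyl n 1, v z = ω⁻¹ * u z + -(ω⁻¹ * m) := by
  obtain ⟨C, hC⟩ := h.lipschitz
  obtain ⟨w, hw, hwu⟩ := hC.extend_real
  -- Clamping makes the extended function lie in `[0, 1]` everywhere; on the open cylinder it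
  -- changes neither the values nor the derivatives.
  set v : SpaceTime n → ℝ := fun z => max 0 (min 1 (ω⁻¹ * w z + -(ω⁻¹ * m))) with hv
  have hvu : ∀ z ∈ cyl n 1, v z = ω⁻¹ * u z + -(ω⁻¹ * m) := fun z hz => by
    have h1 : 0 ≤ ω⁻¹ * (u z - m) := mul_nonneg (by positivity) (by linarith [hm z hz])
    have h2 : ω⁻¹ * (u z - m) ≤ 1 := by
      rw [inv_mul_le_iff₀ hω]; linarith [hM z hz]
    simp only [hv, ← hwu hz]
    rw [min_eq_right (by linarith), max_eq_right (by linarith)]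
  have hderiv : ∀ z ∈ cyl n 1, ∀ d : SpaceTime n, lineDeriv ℝ v z d = ω⁻¹ * lineDeriv ℝ u z d :=
    fun z hz d => by
    have he : v =ᶠ[𝓝 z] fun z => ω⁻¹ * u z + -(ω⁻¹ * m) := by
      filter_upwards [(isOpen_cyl n 1).mem_nhds hz] with y hy using hvu y hy
    rw [he.lineDeriv_eq (𝕜 := ℝ), lineDeriv_affine]
  refine ⟨v, ⟨hν, ha, hb', hdiv.congr hbb, ?_, fun z => le_max_left _ _, fun η h1 h2 h3 => ?_⟩,
    fun z => max_le zero_le_one (min_le_left _ _), hvu⟩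
  · have h1 : LipschitzWith (‖ω⁻¹‖₊ * C) fun z => ω⁻¹ * w z + -(ω⁻¹ * m) :=
      LipschitzWith.of_dist_le_mul fun x y => by
        rw [Real.dist_eq, add_sub_add_right_eq_sub, ← mul_sub, abs_mul, ← Real.dist_eq]
        push_cast
        rw [Real.norm_eq_abs, mul_assoc]
        exact mul_le_mul_of_nonneg_left (hw.dist_le_mul x y) (abs_nonneg _)
    exact ⟨_, (h1.const_min 1).const_max 0⟩
  · have := h.weak η h1 h2 h3
    rw [← mul_zero ω⁻¹, ← this, ← integral_const_mul]
    refine integral_congr_ae ?_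
    filter_upwards [hbb, ae_restrict_mem (measurableSet_cyl n 1)] with z hbz hz
    simp only [timeDeriv, spaceDeriv, hderiv z hz, ← hbz, mul_add, Finset.mul_sum, Finset.sum_mul]
    congr 1
    · congr 1
      · ring
      · exact Finset.sum_congr rfl fun i _ => Finset.sum_congr rfl fun j _ => by ring
    · exact Finset.sum_congr rfl fun i _ => by ring

/-- Decay of the oscillation from one scale to the next. -/
theorem exists_osc_le {n : ℕ} (hn : 2 ≤ n) {ν : ℝ} (hν : 0 < ν) {q l : ℝ≥0∞} (hq : 1 ≤ q)
    (hl : 1 ≤ l) (hα : alpha n q l < 1) (K : ℝ≥0) :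
    ∃ ρ δ : ℝ, 0 < ρ ∧ ρ < 1 ∧ 0 < δ ∧ δ < 1 ∧ ∀ (R : ℝ)
      (a : SpaceTime n → Matrix (Fin n) (Fin n) ℝ) (b : SpaceTime n → EuclideanSpace ℝ (Fin n))
      (u : SpaceTime n → ℝ), 0 < R → UniformlyParabolic ν (cyl n R) a →
      AEStronglyMeasurable b (volume.restrict (cyl n R)) → DivNonpos (cyl n R) b →
      scaledNorm q l R b ≤ K → IsLipschitzSolution (cyl n R) a b u →
      osc u (cyl n (R * ρ)) ≤ (1 - δ) * osc u (cyl n R) := by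
  obtain ⟨q₁, l₁, hq₁, hl₁, hql, hqq, hll⟩ := exists_real_exponents hn hq hl hα
  obtain ⟨K₁, hK₁⟩ := exists_weightNorm_le_of_le n hq₁ hl₁ hqq hll K
  obtain ⟨ρ, δ, hρ, hρ1, hδ, H⟩ := exists_oscillation_decay hn hq₁ hl₁ hql ν K₁
  obtain ⟨s, A, hs, hsmall⟩ := exists_lintegral_weight_le n hq₁ hl₁
  -- The minimum keeps `1 - δ'` positive, since its logarithm will be the numerator of the Hölder
  -- exponent.
  refine ⟨ρ, min δ (1 / 2), hρ, hρ1, lt_min hδ (by norm_num),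
    (min_le_right _ _).trans_lt (by norm_num), fun R a b u hR ha hb hdiv hK h => ?_⟩
  set δ' := min δ (1 / 2)
  have hδδ : δ' ≤ δ := min_le_left _ _
  have hbd := h.isBounded_image
  have hmem : ∀ z ∈ cyl n 1, dilation n hR z ∈ cyl n R := fun z hz => by
    rw [← dilation_preimage_cyl hR] at hz; exact hz
  have hsub : cyl n (R * ρ) ⊆ cyl n R := cyl_mono (by positivity) (by nlinarith)
  have hne : (cyl n (R * ρ)).Nonempty := cyl_nonempty n (by positivity)
  set m := sInf (u '' cyl n R) with hm
  set M := sSup (u '' cyl n R) with hM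
  have hmu : ∀ z ∈ cyl n R, m ≤ u z := fun z hz => csInf_le hbd.bddBelow (mem_image_of_mem u hz)
  have hMu : ∀ z ∈ cyl n R, u z ≤ M := fun z hz => le_csSup hbd.bddAbove (mem_image_of_mem u hz)
  have hosc : osc u (cyl n R) = M - m := rfl
  have hmono := osc_mono hne hsub hbd
  obtain ⟨z₀, hz₀⟩ := cyl_nonempty n hR
  -- For zero oscillation there is nothing to normalize by, and monotonicity suffices.
  rcases (sub_nonneg.2 ((hmu z₀ hz₀).trans (hMu z₀ hz₀))).eq_or_lt with h0 | hω
  · rw [hosc, ← h0] at hmono ⊢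
    simpa using hmono
  have hbs : AEStronglyMeasurable (fun z => R • b (dilation n hR z)) (volume.restrict (cyl n 1)) :=
    (hb.comp_quasiMeasurePreserving (quasiMeasurePreserving_dilation n hR)).const_smul R
  set b' := hbs.mk with hb'
  have hb'm : Measurable b' := hbs.stronglyMeasurable_mk.measurable
  have hbb := hbs.ae_eq_mk
  have hw : weightNorm q₁ l₁ b' ≤ K₁ := hK₁ b' hb'm (by
    rw [← mixedNorm_congr q l hbb]
    exact (mixedNorm_comp_dilation_le q l hR b).trans hK)
  -- Integrability of the drift follows from the weight estimate applied to the whole cylinder.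
  have hint : IntegrableOn b' (cyl n 1) := by
    refine ⟨hb'm.aestronglyMeasurable, ?_⟩
    rw [cyl_one]
    refine lt_of_le_of_lt (lintegral_mono fun z => ?_)
      ((hsmall b' hb'm _ (measurableSet_slab n (-1) 0) subset_rfl).trans_lt ?_)
    · exact le_add_self
    · refine ENNReal.mul_lt_top (ENNReal.mul_lt_top ENNReal.coe_lt_top ?_) ?_
      · exact ENNReal.rpow_lt_top_of_nonneg (by positivity) (hw.trans_lt ENNReal.coe_lt_top).ne
      · exact ENNReal.rpow_lt_top_of_nonneg hs.le (volume_slab_lt_top n _ _).ne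
  obtain ⟨v, hv, hv1, hvu⟩ := (h.comp_dilation hR).exists_unitSolution hν (ha.comp_dilation hR)
    (hdiv.comp_dilation hR) hbb hint hω (m := m) (fun z hz => hmu _ (hmem z hz))
    (fun z hz => by linarith [hMu _ (hmem z hz)])
  have hback : ∀ y ∈ cyl n (R * ρ), ∃ z ∈ cyl n ρ, u y - m = (M - m) * v z := fun y hy => by
    obtain ⟨z, rfl⟩ := (dilation n hR).surjective y
    rw [dilation_mem_cyl_iff] at hy
    refine ⟨z, hy, ?_⟩
    rw [hvu z (cyl_mono hρ.le hρ1.le hy)]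
    field_simp
    ring
  rw [hosc]
  rcases H _ b' v hv hv1 hb'm hw with hlow | hup
  · refine (osc_le_of_forall hne (m := m + δ' * (M - m)) (M := M) (fun y hy => ?_)
      fun y hy => hMu y (hsub hy)).trans (by linarith)
    obtain ⟨z, hz, hyz⟩ := hback y hy
    nlinarith [hlow z hz]
  · refine (osc_le_of_forall hne (m := m) (M := M - δ' * (M - m)) (fun y hy => hmu y (hsub hy))
      fun y hy => ?_).trans (by linarith)
    obtain ⟨z, hz, hyz⟩ := hback y hy
    nlinarith [hup z hz]

/-! ### Iteration over scales and the Hölder estimate. -/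

/-- Geometric decay along scales gives a power bound. -/
theorem exists_rpow_bound {ρ δ : ℝ} (hρ : 0 < ρ) (hρ1 : ρ < 1) (hδ : 0 < δ) (hδ1 : δ < 1) :
    ∃ N γ : ℝ, 0 < N ∧ 0 < γ ∧ ∀ (f : ℝ → ℝ) (r : ℝ), 0 < r →
      (∀ s t, 0 < s → s ≤ t → t ≤ r → f s ≤ f t) →
      (∀ s, 0 < s → s ≤ r → f (s * ρ) ≤ (1 - δ) * f s) → 0 ≤ f r →
      ∀ s, 0 < s → s ≤ r → f s ≤ N * (s / r) ^ γ * f r := by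
  have hlogρ : Real.log ρ < 0 := Real.log_neg hρ hρ1
  have hδ' : 0 < 1 - δ := by linarith
  have hlogδ : Real.log (1 - δ) < 0 := Real.log_neg hδ' (by linarith)
  -- The solution of `ρ^γ = 1 - δ`.
  set γ := Real.log (1 - δ) / Real.log ρ with hγ
  have hγ0 : 0 < γ := div_pos_of_neg_of_neg hlogδ hlogρ
  have hpow : ρ ^ γ = 1 - δ := by
    rw [Real.rpow_def_of_pos hρ, hγ, mul_div_cancel₀ _ hlogρ.ne, Real.exp_log hδ']
  refine ⟨(1 - δ)⁻¹, γ, by positivity, hγ0, fun f r hr hmono hstep hf s hs hsr => ?_⟩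
  -- `s / r` lies between `ρ^{k+1}` and `ρ^k`. Only `k` reductions apply to `s`, and the missing one
  -- produces the constant `(1 - δ)⁻¹`.
  obtain ⟨k, hk1, hk2⟩ := exists_nat_pow_near_of_lt_one (div_pos hs hr) ((div_le_one hr).2 hsr)
    hρ hρ1
  have hiter : ∀ j : ℕ, f (r * ρ ^ j) ≤ (1 - δ) ^ j * f r := fun j => by
    induction j with
    | zero => simp
    | succ j ih =>
      have h1 := hstep (r * ρ ^ j) (by positivity)
        (mul_le_of_le_one_right hr.le (pow_le_one₀ hρ.le hρ1.le))
      rw [pow_succ, ← mul_assoc]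
      refine h1.trans ?_
      calc (1 - δ) * f (r * ρ ^ j) ≤ (1 - δ) * ((1 - δ) ^ j * f r) :=
            mul_le_mul_of_nonneg_left ih hδ'.le
        _ = _ := by ring
  have h1 : s ≤ r * ρ ^ k := by rw [div_le_iff₀ hr] at hk2; linarith
  have h2 : (1 - δ) ^ k ≤ (1 - δ)⁻¹ * (s / r) ^ γ := by
    have h3 : (ρ ^ (k + 1)) ^ γ ≤ (s / r) ^ γ :=
      Real.rpow_le_rpow (by positivity) hk1.le hγ0.le
    have h4 : (ρ ^ (k + 1)) ^ γ = (1 - δ) ^ (k + 1) := by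
      rw [← hpow, ← Real.rpow_natCast, ← Real.rpow_natCast, ← Real.rpow_mul hρ.le,
        ← Real.rpow_mul hρ.le, mul_comm]
    rw [h4] at h3
    rw [le_inv_mul_iff₀ hδ', ← pow_succ']
    exact h3
  calc f s ≤ f (r * ρ ^ k) := hmono _ _ hs h1
        (mul_le_of_le_one_right hr.le (pow_le_one₀ hρ.le hρ1.le))
    _ ≤ (1 - δ) ^ k * f r := hiter k
    _ ≤ _ := mul_le_mul_of_nonneg_right h2 hf

/-- Hölder estimate for Lipschitz solutions, in terms of oscillations on parabolic cylinders. -/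
theorem exists_holder_estimate (n : ℕ) (hn : 2 ≤ n) (ν : ℝ) (hν : 0 < ν)
    (q l : ℝ≥0∞) (hq : 1 ≤ q) (hl : 1 ≤ l)
    (hα : alpha n q l ∈ Set.Ico (0 : ℝ) 1) (K : ℝ≥0) :
    ∃ N₅ γ₁ : ℝ, 0 < N₅ ∧ 0 < γ₁ ∧
      ∀ (R₀ : ℝ) (a : SpaceTime n → Matrix (Fin n) (Fin n) ℝ)
        (b : SpaceTime n → EuclideanSpace ℝ (Fin n))
        (u : SpaceTime n → ℝ),
        0 < R₀ →
        UniformlyParabolic ν (cyl n R₀) a →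
        MemMixed q l R₀ b →
        DivNonpos (cyl n R₀) b →
        (⨆ R ∈ Set.Ioo 0 R₀, scaledNorm q l R b) ≤ (K : ℝ≥0∞) →
        IsLipschitzSolution (cyl n R₀) a b u →
        ∀ ρ r : ℝ, 0 < ρ → ρ < r → r ≤ R₀ →
          osc u (cyl n ρ) ≤
            N₅ * (ρ / r) ^ γ₁ * osc u (cyl n r) := by
  obtain ⟨κ, δ, hκ, hκ1, hδ, hδ1, H⟩ := exists_osc_le hn hν hq hl hα.2 K
  obtain ⟨N, γ, hN, hγ, hbound⟩ := exists_rpow_bound hκ hκ1 hδ hδ1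
  refine ⟨N, γ, hN, hγ, fun R₀ a b u hR₀ ha hb hdiv hK hu ρ r hρ hρr hr => ?_⟩
  have hm := measurableSet_cyl n R₀
  have hbd := hu.isBounded_image
  have hmono : ∀ s t, 0 < s → s ≤ t → t ≤ R₀ →
      osc u (cyl n s) ≤
        osc u (cyl n t) := fun s t hs hst ht =>
    osc_mono (cyl_nonempty n hs)
      (cyl_mono hs.le hst)
      (hbd.subset (image_mono (cyl_mono (hs.le.trans hst) ht)))
  have hstep : ∀ s, 0 < s → s < R₀ → osc u (cyl n (s * κ)) ≤
      (1 - δ) * osc u (cyl n s) := fun s hs hsR => by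
    have hsub := cyl_mono (n := n) hs.le hsR.le
    exact H s a b u hs (ha.mono hsub) (hb.1.mono_measure (Measure.restrict_mono hsub le_rfl))
      (hdiv.mono hm hsub)
      ((le_iSup₂ (f := fun R _ => scaledNorm q l R b) s ⟨hs, hsR⟩).trans hK)
      (hu.mono hm hsub)
  have hnonneg : ∀ s, 0 < s → s ≤ R₀ → 0 ≤ osc u (cyl n s) :=
    fun s hs hsR => by
    obtain ⟨z, hz⟩ := cyl_nonempty n hs
    have hb' := hbd.subset (image_mono (cyl_mono hs.le hsR))
    exact sub_nonneg.2 ((csInf_le hb'.bddBelow (mem_image_of_mem u hz)).trans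
      (le_csSup hb'.bddAbove (mem_image_of_mem u hz)))
  have hr0 : 0 < r := hρ.trans hρr
  -- The bound on `b` is assumed only for radii strictly below `R₀`, so the iteration is started
  -- from `t < r` and then `t` increases to `r`.
  have hcont : Tendsto (fun t => N * (ρ / t) ^ γ * osc u (cyl n r))
      (𝓝[<] r) (𝓝 (N * (ρ / r) ^ γ * osc u (cyl n r))) := by
    have h1 : Tendsto (fun t : ℝ => ρ / t) (𝓝 r) (𝓝 (ρ / r)) :=
      tendsto_const_nhds.div tendsto_id hr0.ne'
    exact (((h1.rpow_const (Or.inr hγ.le)).const_mul N).mul_const _).mono_left nhdsWithin_le_nhds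
  refine ge_of_tendsto hcont ?_
  filter_upwards [Ioo_mem_nhdsLT hρr] with t ht
  have ht0 : 0 < t := hρ.trans ht.1
  have htR : t < R₀ := ht.2.trans_le hr
  refine (hbound (fun s => osc u (cyl n s)) t ht0
    (fun s s' hs hss hs' => hmono s s' hs hss (hs'.trans htR.le))
    (fun s hs hst => hstep s hs (hst.trans_lt htR)) (hnonneg t ht0 htR.le) ρ hρ ht.1.le).trans ?_
  exact mul_le_mul_of_nonneg_left (hmono t r ht0 ht.2.le hr) (by positivity)

end ParabolicHolder

theorem corollary3p6 (n : ℕ) (hn : 2 ≤ n) (ν : ℝ) (hν : 0 < ν)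
    (q l : ℝ≥0∞) (hq : 1 ≤ q) (hl : 1 ≤ l)
    (hα : ParabolicHolder.alpha n q l ∈ Set.Ico (0 : ℝ) 1) (K : ℝ≥0) :
    ∃ N₅ γ₁ : ℝ, 0 < N₅ ∧ 0 < γ₁ ∧
      ∀ (R₀ : ℝ) (a : ParabolicHolder.SpaceTime n → Matrix (Fin n) (Fin n) ℝ)
        (b : ParabolicHolder.SpaceTime n → EuclideanSpace ℝ (Fin n))
        (u : ParabolicHolder.SpaceTime n → ℝ),
        0 < R₀ →
        ParabolicHolder.UniformlyParabolic ν (ParabolicHolder.cyl n R₀) a →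
        ParabolicHolder.MemMixed q l R₀ b →
        ParabolicHolder.DivNonpos (ParabolicHolder.cyl n R₀) b →
        (⨆ R ∈ Set.Ioo 0 R₀, ParabolicHolder.scaledNorm q l R b) ≤ (K : ℝ≥0∞) →
        ParabolicHolder.IsLipschitzSolution (ParabolicHolder.cyl n R₀) a b u →
        ∀ ρ r : ℝ, 0 < ρ → ρ < r → r ≤ R₀ →
          ParabolicHolder.osc u (ParabolicHolder.cyl n ρ) ≤
            N₅ * (ρ / r) ^ γ₁ * ParabolicHolder.osc u (ParabolicHolder.cyl n r) :=
  ParabolicHolder.exists_holder_estimate n hn ν hν q l hq hl hα K
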